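/- A \emph{Weinstein domain} $(V,\omega,X,\varphi)$ of dimension $2n$ is a compact smooth $2n$-dimensional manifold $V$ with boundary together with a symplectic form $\omega$ on $V$, a Liouville vector field $X$ (that is, $L_X\omega = d(\iota_X\omega)=\omega$) pointing outwards along $\partial V$, and a generalized Morse function $\varphi\colon V\to\mathbb{R}$ (every critical point is nondegenerate or embryonic, i.e. of birth--death type) such that $\partial V$ is a regular level set of $\varphi$ on which $\varphi$ attains its maximum, and such that $X$ is gradient-like for $\varphi$: $d\varphi(X)\ge\delta\,(|X|^2+|d\varphi|^2)$ for some Riemannian metric on $V$ and some constant $\delta>0$. \textbf{Lemma.} Let $V^{2n}$ be a Weinstein domain with $n\geq 3$. Then the inclusion map $i\colon\partial V\to V$ induces an isomorphism on $\pi_1$; that is, for every base point $b\in\partial V$ the homomorphism $i_*\colon\pi_1(\partial V,b)\to\pi_1(V,b)$ is an isomorphism. -/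

import Mathlib

open Set
open scoped Manifold ContDiff

/-! ### Differential forms on a manifold (possibly with boundary) -/

section Forms

variable {E : Type*} [NormedAddCommGroup E] [NormedSpace ℝ E]
  {H : Type*} [TopologicalSpace H] (I : ModelWithCorners ℝ E H)
  {M : Type*} [TopologicalSpace M] [ChartedSpace H M]

/-- A (not necessarily smooth) differential `k`-form on `M`. -/
abbrev MForm (M : Type*) [TopologicalSpace M] [ChartedSpace H M] (k : ℕ) :=
  ∀ x : M, TangentSpace I x [⋀^Fin k]→L[ℝ] ℝ

variable {I} {k : ℕ}

/-- The expression of a form in the chart around `x₀`: the pullback of the form under the inverse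
of the chart. It is meaningful on the target of the chart. -/
noncomputable def MForm.inChart (σ : MForm I M k) (x₀ : M) (y : E) : E [⋀^Fin k]→L[ℝ] ℝ :=
  (σ ((extChartAt I x₀).symm y)).compContinuousLinearMap
    (mfderivWithin 𝓘(ℝ, E) I (extChartAt I x₀).symm (range I) y : E →L[ℝ] _)

/-- A form is smooth if its expressions in the charts are smooth. -/
def MForm.IsSmooth (σ : MForm I M k) : Prop :=
  ∀ x₀ : M, ContDiffOn ℝ ∞ (σ.inChart x₀) (extChartAt I x₀).target

/-- The exterior derivative `dσ`, computed at `x` in the chart around `x` and pulled back to the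
manifold. -/
noncomputable def MForm.d (σ : MForm I M k) : MForm I M (k + 1) := fun x ↦
  (extDerivWithin (σ.inChart x) (range I) (extChartAt I x x)).compContinuousLinearMap
    (mfderiv I 𝓘(ℝ, E) (extChartAt I x) x)

/-- The interior product `ι_X σ = σ(X, ·, …, ·)`. -/
noncomputable def MForm.interiorProduct (X : ∀ x : M, TangentSpace I x)
    (σ : MForm I M (k + 1)) : MForm I M k := fun x ↦
  ContinuousAlternatingMap.curryLeft (E := E) (σ x) (X x)

/-- A symplectic form: a smooth closed nondegenerate `2`-form. -/
structure MForm.IsSymplectic (σ : MForm I M 2) : Prop where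
  smooth : σ.IsSmooth
  closed : ∀ x, σ.d x = 0
  nondegenerate : ∀ (x : M) (v : TangentSpace I x), (∀ w : TangentSpace I x, σ x ![v, w] = 0) → v = 0

/-- A Liouville vector field of a symplectic form `σ`: a smooth vector field with
`L_X σ = σ`, that is (`σ` being closed) `d(ι_X σ) = σ` (Cartan). -/
structure IsLiouvilleField [IsManifold I ∞ M] (σ : MForm I M 2) (X : ∀ x : M, TangentSpace I x) : Prop where
  smooth : ContMDiff I I.tangent ∞ (fun x ↦ (⟨x, X x⟩ : TangentBundle I M))
  d_interiorProduct : ∀ x, (MForm.interiorProduct X σ).d x = σ x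

end Forms

/-! ### Generalized Morse functions -/

section Morse

variable {E : Type*} [NormedAddCommGroup E] [NormedSpace ℝ E]
  {H : Type*} [TopologicalSpace H] (I : ModelWithCorners ℝ E H)
  {M : Type*} [TopologicalSpace M] [ChartedSpace H M]

/-- `x` is a critical point of `φ`: `dφ_x = 0`. -/
def IsCriticalPt (φ : M → ℝ) (x : M) : Prop :=
  mfderiv I 𝓘(ℝ, ℝ) φ x = 0

/-- The matrix of second derivatives of `φ` at `x`, in the chart around `x`, as a bilinear form on
the model space; at a critical point this is the Hessian of `φ`. -/
noncomputable def hessianInChart (φ : M → ℝ) (x : M) (v w : E) : ℝ :=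
  iteratedFDerivWithin ℝ 2 (φ ∘ (extChartAt I x).symm) (range I) (extChartAt I x x) ![v, w]

/-- The third derivative of `φ` at `x` in the direction `v`, in the chart around `x`. -/
noncomputable def thirdDerivInChart (φ : M → ℝ) (x : M) (v : E) : ℝ :=
  iteratedFDerivWithin ℝ 3 (φ ∘ (extChartAt I x).symm) (range I) (extChartAt I x x) ![v, v, v]

/-- A nondegenerate (Morse) critical point. -/
def IsNondegenerateCriticalPt (φ : M → ℝ) (x : M) : Prop :=
  IsCriticalPt I φ x ∧ ∀ v : E, (∀ w : E, hessianInChart I φ x v w = 0) → v = 0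

/-- An embryonic (birth–death) critical point: the kernel of the Hessian is a line, and the third
derivative along this line does not vanish. -/
def IsEmbryonicCriticalPt (φ : M → ℝ) (x : M) : Prop :=
  IsCriticalPt I φ x ∧ ∃ u : E, u ≠ 0 ∧
    (∀ v : E, (∀ w : E, hessianInChart I φ x v w = 0) ↔ ∃ t : ℝ, v = t • u) ∧
    thirdDerivInChart I φ x u ≠ 0

/-- A generalized Morse function: every critical point is nondegenerate or embryonic.
(Morse functions are those without embryonic critical points.) -/
def IsGeneralizedMorse (φ : M → ℝ) : Prop :=
  ContMDiff I 𝓘(ℝ, ℝ) ∞ φ ∧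
    ∀ x, IsCriticalPt I φ x → IsNondegenerateCriticalPt I φ x ∨ IsEmbryonicCriticalPt I φ x

/-- The square of the dual norm of a covector with respect to an inner product `g` on `F`. -/
noncomputable def dualNormSq {F : Type*} [AddCommGroup F] [Module ℝ F] [TopologicalSpace F]
    (g : F → F → ℝ) (α : F →L[ℝ] ℝ) : ℝ :=
  sSup {r : ℝ | ∃ v : F, g v v ≤ 1 ∧ r = (α v) ^ 2}

/-- The vector field `X` is gradient-like for `φ` (on a compact manifold):
`dφ(X) ≥ δ (|X|² + |dφ|²)` for some Riemannian metric and some constant `δ > 0`. -/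
def IsGradientLike [IsManifold I ∞ M] (X : ∀ x : M, TangentSpace I x) (φ : M → ℝ) : Prop :=
  ∃ (g : Bundle.ContMDiffRiemannianMetric I ∞ E (fun x : M ↦ TangentSpace I x)) (δ : ℝ), 0 < δ ∧
    ∀ x : M, δ * (g.inner x (X x) (X x) +
        dualNormSq (fun v w ↦ g.inner x v w) (mfderiv I 𝓘(ℝ, ℝ) φ x)) ≤
      mfderiv I 𝓘(ℝ, ℝ) φ x (X x)

end Morse

/-! ### Weinstein domains -/

/-- A tangent vector `v` at a boundary point `x` points outwards: in the chart around `x`, with values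
in the half-space `{y | 0 ≤ y 0}`, its zeroth coordinate is negative. -/
def PointsOutward {m : ℕ} [NeZero m] {V : Type*} [TopologicalSpace V]
    [ChartedSpace (EuclideanHalfSpace m) V] (x : V) (v : TangentSpace (𝓡∂ m) x) : Prop :=
  let y : EuclideanSpace ℝ (Fin m) :=
    mfderiv (𝓡∂ m) 𝓘(ℝ, EuclideanSpace ℝ (Fin m)) (extChartAt (𝓡∂ m) x) x v
  y 0 < 0

/-- A Weinstein domain structure `(σ, X, φ)` on a compact smooth `2n`-manifold `V` with boundary:
a symplectic form `σ`, a Liouville vector field `X` pointing outwards along `∂V`, and a generalized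
Morse function `φ` for which `X` is gradient-like and of which `∂V` is the regular level set
at the maximum. -/
structure WeinsteinDomain (n : ℕ) [NeZero (2 * n)] (V : Type*) [TopologicalSpace V] [CompactSpace V]
    [T2Space V] [ChartedSpace (EuclideanHalfSpace (2 * n)) V] [IsManifold (𝓡∂ (2 * n)) ∞ V] where
  /-- the symplectic form -/
  σ : MForm (𝓡∂ (2 * n)) V 2
  /-- the Liouville vector field -/
  X : ∀ x : V, TangentSpace (𝓡∂ (2 * n)) x
  /-- the generalized Morse function -/
  φ : V → ℝ
  isSymplectic : σ.IsSymplectic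
  isLiouville : IsLiouvilleField σ X
  outward : ∀ x ∈ (𝓡∂ (2 * n)).boundary V, PointsOutward x (X x)
  isGeneralizedMorse : IsGeneralizedMorse (𝓡∂ (2 * n)) φ
  isGradientLike : IsGradientLike (𝓡∂ (2 * n)) X φ
  boundary_level : ∃ c : ℝ, (∀ x, φ x ≤ c) ∧ (𝓡∂ (2 * n)).boundary V = {x | φ x = c}
  boundary_regular : ∀ x ∈ (𝓡∂ (2 * n)).boundary V, ¬ IsCriticalPt (𝓡∂ (2 * n)) φ x

/-- The inclusion `∂M → M` of the boundary (with the subspace topology) as a continuous map. -/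
def boundaryInclusion {E : Type*} [NormedAddCommGroup E] [NormedSpace ℝ E]
    {H : Type*} [TopologicalSpace H] (I : ModelWithCorners ℝ E H)
    (M : Type*) [TopologicalSpace M] [ChartedSpace H M] : C(I.boundary M, M) :=
  ⟨Subtype.val, continuous_subtype_val⟩

/-! The field `-X` points inwards, so its flow exists for all nonnegative times. It carries the
boundary into `V`: every point either is reached from a unique boundary point after a unique time,
or lies in the core, the intersection of the images of all the time-`t` maps. The complement of the
core therefore deformation retracts onto the boundary (`IsEntrance.exists_coordinates`), and what
remains is that removing the core does not change the fundamental group.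

The core has dimension at most `n`. A core point has a complete forward orbit under `X`, along which
`φ` is nondecreasing and bounded. Critical points are isolated, hence finite in number, so the orbit
ends up staying near one of them, `p`. Differences of orbits that stay near `p` lie in the cone
where a suitable quadratic form `Q` is nonpositive, so the local stable set is a Lipschitz graph
over a subset of a space whose dimension is that of a subspace with `Q ≤ 0`
(`WeinsteinDomain.exists_nhds_coveredByLipschitz`). By the Liouville equation the linearization of
`X` is conformally symplectic. The images of that subspace under the backward linear flow become
almost isotropic, so it is at most half-dimensional (`two_mul_finrank_le_of_lyapunov`). `Q` is the
Hessian at a nondegenerate point and a perturbation of it at an embryonic one, and no smoothness of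
stable manifolds is used.

So the core is closed of codimension at least `n ≥ 3`. In a ball, two curves with the same ends that
avoid such a set can be coned off from a common generic apex, because the bad apexes have dimension
at most `n + 2 < 2 * n` (`CoveredByLipschitz.isSimplyConnected_diff`). Thus the complement of the
core is locally simply connected even at points of the core, and Lebesgue number arguments push
paths and homotopies of `V` off the core. -/

/-! ### Removing a set whose complement is locally simply connected -/

section LocallySimplyConnectedComplement

open Metric
open scoped unitInterval Topology

/-- Every point has arbitrarily small neighbourhoods whose trace on `U` is simply connected. -/
def HasSimplyConnectedTraces {X : Type*} [TopologicalSpace X] (U : Set X) : Prop :=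
  ∀ x : X, ∀ N ∈ 𝓝 x, ∃ B ∈ 𝓝 x, B ⊆ N ∧ IsSimplyConnected (B ∩ U)

theorem HasSimplyConnectedTraces.dense {X : Type*} [TopologicalSpace X] {U : Set X}
    (hU : HasSimplyConnectedTraces U) : Dense U := by
  intro x
  rw [mem_closure_iff_nhds]
  intro N hN
  obtain ⟨B, -, hBN, hB⟩ := hU x N hN
  obtain ⟨y, hy⟩ := hB.nonempty
  exact ⟨y, hBN hy.1, hy.2⟩

variable {X : Type*} [PseudoMetricSpace X] [CompactSpace X] {U : Set X}


/-- Two points of `U` closer than a Lebesgue number of the cover by good neighbourhoods lie in a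
common one, whose trace on `U` is path connected. -/
theorem HasSimplyConnectedTraces.exists_small_path (hU : HasSimplyConnectedTraces U) {ε : ℝ}
    (hε : 0 < ε) :
    ∃ δ > 0, ∀ x y : U, dist x y < δ → ∃ γ : Path x y, ∀ t, dist (γ t) x < ε := by
  choose B hB hBN hBU using fun x ↦ hU x (ball x (ε / 2)) (ball_mem_nhds x (half_pos hε))
  obtain ⟨δ, hδ, h⟩ := lebesgue_number_lemma_of_metric (c := fun x ↦ interior (B x))
    (isCompact_univ (X := X)) (fun x ↦ isOpen_interior)
    (fun x _ ↦ mem_iUnion.2 ⟨x, mem_interior_iff_mem_nhds.2 (hB x)⟩)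
  refine ⟨δ, hδ, fun x y hxy ↦ ?_⟩
  obtain ⟨z, hz⟩ := h x (mem_univ _)
  have hx : (x : X) ∈ B z ∩ U := ⟨interior_subset (hz (mem_ball_self hδ)), x.2⟩
  have hy : (y : X) ∈ B z ∩ U := ⟨interior_subset (hz (by rwa [mem_ball, dist_comm])), y.2⟩
  obtain ⟨γ, hγ⟩ := (hBU z).isPathConnected.joinedIn x hx y hy
  refine ⟨⟨⟨fun t ↦ ⟨γ t, (hγ t).2⟩, by fun_prop⟩, Subtype.ext γ.source, Subtype.ext γ.target⟩,
    fun t ↦ ?_⟩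
  have h1 := hBN z (hγ t).1
  have h2 := hBN z hx.1
  rw [mem_ball] at h1 h2
  have := dist_triangle_right (γ t) x z
  change dist (γ t) (x : X) < ε
  linarith

/-- Again a Lebesgue number: both paths lie in the trace on `U` of one good neighbourhood, which is
simply connected. -/
theorem HasSimplyConnectedTraces.exists_homotopic_of_small (hU : HasSimplyConnectedTraces U) :
    ∃ η > 0, ∀ (z : X) (x y : U) (p q : Path x y), (∀ t, dist (p t : X) z < η) →
      (∀ t, dist (q t : X) z < η) → p.Homotopic q := by
  choose B hB hBN hBU using fun x ↦ hU x univ Filter.univ_mem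
  obtain ⟨δ, hδ, h⟩ := lebesgue_number_lemma_of_metric (c := fun x ↦ interior (B x))
    (isCompact_univ (X := X)) (fun x ↦ isOpen_interior)
    (fun x _ ↦ mem_iUnion.2 ⟨x, mem_interior_iff_mem_nhds.2 (hB x)⟩)
  refine ⟨δ, hδ, fun z x y p q hp hq ↦ ?_⟩
  obtain ⟨w, hw⟩ := h z (mem_univ _)
  have key : ∀ r : Path x y, (∀ t, dist (r t : X) z < δ) → ∀ t, (r t : X) ∈ B w ∩ U :=
    fun r hr t ↦ ⟨interior_subset (hw (hr t)), (r t).2⟩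
  have hx : (x : X) ∈ B w ∩ U := by simpa using key p hp 0
  have hy : (y : X) ∈ B w ∩ U := by simpa using key p hp 1
  have := (hBU w).simplyConnectedSpace
  let lft (r : Path x y) (hr : ∀ t, dist (r t : X) z < δ) :
      Path (⟨x, hx⟩ : ↥(B w ∩ U)) ⟨y, hy⟩ :=
    ⟨⟨fun t ↦ ⟨r t, key r hr t⟩, by fun_prop⟩, Subtype.ext (by simp), Subtype.ext (by simp)⟩
  let ι : C(↥(B w ∩ U), U) := ⟨fun v ↦ ⟨v, v.2.2⟩, by fun_prop⟩
  exact (SimplyConnectedSpace.paths_homotopic (lft p hp) (lft q hq)).map ι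

/-- A ladder argument. Short rungs `ρ t` in `U` join `p t` to `q t`. After a fine subdivision each
square of the ladder has small diameter, so it commutes up to homotopy in `U`; multiplying the
squares compares `p` with `q` up to the two end rungs, which are small loops and hence trivial. -/
theorem HasSimplyConnectedTraces.exists_homotopic_of_close (hU : HasSimplyConnectedTraces U) :
    ∃ δ > 0, ∀ (x y : U) (p q : Path x y), (∀ t, dist (p t) (q t) < δ) → p.Homotopic q := by
  obtain ⟨η, hη, hsmall⟩ := hU.exists_homotopic_of_small
  obtain ⟨δ, hδ, hpath⟩ := hU.exists_small_path (ε := η / 4) (by positivity)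
  refine ⟨δ, hδ, fun x y p q hpq ↦ ?_⟩
  obtain ⟨θ, hθ, hunif⟩ : ∃ θ > 0, ∀ s t : I, dist s t < θ →
      dist (p s) (p t) < η / 4 ∧ dist (q s) (q t) < η / 4 := by
    obtain ⟨θ₁, h₁, H₁⟩ := uniformContinuous_iff.1
      (CompactSpace.uniformContinuous_of_continuous p.continuous) (η / 4) (by positivity)
    obtain ⟨θ₂, h₂, H₂⟩ := uniformContinuous_iff.1
      (CompactSpace.uniformContinuous_of_continuous q.continuous) (η / 4) (by positivity)
    exact ⟨min θ₁ θ₂, lt_min h₁ h₂, fun s t h ↦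
      ⟨H₁ (h.trans_le (min_le_left _ _)), H₂ (h.trans_le (min_le_right _ _))⟩⟩
  choose ρ hρ using fun t : I ↦ hpath (p t) (q t) (hpq t)
  obtain ⟨N, hN⟩ := exists_nat_one_div_lt hθ
  -- Clamping to the unit interval lets the statements about `τ k` hold for every `k`, so the
  -- induction needs no bound on `k`.
  let τ (k : ℕ) : I := projIcc 0 1 zero_le_one (k / (N + 1 : ℝ))
  have hτ : ∀ k, dist (τ k) (τ (k + 1)) < θ := by
    intro k
    refine lt_of_le_of_lt ?_ hN
    have := LipschitzWith.dist_le_mul (LipschitzWith.projIcc (zero_le_one (α := ℝ)))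
      (k / (N + 1 : ℝ)) ((k + 1 : ℕ) / (N + 1 : ℝ))
    refine this.trans (le_of_eq ?_)
    rw [Real.dist_eq, ← sub_div, abs_div]
    simp [abs_of_pos (show (0 : ℝ) < N + 1 by positivity)]
  have hτ0 : τ 0 = 0 := by simp [τ]
  have hτN : τ (N + 1) = 1 := by
    have : (((N + 1 : ℕ) : ℝ) / (N + 1 : ℝ)) = 1 := by push_cast; field_simp
    simp only [τ, this]
    exact projIcc_right (h := zero_le_one)
  have htri : ∀ a b c d : U, dist a b < η / 4 → dist b c < η / 4 → dist c d < η / 4 →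
      dist (a : X) d < η := by
    intro a b c d h1 h2 h3
    have := dist_triangle4 a b c d
    change dist a d < η
    linarith
  have step : ∀ k, ((p.subpath (τ k) (τ (k + 1))).trans (ρ (τ (k + 1)))).Homotopic
      ((ρ (τ k)).trans (q.subpath (τ k) (τ (k + 1)))) := by
    intro k
    have hconv : ∀ u, dist (Icc.convexComb (τ k) (τ (k + 1)) u) (τ k) < θ := by
      intro u
      refine lt_of_le_of_lt ?_ (hτ k)
      have hmem : (Icc.convexComb (τ k) (τ (k + 1)) u) ∈ uIcc (τ k) (τ (k + 1)) := by
        rw [← Path.range_subpathAux]; exact mem_range_self u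
      rw [dist_comm (τ k)]
      rw [Subtype.dist_eq, Subtype.dist_eq, Real.dist_eq, Real.dist_eq]
      apply abs_sub_left_of_mem_uIcc
      rw [mem_uIcc] at hmem ⊢
      exact hmem
    refine hsmall (p (τ k)) _ _ _ _ (fun t ↦ ?_) (fun t ↦ ?_)
    · rw [Path.trans_apply]
      split_ifs
      · exact ((hunif _ _ (hconv _)).1).trans (by linarith)
      · refine htri _ (p (τ (k + 1))) (p (τ k)) _ (hρ _ _) ?_ (by simpa using by positivity)
        rw [dist_comm]
        exact (hunif _ _ (hτ k)).1
    · rw [Path.trans_apply]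
      split_ifs
      · exact (hρ _ _).trans (by linarith)
      · refine htri _ (q (τ k)) (p (τ k)) _ ((hunif _ _ (hconv _)).2) ?_
          (by simpa using by positivity)
        simpa using hρ (τ k) 1
  have claim : ∀ k, ((p.subpath (τ 0) (τ k)).trans (ρ (τ k))).Homotopic
      ((ρ (τ 0)).trans (q.subpath (τ 0) (τ k))) := by
    intro k
    induction k with
    | zero =>
      simp only [Path.subpath_self]
      exact Path.Homotopic.trans ⟨Path.Homotopy.reflTrans _⟩
        (Path.Homotopic.symm ⟨Path.Homotopy.transRefl _⟩)
    | succ k ih =>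
      have e1 : (p.subpath (τ 0) (τ (k + 1))).Homotopic
          ((p.subpath (τ 0) (τ k)).trans (p.subpath (τ k) (τ (k + 1)))) :=
        Path.Homotopic.symm ⟨Path.Homotopy.subpathTransSubpath p _ _ _⟩
      have e2 : ((q.subpath (τ 0) (τ k)).trans (q.subpath (τ k) (τ (k + 1)))).Homotopic
          (q.subpath (τ 0) (τ (k + 1))) := ⟨Path.Homotopy.subpathTransSubpath q _ _ _⟩
      have s := step k
      rw [← Path.Homotopic.Quotient.eq] at e1 e2 ih s ⊢
      simp only [Path.Homotopic.Quotient.mk_trans] at e1 e2 ih s ⊢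
      rw [e1, Path.Homotopic.Quotient.trans_assoc, s, ← Path.Homotopic.Quotient.trans_assoc, ih,
        Path.Homotopic.Quotient.trans_assoc, e2]
  have fin := claim (N + 1)
  rw [hτ0, hτN] at fin
  have hρ0 : ((ρ 0).cast p.source.symm q.source.symm).Homotopic (Path.refl x) := by
    refine hsmall x _ _ _ _ (fun t ↦ ?_) (fun t ↦ by simpa using hη)
    have h1 : dist (ρ 0 t : X) (p 0 : U) < η / 4 := hρ 0 t
    have h2 := h1.trans (by linarith : η / 4 < η)
    rwa [show ((p 0 : U) : X) = _ from congrArg Subtype.val p.source] at h2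
  have hρ1 : ((ρ 1).cast p.target.symm q.target.symm).Homotopic (Path.refl y) := by
    refine hsmall y _ _ _ _ (fun t ↦ ?_) (fun t ↦ by simpa using hη)
    have h1 : dist (ρ 1 t : X) (p 1 : U) < η / 4 := hρ 1 t
    have h2 := h1.trans (by linarith : η / 4 < η)
    rwa [show ((p 1 : U) : X) = _ from congrArg Subtype.val p.target] at h2
  have fin' : (p.trans ((ρ 1).cast p.target.symm q.target.symm)).Homotopic
      (((ρ 0).cast p.source.symm q.source.symm).trans q) := by
    have := fin.pathCast p.source.symm q.target.symm
    rw [Path.subpath_zero_one, Path.subpath_zero_one] at this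
    exact this
  rw [← Path.Homotopic.Quotient.eq] at *
  simp only [Path.Homotopic.Quotient.mk_trans, hρ0, hρ1, Path.Homotopic.Quotient.mk_refl] at fin'
  simpa using fin'

/-- Sample `g` finely, move the samples into the dense set `U`, and join consecutive ones by small
paths in `U`. -/
theorem HasSimplyConnectedTraces.exists_path_approx (hU : HasSimplyConnectedTraces U) {x y : U}
    (g : Path (x : X) y) {ε : ℝ} (hε : 0 < ε) :
    ∃ p : Path x y, ∀ t, dist (p t : X) (g t) < ε := by
  obtain ⟨δ, hδ, hpath⟩ := hU.exists_small_path (ε := ε / 3) (by positivity)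
  obtain ⟨θ, hθ, hunif⟩ : ∃ θ > 0, ∀ s t : ℝ, dist s t ≤ θ →
      dist (g.extend s) (g.extend t) < min (δ / 3) (ε / 3) := by
    obtain ⟨θ, h, H⟩ := uniformContinuous_iff.1
      (CompactSpace.uniformContinuous_of_continuous g.continuous) (min (δ / 3) (ε / 3))
        (by positivity)
    refine ⟨θ / 2, half_pos h, fun s t hst ↦ H (lt_of_le_of_lt ?_ (half_lt_self h))⟩
    have := LipschitzWith.dist_le_mul (LipschitzWith.projIcc (zero_le_one (α := ℝ))) s t
    simp only [NNReal.coe_one, one_mul] at this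
    exact this.trans hst
  obtain ⟨N, hN⟩ := exists_nat_one_div_lt hθ
  have hN0 : (0 : ℝ) < N + 1 := by positivity
  -- Density supplies the samples, except that the last one has to be the endpoint `y` itself.
  have hν : ∀ k : ℕ, ∃ u : U, dist (u : X) (g.extend (k / (N + 1))) < min (δ / 3) (ε / 3) ∧
      (k = N + 1 → u = y) := by
    intro k
    by_cases hk : k = N + 1
    · refine ⟨y, ?_, fun _ ↦ rfl⟩
      subst hk
      have : (((N + 1 : ℕ) : ℝ) / (N + 1 : ℝ)) = 1 := by push_cast; field_simp
      rw [this, Path.extend_one, dist_self]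
      positivity
    · obtain ⟨u, hu, hd⟩ := Metric.dense_iff.1 hU.dense (g.extend (k / (N + 1)))
        (min (δ / 3) (ε / 3)) (by positivity)
      exact ⟨⟨u, hd⟩, hu, fun h ↦ absurd h hk⟩
  -- The curve `a` is defined on the whole line so that pieces can be glued by a case distinction;
  -- only its values on `[0, k / (N + 1)]` are controlled.
  have claim : ∀ k : ℕ, ∃ (a : ℝ → U) (u : U), Continuous a ∧ a 0 = x ∧ (k = N + 1 → u = y) ∧
      a (k / (N + 1)) = u ∧ dist (u : X) (g.extend (k / (N + 1))) < min (δ / 3) (ε / 3) ∧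
      ∀ t ∈ Icc (0 : ℝ) (k / (N + 1)), dist (a t : X) (g.extend t) < ε := by
    intro k
    induction k with
    | zero =>
      refine ⟨fun _ ↦ x, x, continuous_const, rfl, by simp, rfl, ?_, fun t ht ↦ ?_⟩
      · simpa using ⟨hδ, hε⟩
      · have : t = 0 := by simpa using ht
        simpa [this] using hε
    | succ k ih =>
      obtain ⟨a, u, ha, ha0, -, hau, hu, hat⟩ := ih
      obtain ⟨v, hv, hvy⟩ := hν (k + 1)
      have hstep : dist ((k : ℝ) / (N + 1)) ((k + 1 : ℕ) / (N + 1)) ≤ θ := by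
        refine le_trans (le_of_eq ?_) hN.le
        rw [Real.dist_eq, ← sub_div, abs_div]
        simp [abs_of_pos hN0]
      have huv : dist u v < δ := by
        have h1 := dist_triangle4 (u : X) (g.extend (k / (N + 1)))
          (g.extend ((k + 1 : ℕ) / (N + 1))) v
        have h2 := hunif _ _ hstep
        rw [dist_comm (g.extend ((k + 1 : ℕ) / (N + 1))) (v : X)] at h1
        rw [lt_min_iff] at hu hv h2
        change dist (u : X) v < δ
        linarith [hu.1, hv.1, h2.1]
      obtain ⟨γ, hγ⟩ := hpath u v huv
      have hk0 : (0 : ℝ) ≤ k / (N + 1) := by positivity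
      refine ⟨fun t ↦ if t ≤ k / (N + 1) then a t else γ.extend ((t - k / (N + 1)) * (N + 1)), v,
        ?_, ?_, hvy, ?_, hv, fun t ht ↦ ?_⟩
      · refine Continuous.if_le ha (γ.continuous_extend.comp (by fun_prop)) continuous_id
          continuous_const ?_
        rintro t rfl
        simp [hau]
      · simp [hk0, ha0]
      · have h1 : ¬ (((k + 1 : ℕ) : ℝ) / (N + 1) ≤ k / (N + 1)) := by
          rw [not_le]
          gcongr
          simp
        have h2 : ((((k + 1 : ℕ) : ℝ) / (N + 1) - k / (N + 1)) * (N + 1)) = 1 := by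
          push_cast; field_simp; ring
        simp only [h1, if_false, h2, Path.extend_one]
      · simp only
        split_ifs with h
        · exact hat t ⟨ht.1, h⟩
        · rw [not_le] at h
          have h1 : dist ((k : ℝ) / (N + 1)) t ≤ θ := by
            refine le_trans ?_ hstep
            rw [Real.dist_eq, Real.dist_eq, abs_sub_comm, abs_sub_comm _ (((k + 1 : ℕ) : ℝ) / _),
              abs_of_pos (by linarith), abs_of_pos (by linarith [ht.2])]
            linarith [ht.2]
          have h2 := hunif _ _ h1
          have h3 : dist (γ.extend ((t - k / (N + 1)) * (N + 1)) : X) u < ε / 3 :=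
            hγ (projIcc 0 1 zero_le_one ((t - k / (N + 1)) * (N + 1)))
          have h4 := dist_triangle4 (γ.extend ((t - k / (N + 1)) * (N + 1)) : X) u
            (g.extend (k / (N + 1))) (g.extend t)
          rw [lt_min_iff] at hu h2
          linarith [hu.2, h2.2]
  obtain ⟨a, u, ha, ha0, huy, hau, -, hat⟩ := claim (N + 1)
  have h1 : (((N + 1 : ℕ) : ℝ) / (N + 1 : ℝ)) = 1 := by push_cast; field_simp
  rw [h1] at hau hat
  refine ⟨⟨⟨fun t ↦ a t, by fun_prop⟩, by simpa using ha0, by simpa [huy rfl] using hau⟩,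
    fun t ↦ ?_⟩
  have := hat t t.2
  rwa [Path.extend_apply _ t.2] at this

/-- Paths with ends in `U` can be pushed into `U`. -/
theorem HasSimplyConnectedTraces.exists_homotopic_map (hU : HasSimplyConnectedTraces U)
    (hX : HasSimplyConnectedTraces (univ : Set X)) {x y : U} (g : Path (x : X) y) :
    ∃ p : Path x y, g.Homotopic (p.map continuous_subtype_val) := by
  -- Closeness is used in `X`, through `univ`: a path in `U` close enough to `g` is homotopic to `g`
  -- in `X`.
  obtain ⟨δ, hδ, h⟩ := hX.exists_homotopic_of_close
  obtain ⟨p, hp⟩ := hU.exists_path_approx g hδ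
  refine ⟨p, ?_⟩
  let ι : C(X, (univ : Set X)) := ⟨fun v ↦ ⟨v, trivial⟩, by fun_prop⟩
  have := h ⟨x, trivial⟩ ⟨y, trivial⟩ (g.map ι.continuous)
    ((p.map continuous_subtype_val).map ι.continuous) (fun t ↦ by
      rw [dist_comm]; exact hp t)
  exact this.map ⟨Subtype.val, continuous_subtype_val⟩

/-- Paths in `U` which are homotopic in `X` are homotopic in `U`. -/
theorem HasSimplyConnectedTraces.homotopic_of_map (hU : HasSimplyConnectedTraces U) {x y : U}
    (p q : Path x y)
    (hpq : (p.map continuous_subtype_val).Homotopic (q.map continuous_subtype_val)) :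
    p.Homotopic q := by
  obtain ⟨δ, hδ, h⟩ := hU.exists_homotopic_of_close
  obtain ⟨F⟩ := hpq
  obtain ⟨θ, hθ, hunif⟩ := uniformContinuous_iff.1
    (CompactSpace.uniformContinuous_of_continuous F.continuous) (δ / 3) (by positivity)
  obtain ⟨N, hN⟩ := exists_nat_one_div_lt hθ
  let τ (k : ℕ) : I := projIcc 0 1 zero_le_one (k / (N + 1 : ℝ))
  have hτ : ∀ k, dist (τ k) (τ (k + 1)) < θ := by
    intro k
    refine lt_of_le_of_lt ?_ hN
    have := LipschitzWith.dist_le_mul (LipschitzWith.projIcc (zero_le_one (α := ℝ)))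
      (k / (N + 1 : ℝ)) ((k + 1 : ℕ) / (N + 1 : ℝ))
    refine this.trans (le_of_eq ?_)
    rw [Real.dist_eq, ← sub_div, abs_div]
    simp [abs_of_pos (show (0 : ℝ) < N + 1 by positivity)]
  have hτ0 : τ 0 = 0 := by simp [τ]
  have hτN : τ (N + 1) = 1 := by
    have : (((N + 1 : ℕ) : ℝ) / (N + 1 : ℝ)) = 1 := by push_cast; field_simp
    simp only [τ, this]
    exact projIcc_right (h := zero_le_one)
  -- The slices of the homotopy are approximated by paths in `U`. Consecutive approximations differ
  -- by less than three times `δ / 3`, so they are homotopic in `U`.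
  have claim : ∀ k, ∃ r : Path x y, p.Homotopic r ∧
      ∀ t, dist (r t : X) (F.eval (τ k) t) < δ / 3 := by
    intro k
    induction k with
    | zero =>
      refine ⟨p, .refl p, fun t ↦ ?_⟩
      rw [hτ0, F.eval_zero]
      simpa using hδ
    | succ k ih =>
      obtain ⟨r, hr, hrF⟩ := ih
      obtain ⟨s, hs⟩ := hU.exists_path_approx (F.eval (τ (k + 1))) (ε := δ / 3) (by positivity)
      refine ⟨s, hr.trans (h x y r s fun t ↦ ?_), hs⟩
      have h1 : dist (F.eval (τ k) t) (F.eval (τ (k + 1)) t) < δ / 3 := by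
        refine hunif (a := (τ k, t)) (b := (τ (k + 1), t)) ?_
        rw [Prod.dist_eq]
        simpa [hθ] using hτ k
      have h2 := dist_triangle4 (r t : X) (F.eval (τ k) t) (F.eval (τ (k + 1)) t) (s t)
      have h3 := hs t
      rw [dist_comm] at h3
      change dist (r t : X) (s t) < δ
      linarith [hrF t]
  obtain ⟨r, hr, hrF⟩ := claim (N + 1)
  refine hr.trans (h x y r q fun t ↦ ?_)
  have := hrF t
  rw [hτN, F.eval_one] at this
  exact this.trans (by linarith)

end LocallySimplyConnectedComplement

/-! ### Complements of sets of codimension at least three -/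

section CodimensionThree

open Metric Module
open scoped unitInterval Topology NNReal

/-- `T` is contained in a countable union of Lipschitz images of `ℝⁿ`. -/
def CoveredByLipschitz {E : Type*} [PseudoEMetricSpace E] (n : ℕ) (T : Set E) : Prop :=
  ∃ f : ℕ → EuclideanSpace ℝ (Fin n) → E, (∀ i, ∃ C : ℝ≥0, LipschitzWith C (f i)) ∧
    T ⊆ ⋃ i, range (f i)

theorem CoveredByLipschitz.mono {E : Type*} [PseudoEMetricSpace E] {n : ℕ} {S T : Set E}
    (hT : CoveredByLipschitz n T) (h : S ⊆ T) :
    CoveredByLipschitz n S := by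
  obtain ⟨f, hf, hT⟩ := hT
  exact ⟨f, hf, h.trans hT⟩

variable {E : Type*} [NormedAddCommGroup E] [NormedSpace ℝ E]

/-- The set of apexes whose cone over a `C¹` curve meets `T` has dimension at most `n + 2`. -/
theorem CoveredByLipschitz.dimH_apexes_le {n : ℕ} {T : Set E} (hT : CoveredByLipschitz n T)
    {p : ℝ → E} (hp : ContDiff ℝ 1 p) :
    dimH {c : E | ∃ s ∈ Ioc (0 : ℝ) 1, ∃ t : ℝ, (1 - s) • p t + s • c ∈ T} ≤ n + 2 := by
  obtain ⟨f, hf, hT⟩ := hT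
  -- `Φ` solves `(1 - s) • p t + s • c = z` for the apex `c`. Bad apexes are thus parametrized by
  -- `n` parameters in `T` together with `s` and `t`, locally Lipschitz as long as `s > 0`.
  let Φ : E × ℝ × ℝ → E := fun z ↦ z.2.1⁻¹ • (z.1 - (1 - z.2.1) • p z.2.2)
  let S : Set (EuclideanSpace ℝ (Fin n) × ℝ × ℝ) := {z | 0 < z.2.1}
  let G (i : ℕ) : EuclideanSpace ℝ (Fin n) × ℝ × ℝ → E := fun z ↦ Φ (f i z.1, z.2)
  have hsub : {c : E | ∃ s ∈ Ioc (0 : ℝ) 1, ∃ t : ℝ, (1 - s) • p t + s • c ∈ T} ⊆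
      ⋃ i, G i '' S := by
    rintro c ⟨s, hs, t, hc⟩
    obtain ⟨i, v, hv⟩ := mem_iUnion.1 (hT hc)
    refine mem_iUnion.2 ⟨i, (v, s, t), hs.1, ?_⟩
    simp only [G, Φ, hv, add_sub_cancel_left, smul_smul, inv_mul_cancel₀ hs.1.ne', one_smul]
  refine (dimH_mono hsub).trans ?_
  rw [dimH_iUnion]
  refine iSup_le fun i ↦ ?_
  have h1 : dimH (G i '' S) ≤ dimH S := by
    refine dimH_image_le_of_locally_lipschitzOn fun z hz ↦ ?_
    obtain ⟨C, hC⟩ := hf i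
    have hΦ : ContDiffAt ℝ 1 Φ (f i z.1, z.2) := by
      have h0 : (f i z.1, z.2).2.1 ≠ 0 := ne_of_gt hz
      refine ContDiffAt.smul (ContDiffAt.inv (by fun_prop) h0) ?_
      refine ContDiffAt.sub (by fun_prop) (ContDiffAt.smul (by fun_prop) ?_)
      exact hp.contDiffAt.comp (f i z.1, z.2) (by fun_prop)
    obtain ⟨K, t, ht, hK⟩ := hΦ.exists_lipschitzOnWith
    have hL : LipschitzWith (max C 1) (Prod.map (f i) (id : ℝ × ℝ → ℝ × ℝ)) := by
      have := (hC.comp LipschitzWith.prod_fst).prodMk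
        (LipschitzWith.prod_snd (α := EuclideanSpace ℝ (Fin n)) (β := ℝ × ℝ))
      rw [mul_one] at this
      exact this
    refine ⟨K * max C 1, (Prod.map (f i) id) ⁻¹' t, ?_, ?_⟩
    · exact mem_nhdsWithin_of_mem_nhds (hL.continuous.continuousAt ht)
    · exact hK.comp hL.lipschitzOnWith (fun _ h ↦ h)
  refine h1.trans ((dimH_mono (subset_univ _)).trans ?_)
  rw [Real.dimH_univ_eq_finrank]
  simp only [finrank_prod, finrank_euclideanSpace, Fintype.card_fin, finrank_self]
  norm_num

/-- The restriction to `[0, 1]` of a curve with values in `O`, as a path in `O`. -/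
def pathOfCurve {O : Set E} (g : ℝ → E) (hg : Continuous g) (hO : ∀ t ∈ Icc (0 : ℝ) 1, g t ∈ O)
    (x y : O) (hx : g 0 = x) (hy : g 1 = y) : Path x y :=
  ⟨⟨fun t ↦ ⟨g t, hO t t.2⟩, by fun_prop⟩, Subtype.ext (by simpa using hx),
    Subtype.ext (by simpa using hy)⟩

/-- A smooth approximation within `δ / 3` gets its endpoints corrected by an affine interpolation of
the endpoint errors. The result is `δ`-close to `γ`, so the straight-line homotopy stays in `O`. -/
theorem exists_contDiff_homotopic_path {O : Set E} [FiniteDimensional ℝ E] (hO : IsOpen O)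
    {x y : O} (γ : Path x y) :
    ∃ (g : ℝ → E) (hg : ContDiff ℝ 1 g) (hgO : ∀ t ∈ Icc (0 : ℝ) 1, g t ∈ O) (hx : g 0 = x)
      (hy : g 1 = y), γ.Homotopic (pathOfCurve g hg.continuous hgO x y hx hy) := by
  have hcomp : IsCompact (range fun t ↦ (γ t : E)) := isCompact_range (by fun_prop)
  obtain ⟨δ, hδ, hthick⟩ := hcomp.exists_thickening_subset_open hO
    (by rintro _ ⟨t, rfl⟩; exact (γ t).2)
  obtain ⟨g₀, hg₀, happ, -⟩ := Continuous.exists_contDiff_approx (f := fun t ↦ (γ.extend t : E))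
    (ε := fun _ : ℝ ↦ δ / 3) 1 (by fun_prop) continuous_const (fun _ ↦ by positivity)
  let g : ℝ → E := fun t ↦ g₀ t + ((1 - t) • ((x : E) - g₀ 0) + t • ((y : E) - g₀ 1))
  have hg : ContDiff ℝ 1 g := by
    have : ContDiff ℝ 1 g₀ := hg₀
    fun_prop
  have hclose : ∀ t ∈ Icc (0 : ℝ) 1, ‖g t - γ.extend t‖ < δ := by
    intro t ht
    have h1 : ‖g₀ t - γ.extend t‖ < δ / 3 := by simpa [dist_eq_norm] using happ t
    have h2 : ‖(x : E) - g₀ 0‖ < δ / 3 := by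
      have := happ 0
      rw [dist_comm] at this
      simpa [dist_eq_norm] using this
    have h3 : ‖(y : E) - g₀ 1‖ < δ / 3 := by
      have := happ 1
      rw [dist_comm] at this
      simpa [dist_eq_norm] using this
    have h4 : g t - γ.extend t = (g₀ t - γ.extend t) + ((1 - t) • ((x : E) - g₀ 0) +
        t • ((y : E) - g₀ 1)) := by simp only [g]; abel
    rw [h4]
    have h5 : ‖(1 - t) • ((x : E) - g₀ 0)‖ ≤ ‖(x : E) - g₀ 0‖ := by
      rw [norm_smul, Real.norm_of_nonneg (by linarith [ht.2])]
      nlinarith [norm_nonneg ((x : E) - g₀ 0), ht.1]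
    have h6 : ‖t • ((y : E) - g₀ 1)‖ ≤ ‖(y : E) - g₀ 1‖ := by
      rw [norm_smul, Real.norm_of_nonneg ht.1]
      nlinarith [norm_nonneg ((y : E) - g₀ 1), ht.2]
    have h7 := norm_add_le (g₀ t - γ.extend t) ((1 - t) • ((x : E) - g₀ 0) +
        t • ((y : E) - g₀ 1))
    have h8 := norm_add_le ((1 - t) • ((x : E) - g₀ 0)) (t • ((y : E) - g₀ 1))
    linarith
  have hmem : ∀ (s : I) (t : I), (γ t : E) + (s : ℝ) • (g t - γ t) ∈ O := by
    intro s t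
    apply hthick
    rw [mem_thickening_iff]
    refine ⟨γ t, mem_range_self t, ?_⟩
    have := hclose t t.2
    rw [Path.extend_apply _ t.2] at this
    rw [dist_eq_norm, add_sub_cancel_left, norm_smul, Real.norm_of_nonneg s.2.1]
    nlinarith [norm_nonneg (g t - γ t), s.2.2, this]
  have hgO : ∀ t ∈ Icc (0 : ℝ) 1, g t ∈ O := fun t ht ↦ by simpa using hmem 1 ⟨t, ht⟩
  have hx : g 0 = x := by simp [g]
  have hy : g 1 = y := by simp [g]
  refine ⟨g, hg, hgO, hx, hy, ⟨⟨⟨⟨fun z ↦ ⟨_, hmem z.1 z.2⟩, ?_⟩, ?_, ?_⟩, ?_⟩⟩⟩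
  · have := hg.continuous
    fun_prop
  · intro t
    exact Subtype.ext (by simp)
  · intro t
    exact Subtype.ext (by simp [pathOfCurve])
  · intro s t ht
    rcases ht with rfl | rfl
    · exact Subtype.ext (by simp [hx])
    · exact Subtype.ext (by simp [hy])

/-- The cone is a map from a square to `O`, and paths in the square with the same ends are
homotopic. Hence the class of the curve depends only on its endpoints and the apex. -/
theorem pathOfCurve_homotopic_cone {O : Set E} {g : ℝ → E} (hg : Continuous g)
    (hgO : ∀ t ∈ Icc (0 : ℝ) 1, g t ∈ O) {x y : O} (hx : g 0 = x) (hy : g 1 = y) (c : O)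
    (L : Path x c) (M : Path y c) (hL : ∀ s : I, (L s : E) = (1 - (s : ℝ)) • (x : E) + (s : ℝ) • c)
    (hM : ∀ s : I, (M s : E) = (1 - (s : ℝ)) • (y : E) + (s : ℝ) • c)
    (hcone : ∀ s ∈ Icc (0 : ℝ) 1, ∀ t ∈ Icc (0 : ℝ) 1, (1 - s) • g t + s • (c : E) ∈ O) :
    (pathOfCurve g hg hgO x y hx hy).Homotopic ((L.trans (Path.refl c)).trans M.symm) := by
  let F : C(I × I, O) := ⟨fun z ↦ ⟨_, hcone z.1 z.1.2 z.2 z.2.2⟩, by fun_prop⟩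
  have : ContractibleSpace I :=
    (convex_Icc (0 : ℝ) 1).contractibleSpace ⟨0, by simp⟩
  let p : Path ((0, 0) : I × I) (0, 1) := ⟨⟨fun t ↦ (0, t), by fun_prop⟩, rfl, rfl⟩
  let l : Path ((0, 0) : I × I) (1, 0) := ⟨⟨fun t ↦ (t, 0), by fun_prop⟩, rfl, rfl⟩
  let k : Path ((1, 0) : I × I) (1, 1) := ⟨⟨fun t ↦ (1, t), by fun_prop⟩, rfl, rfl⟩
  let m : Path ((0, 1) : I × I) (1, 1) := ⟨⟨fun t ↦ (t, 1), by fun_prop⟩, rfl, rfl⟩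
  have h := (SimplyConnectedSpace.paths_homotopic p ((l.trans k).trans m.symm)).map F
  have h00 : x = F (0, 0) := Subtype.ext (by simp [F, hx])
  have h01 : y = F (0, 1) := Subtype.ext (by simp [F, hy])
  have h10 : c = F (1, 0) := Subtype.ext (by simp [F])
  have h11 : c = F (1, 1) := Subtype.ext (by simp [F])
  have h' := h.pathCast h00 h01
  convert h' using 1
  · ext t
    simp [pathOfCurve, F, p]
  · rw [Path.map_trans, Path.map_trans]
    have e1 : L = (l.map F.continuous).cast h00 h10 := by
      ext t
      simp [F, l, hL, hx]
    have e2 : Path.refl c = (k.map F.continuous).cast h10 h11 := by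
      ext t
      simp [F, k]
    have e3 : M.symm = (m.symm.map F.continuous).cast h11 h01 := by
      ext t
      simp [F, m, hM, hy]
    rw [e2, e3, e1]
    rfl

/-- Removing a set of codimension at least three from a convex open set leaves a simply connected
set. -/
theorem CoveredByLipschitz.isSimplyConnected_diff [FiniteDimensional ℝ E] {n : ℕ} {D T : Set E}
    (hn : n + 3 ≤ finrank ℝ E) (hD : IsOpen D) (hconv : Convex ℝ D) (hne : D.Nonempty)
    (hDT : IsOpen (D \ T)) (hT : CoveredByLipschitz n (D ∩ T)) : IsSimplyConnected (D \ T) := by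
  have hlt : ((n : ENNReal) + 2) < finrank ℝ E := by
    have : ((n + 2 : ℕ) : ENNReal) < (finrank ℝ E : ℕ) := Nat.cast_lt.2 (by omega)
    simpa using this
  -- a common generic apex for two curves
  have apex : ∀ p q : ℝ → E, ContDiff ℝ 1 p → ContDiff ℝ 1 q →
      (∀ t ∈ Icc (0 : ℝ) 1, p t ∈ D \ T) → (∀ t ∈ Icc (0 : ℝ) 1, q t ∈ D \ T) →
      ∃ c ∈ D \ T, (∀ s ∈ Icc (0 : ℝ) 1, ∀ t ∈ Icc (0 : ℝ) 1, (1 - s) • p t + s • c ∈ D \ T) ∧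
        ∀ s ∈ Icc (0 : ℝ) 1, ∀ t ∈ Icc (0 : ℝ) 1, (1 - s) • q t + s • c ∈ D \ T := by
    intro p q hp hq hpD hqD
    have hdim : dimH ({c : E | ∃ s ∈ Ioc (0 : ℝ) 1, ∃ t : ℝ, (1 - s) • p t + s • c ∈ D ∩ T} ∪
        {c : E | ∃ s ∈ Ioc (0 : ℝ) 1, ∃ t : ℝ, (1 - s) • q t + s • c ∈ D ∩ T}) <
        finrank ℝ E := by
      rw [dimH_union]
      exact (max_le (hT.dimH_apexes_le hp) (hT.dimH_apexes_le hq)).trans_lt hlt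
    obtain ⟨c, hcD, hc⟩ := (dense_compl_of_dimH_lt_finrank hdim).inter_open_nonempty D hD hne
    rw [mem_compl_iff, mem_union, not_or] at hc
    have key : ∀ r : ℝ → E, (∀ t ∈ Icc (0 : ℝ) 1, r t ∈ D \ T) →
        (¬ ∃ s ∈ Ioc (0 : ℝ) 1, ∃ t : ℝ, (1 - s) • r t + s • c ∈ D ∩ T) →
        ∀ s ∈ Icc (0 : ℝ) 1, ∀ t ∈ Icc (0 : ℝ) 1, (1 - s) • r t + s • c ∈ D \ T := by
      intro r hr hnot s hs t ht
      have hin : (1 - s) • r t + s • c ∈ D :=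
        hconv (hr t ht).1 hcD (by linarith [hs.2]) hs.1 (by ring)
      rcases hs.1.eq_or_lt with rfl | hpos
      · simpa using hr t ht
      · exact ⟨hin, fun h ↦ hnot ⟨s, ⟨hpos, hs.2⟩, t, hin, h⟩⟩
    refine ⟨c, ?_, key p hpD hc.1, key q hqD hc.2⟩
    -- At `s = 1` the cone condition says that the apex itself avoids `T`.
    simpa using key p hpD hc.1 1 (by simp) 0 (by simp)
  have seg : ∀ (x c : ↥(D \ T)), (∀ s ∈ Icc (0 : ℝ) 1, (1 - s) • (x : E) + s • (c : E) ∈ D \ T) →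
      ∃ L : Path x c, ∀ s : I, (L s : E) = (1 - (s : ℝ)) • (x : E) + (s : ℝ) • c := by
    intro x c h
    exact ⟨pathOfCurve (fun s ↦ (1 - s) • (x : E) + s • (c : E)) (by fun_prop) h x c (by simp)
      (by simp), fun s ↦ rfl⟩
  rw [IsSimplyConnected, simply_connected_iff_paths_homotopic']
  refine ⟨⟨?_, fun x y ↦ ?_⟩, fun {x y} γ₁ γ₂ ↦ ?_⟩
  · have hdim : dimH (D ∩ T) < finrank ℝ E := by
      refine lt_of_le_of_lt ?_ hlt
      refine (dimH_mono fun c hc ↦ ?_).trans (hT.dimH_apexes_le (p := fun _ ↦ 0) contDiff_const)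
      exact ⟨1, by simp, 0, by simpa using hc⟩
    obtain ⟨c, hcD, hc⟩ := (dense_compl_of_dimH_lt_finrank hdim).inter_open_nonempty D hD hne
    exact ⟨⟨c, hcD, fun h ↦ hc ⟨hcD, h⟩⟩⟩
  · obtain ⟨c, hc, h1, h2⟩ := apex (fun _ ↦ x) (fun _ ↦ y) contDiff_const contDiff_const
      (fun _ _ ↦ x.2) (fun _ _ ↦ y.2)
    obtain ⟨L, -⟩ := seg x ⟨c, hc⟩ fun s hs ↦ h1 s hs 0 (by simp)
    obtain ⟨M, -⟩ := seg y ⟨c, hc⟩ fun s hs ↦ h2 s hs 0 (by simp)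
    exact ⟨L.trans M.symm⟩
  -- With a common apex both curves are homotopic to the same broken line from `x` to `c` to `y`.
  · obtain ⟨g₁, hg₁, hgO₁, hx₁, hy₁, hom₁⟩ := exists_contDiff_homotopic_path hDT γ₁
    obtain ⟨g₂, hg₂, hgO₂, hx₂, hy₂, hom₂⟩ := exists_contDiff_homotopic_path hDT γ₂
    obtain ⟨c, hc, h1, h2⟩ := apex g₁ g₂ hg₁ hg₂ hgO₁ hgO₂
    obtain ⟨L, hL⟩ := seg x ⟨c, hc⟩ fun s hs ↦ by simpa [hx₁] using h1 s hs 0 (by simp)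
    obtain ⟨M, hM⟩ := seg y ⟨c, hc⟩ fun s hs ↦ by simpa [hy₁] using h1 s hs 1 (by simp)
    exact (hom₁.trans (pathOfCurve_homotopic_cone hg₁.continuous hgO₁ hx₁ hy₁ ⟨c, hc⟩ L M hL hM
      h1)).trans (hom₂.trans (pathOfCurve_homotopic_cone hg₂.continuous hgO₂ hx₂ hy₂ ⟨c, hc⟩ L M hL
      hM h2)).symm

end CodimensionThree

/-! ### Semiflows -/

section Semiflow

open Filter
open scoped Topology unitInterval

/-- A continuous semiflow `Ψ t`, `t ≥ 0`, by injective maps. -/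
structure IsInjectiveSemiflow {X : Type*} [TopologicalSpace X] (Ψ : ℝ → X → X) : Prop where
  continuousOn : ContinuousOn (fun z : ℝ × X ↦ Ψ z.1 z.2) (Ici 0 ×ˢ univ)
  zero : ∀ x, Ψ 0 x = x
  add : ∀ s t, 0 ≤ s → 0 ≤ t → ∀ x, Ψ (s + t) x = Ψ s (Ψ t x)
  injective : ∀ t, 0 ≤ t → Function.Injective (Ψ t)

variable {X : Type*} [TopologicalSpace X]

/-- A semiflow defined for short times extends to all times. -/
theorem exists_semiflow_of_local {ε : ℝ} (hε : 0 < ε) (ψ : ℝ → X → X)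
    (hcont : ContinuousOn (fun z : ℝ × X ↦ ψ z.1 z.2) (Icc 0 ε ×ˢ univ))
    (h0 : ∀ x, ψ 0 x = x)
    (hadd : ∀ s t, 0 ≤ s → 0 ≤ t → s + t ≤ ε → ∀ x, ψ (s + t) x = ψ s (ψ t x))
    (hinj : ∀ t ∈ Icc 0 ε, Function.Injective (ψ t)) :
    ∃ Ψ : ℝ → X → X, IsInjectiveSemiflow Ψ ∧ (∀ t ∈ Icc 0 ε, Ψ t = ψ t) := by
  have hmul : ∀ (k : ℕ) (t : ℝ), 0 ≤ t → k * t ≤ ε → (ψ t)^[k] = ψ (k * t) := by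
    intro k t ht
    induction k with
    | zero => intro _; ext x; simp [h0]
    | succ k ih =>
      intro hk
      push_cast at hk
      have h1 : (k : ℝ) * t ≤ ε := by linarith
      rw [Function.iterate_succ', ih h1]
      ext x
      rw [Function.comp_apply, ← hadd _ _ ht (by positivity) (by linarith)]
      congr 1
      push_cast
      ring
  -- Refining a subdivision of `[0, t]` does not change the iterate. Comparing `m` and `l` steps
  -- through `m * l` steps makes `Ψ` independent of the number of steps.
  have hdiv : ∀ (t : ℝ) (m l : ℕ), 0 ≤ t → 0 < m → 0 < l → t / m ≤ ε →
      (ψ (t / m))^[m] = (ψ (t / (m * l : ℕ)))^[m * l] := by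
    intro t m l ht hm hl hle
    have h1 : (l : ℝ) * (t / (m * l : ℕ)) = t / m := by
      push_cast; field_simp
    rw [mul_comm m l, Function.iterate_mul, mul_comm l m, hmul l _ (by positivity) (by rw [h1]; exact hle), h1]
  have hind : ∀ (t : ℝ) (m l : ℕ), 0 ≤ t → 0 < m → 0 < l → t / m ≤ ε → t / l ≤ ε →
      (ψ (t / m))^[m] = (ψ (t / l))^[l] := by
    intro t m l ht hm hl h1 h2
    rw [hdiv t m l ht hm hl h1, hdiv t l m ht hl hm h2, mul_comm]
  let N (t : ℝ) : ℕ := ⌈t / ε⌉₊ + 1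
  have hN : ∀ t, t / N t ≤ ε := by
    intro t
    rw [div_le_iff₀ (by positivity), mul_comm, ← div_le_iff₀ hε]
    have := Nat.le_ceil (t / ε)
    simp only [N]
    push_cast
    linarith
  let Ψ (t : ℝ) : X → X := (ψ (t / N t))^[N t]
  have hΨ : ∀ (t : ℝ) (m : ℕ), 0 ≤ t → 0 < m → t / m ≤ ε → Ψ t = (ψ (t / m))^[m] :=
    fun t m ht hm h ↦ hind t _ m ht (Nat.succ_pos _) hm (hN t) h
  have hsmall : ∀ t ∈ Icc 0 ε, Ψ t = ψ t := by
    intro t ht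
    rw [hΨ t 1 ht.1 one_pos (by simpa using ht.2)]
    simp
  have hiter : ∀ m : ℕ, ContinuousOn (fun z : ℝ × X ↦ (ψ z.1)^[m] z.2) (Icc 0 ε ×ˢ univ) := by
    intro m
    induction m with
    | zero => exact continuousOn_snd
    | succ m ih =>
      simp only [Function.iterate_succ']
      exact hcont.comp (continuousOn_fst.prodMk ih) fun z hz ↦ ⟨hz.1, mem_univ _⟩
  refine ⟨Ψ, ⟨?_, fun x ↦ ?_, fun s t hs ht x ↦ ?_, fun t ht ↦ ?_⟩, hsmall⟩
  · rintro ⟨t₀, x₀⟩ ⟨ht₀, -⟩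
    -- One number of steps serves all times up to `t₀ + 1`, so near `t₀` the semiflow is a fixed
    -- iterate and inherits continuity.
    let m : ℕ := N (t₀ + 1)
    have hm : (0 : ℝ) < m := by simp only [m, N]; positivity
    have h1 : ∀ᶠ z : ℝ × X in 𝓝[Ici 0 ×ˢ univ] (t₀, x₀), z.1 ∈ Icc 0 (t₀ + 1) := by
      have : ∀ᶠ z : ℝ × X in 𝓝 (t₀, x₀), z.1 < t₀ + 1 :=
        continuous_fst.continuousAt.eventually_lt continuousAt_const (by simp)
      filter_upwards [mem_nhdsWithin_of_mem_nhds this, self_mem_nhdsWithin] with z hz hz'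
      exact ⟨hz'.1, hz.le⟩
    have hle : ∀ t ∈ Icc 0 (t₀ + 1), t / m ∈ Icc 0 ε := fun t ht ↦
      ⟨div_nonneg ht.1 hm.le, (div_le_div_of_nonneg_right ht.2 hm.le).trans (hN _)⟩
    have h2 : ∀ᶠ z : ℝ × X in 𝓝[Ici 0 ×ˢ univ] (t₀, x₀), Ψ z.1 z.2 = (ψ (z.1 / m))^[m] z.2 := by
      filter_upwards [h1] with z hz
      rw [hΨ z.1 m hz.1 (by exact_mod_cast hm) (hle _ hz).2]
    have hmem : t₀ ∈ Icc 0 (t₀ + 1) := ⟨ht₀, by linarith⟩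
    refine ContinuousWithinAt.congr_of_eventuallyEq ?_ h2
      (by rw [hΨ t₀ m ht₀ (by exact_mod_cast hm) (hle _ hmem).2])
    have h3 := hiter m (t₀ / m, x₀) ⟨hle _ hmem, mem_univ _⟩
    refine Tendsto.comp (y := 𝓝[Icc 0 ε ×ˢ univ] (t₀ / m, x₀)) (g := fun z : ℝ × X ↦ (ψ z.1)^[m] z.2)
      (f := fun z : ℝ × X ↦ (z.1 / m, z.2)) h3 ?_
    refine tendsto_nhdsWithin_iff.2 ⟨?_, ?_⟩
    · have : Continuous fun z : ℝ × X ↦ (z.1 / (m : ℝ), z.2) := by fun_prop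
      exact this.continuousWithinAt
    · filter_upwards [h1] with z hz
      exact ⟨hle _ hz, mem_univ _⟩
  · rw [hsmall 0 ⟨le_rfl, hε.le⟩, h0]
  · let m : ℕ := N (s + t)
    have hm : (0 : ℝ) < m := by simp only [m, N]; positivity
    have hm' : 0 < m := by exact_mod_cast hm
    have hst : (s + t) / m ≤ ε := hN _
    have hs' : s / m ≤ ε := le_trans (div_le_div_of_nonneg_right (by linarith) hm.le) hst
    have ht' : t / m ≤ ε := le_trans (div_le_div_of_nonneg_right (by linarith) hm.le) hst
    rw [hΨ (s + t) m (by linarith) hm' hst, hΨ s m hs hm' hs', hΨ t m ht hm' ht']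
    rw [add_div] at hst ⊢
    have hcomm : Function.Commute (ψ (s / m)) (ψ (t / m)) := by
      intro y
      rw [← hadd _ _ (by positivity) (by positivity) hst, add_comm,
        hadd _ _ (by positivity) (by positivity) (by rwa [add_comm])]
    have hfun : ψ (s / m + t / m) = ψ (s / m) ∘ ψ (t / m) := by
      ext y
      rw [hadd _ _ (by positivity) (by positivity) hst, Function.comp_apply]
    rw [hfun, hcomm.comp_iterate, Function.comp_apply]
  · exact (hinj _ ⟨by positivity, hN t⟩).iterate _

theorem IsInjectiveSemiflow.continuous {Ψ : ℝ → X → X} (hΨ : IsInjectiveSemiflow Ψ) {t : ℝ}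
    (ht : 0 ≤ t) : Continuous (Ψ t) :=
  hΨ.continuousOn.comp_continuous (f := fun x ↦ (t, x)) (by fun_prop) fun _ ↦ ⟨ht, mem_univ _⟩

/-- Freezing negative times at `0` gives a map that is continuous on the whole product, as the
compactness and cluster point arguments require. -/
theorem IsInjectiveSemiflow.continuous_max {Ψ : ℝ → X → X} (hΨ : IsInjectiveSemiflow Ψ) :
    Continuous fun z : ℝ × X ↦ Ψ (max z.1 0) z.2 :=
  hΨ.continuousOn.comp_continuous (f := fun z : ℝ × X ↦ (max z.1 0, z.2)) (by fun_prop)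
    fun z ↦ ⟨le_max_right z.1 0, mem_univ _⟩

/-- The points lying in the image of `Ψ t` for all `t`: for a backward flow, those whose forward
orbit exists for all times. -/
def semiflowCore (Ψ : ℝ → X → X) : Set X := {x | ∀ t, 0 ≤ t → x ∈ range (Ψ t)}

/-- A closed set `B` through which a semiflow enters the space transversally: `B` is left at once,
and the points outside `B` have a past. -/
structure IsEntrance (Ψ : ℝ → X → X) (B : Set X) : Prop where
  isClosed : IsClosed B
  leaves : ∀ t, 0 < t → ∀ x, Ψ t x ∉ B
  past : ∀ x ∉ B, ∃ δ > 0, x ∈ range (Ψ δ)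

namespace IsEntrance

variable {Ψ : ℝ → X → X} {B : Set X}

/-- If `Ψ s q` were also `Ψ (s + 1) z`, injectivity would give `q = Ψ 1 z`, which has left `B`. -/
theorem notMem_core (hB : IsEntrance Ψ B) (hΨ : IsInjectiveSemiflow Ψ) {s : ℝ} (hs : 0 ≤ s) {q : X}
    (hq : q ∈ B) : Ψ s q ∈ (semiflowCore Ψ)ᶜ := by
  intro h
  obtain ⟨z, hz⟩ := h (s + 1) (by positivity)
  rw [hΨ.add _ _ hs zero_le_one] at hz
  have := hΨ.injective s hs hz
  exact hB.leaves 1 one_pos z (this ▸ hq)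

theorem eq_of_eq (hB : IsEntrance Ψ B) (hΨ : IsInjectiveSemiflow Ψ) {s t : ℝ} (hs : 0 ≤ s)
    (ht : 0 ≤ t) {q r : X} (hq : q ∈ B) (hr : r ∈ B) (h : Ψ s q = Ψ t r) : s = t ∧ q = r := by
  have key : ∀ {s t : ℝ}, 0 ≤ s → ∀ {q r : X}, q ∈ B → Ψ s q = Ψ t r → t ≤ s := by
    intro s t hs q r hq h
    by_contra! hlt
    have : Ψ t r = Ψ s (Ψ (t - s) r) := by rw [← hΨ.add _ _ hs (by linarith)]; congr 1; ring
    rw [this] at h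
    exact hB.leaves (t - s) (by linarith) r (hΨ.injective s hs h ▸ hq)
  have hst : s = t := le_antisymm (key ht hr h.symm) (key hs hq h)
  subst hst
  exact ⟨rfl, hΨ.injective s hs h⟩

/-- Go back from `x` for the longest possible time `s ≤ t`, which is attained by compactness. If the
point reached were outside `B` it would have a past, contradicting either maximality or `x ∉ range
(Ψ t)`. -/
theorem exists_eq_of_notMem_range [CompactSpace X] [T2Space X] (hB : IsEntrance Ψ B)
    (hΨ : IsInjectiveSemiflow Ψ) {x : X} {t : ℝ} (ht : 0 ≤ t) (hx : x ∉ range (Ψ t)) :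
    ∃ s ∈ Icc 0 t, ∃ q ∈ B, Ψ s q = x := by
  let S : Set ℝ := Prod.fst '' {z : ℝ × X | z ∈ Icc 0 t ×ˢ univ ∧ Ψ (max z.1 0) z.2 = x}
  have hS : IsCompact S := by
    refine IsCompact.image ?_ continuous_fst
    exact (isCompact_Icc.prod isCompact_univ).inter_right
      (isClosed_eq hΨ.continuous_max continuous_const)
  obtain ⟨s, hs⟩ := hS.exists_isGreatest ⟨0, ⟨(0, x), ⟨⟨⟨le_rfl, ht⟩, mem_univ _⟩,
    by simp [hΨ.zero]⟩, rfl⟩⟩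
  obtain ⟨⟨⟨s, q⟩, ⟨⟨hst, -⟩, hq⟩, rfl⟩, hmax⟩ := hs
  simp only at hst hq
  rw [max_eq_left hst.1] at hq
  refine ⟨s, hst, q, ?_, hq⟩
  by_contra hqB
  obtain ⟨δ, hδ, z, rfl⟩ := hB.past q hqB
  rw [← hΨ.add _ _ hst.1 hδ.le] at hq
  by_cases h : s + δ ≤ t
  · have : s + δ ≤ s := hmax ⟨(s + δ, z), ⟨⟨⟨by linarith [hst.1], h⟩, mem_univ _⟩, by
      simpa [max_eq_left (show 0 ≤ s + δ by linarith [hst.1])] using hq⟩, rfl⟩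
    linarith
  · push Not at h
    refine hx ⟨Ψ (s + δ - t) z, ?_⟩
    rw [← hΨ.add _ _ ht (by linarith), ← hq]
    congr 1
    ring

theorem _root_.IsInjectiveSemiflow.isClosed_core [CompactSpace X] [T2Space X] (hΨ : IsInjectiveSemiflow Ψ) :
    IsClosed (semiflowCore Ψ) := by
  have : semiflowCore Ψ = ⋂ t, ⋂ _ : 0 ≤ t, range (Ψ t) := by
    ext x
    simp [semiflowCore]
  rw [this]
  exact isClosed_iInter fun t ↦ isClosed_iInter fun ht ↦
    (isCompact_range (hΨ.continuous ht)).isClosed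

/-- The coordinates are the entrance time and the entrance point. They are continuous because near
`x₀` they stay in a compact set, and every cluster point solves `Ψ s q = x₀`, whose solution with `q
∈ B` is unique. -/
theorem exists_coordinates [CompactSpace X] [T2Space X] (hB : IsEntrance Ψ B)
    (hΨ : IsInjectiveSemiflow Ψ) :
    ∃ (τ : ↥(semiflowCore Ψ)ᶜ → ℝ) (r : ↥(semiflowCore Ψ)ᶜ → B), Continuous τ ∧ Continuous r ∧
      (∀ x, 0 ≤ τ x) ∧ ∀ x, Ψ (τ x) (r x) = x := by
  have hex : ∀ x : ↥(semiflowCore Ψ)ᶜ, ∃ z : ℝ × X, 0 ≤ z.1 ∧ z.2 ∈ B ∧ Ψ z.1 z.2 = x := by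
    rintro ⟨x, hx⟩
    simp only [semiflowCore, mem_compl_iff, mem_ofPred_eq, not_forall] at hx
    obtain ⟨t, ht, hxt⟩ := hx
    obtain ⟨s, hs, q, hq, h⟩ := hB.exists_eq_of_notMem_range hΨ ht hxt
    exact ⟨(s, q), hs.1, hq, h⟩
  choose f hf0 hfB hf using hex
  have hcont : Continuous f := by
    rw [continuous_iff_continuousAt]
    intro x₀
    have hT : 0 ≤ (f x₀).1 + 1 := by linarith [hf0 x₀]
    have hnot : (x₀ : X) ∉ range (Ψ ((f x₀).1 + 1)) := by
      rintro ⟨z, hz⟩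
      rw [hΨ.add _ _ (hf0 x₀) zero_le_one, ← hf x₀] at hz
      exact hB.leaves 1 one_pos z (hΨ.injective _ (hf0 x₀) hz ▸ hfB x₀)
    have hev : ∀ᶠ x : ↥(semiflowCore Ψ)ᶜ in 𝓝 x₀, (x : X) ∉ range (Ψ ((f x₀).1 + 1)) :=
      continuous_subtype_val.continuousAt.eventually
        ((isCompact_range (hΨ.continuous hT)).isClosed.isOpen_compl.mem_nhds hnot)
    refine (isCompact_Icc.prod hB.isClosed.isCompact).tendsto_nhds_of_unique_mapClusterPt
      (s := Icc 0 ((f x₀).1 + 1) ×ˢ B) ?_ ?_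
    · filter_upwards [hev] with x hx
      obtain ⟨s, hs, q, hq, h⟩ := hB.exists_eq_of_notMem_range hΨ hT hx
      obtain ⟨rfl, rfl⟩ := hB.eq_of_eq hΨ hs.1 (hf0 x) hq (hfB x) (h.trans (hf x).symm)
      exact ⟨hs, hfB x⟩
    · rintro ⟨s, q⟩ ⟨hs, hq⟩ hcl
      have h1 := hcl.continuousAt_comp (f := fun z : ℝ × X ↦ Ψ (max z.1 0) z.2)
        hΨ.continuous_max.continuousAt
      have h2 : ((fun z : ℝ × X ↦ Ψ (max z.1 0) z.2) ∘ f) = Subtype.val := by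
        ext x
        simp [max_eq_left (hf0 x), hf]
      rw [h2] at h1
      have h3 : Ψ (max s 0) q = x₀ := by
        have h4 : ClusterPt (Ψ (max s 0) q) (𝓝 (x₀ : X)) :=
          ClusterPt.mono h1 continuous_subtype_val.continuousAt
        exact eq_of_nhds_neBot h4
      simp only at hs
      rw [max_eq_left hs.1, ← hf x₀] at h3
      obtain ⟨h5, h6⟩ := hB.eq_of_eq hΨ hs.1 (hf0 x₀) hq (hfB x₀) h3
      exact Prod.ext h5 h6
  exact ⟨fun x ↦ (f x).1, fun x ↦ ⟨(f x).2, hfB x⟩, by fun_prop, by fun_prop, hf0, hf⟩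

end IsEntrance

/-- If the core of a semiflow entering a compact space through `B` can be avoided by paths and
homotopies, then the inclusion of `B` induces an isomorphism of fundamental groups. -/
theorem IsEntrance.bijective_fundamentalGroup_map {X : Type*} [MetricSpace X] [CompactSpace X]
    {Ψ : ℝ → X → X} {B : Set X} (hB : IsEntrance Ψ B) (hΨ : IsInjectiveSemiflow Ψ)
    (hU : HasSimplyConnectedTraces (semiflowCore Ψ)ᶜ)
    (hX : HasSimplyConnectedTraces (univ : Set X)) (i : C(B, X)) (hi : ∀ x, i x = x) (b : B) :
    Function.Bijective (FundamentalGroup.map i b) := by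
  obtain rfl : i = ⟨Subtype.val, continuous_subtype_val⟩ := by ext x; exact hi x
  obtain ⟨τ, r, hτ, hr, hτ0, hrτ⟩ := hB.exists_coordinates hΨ
  have hmem : ∀ x : B, (x : X) ∈ (semiflowCore Ψ)ᶜ := fun x ↦ by
    simpa [hΨ.zero] using hB.notMem_core hΨ le_rfl x.2
  let j : C(B, ↥(semiflowCore Ψ)ᶜ) := ⟨fun x ↦ ⟨x, hmem x⟩, by fun_prop⟩
  have hj : ∀ x : B, τ (j x) = 0 ∧ r (j x) = x := by
    intro x
    have := hB.eq_of_eq hΨ (hτ0 (j x)) le_rfl (r (j x)).2 x.2 (by rw [hrτ, hΨ.zero]; rfl)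
    exact ⟨this.1, Subtype.ext this.2⟩
  constructor
  -- Injectivity: a homotopy in `X` yields one off the core, which `r` carries back to `B`.
  · intro p q hpq
    obtain ⟨p, rfl⟩ := Path.Homotopic.Quotient.mk_surjective p
    obtain ⟨q, rfl⟩ := Path.Homotopic.Quotient.mk_surjective q
    have h1 : ((p.map j.continuous).map continuous_subtype_val).Homotopic
        ((q.map j.continuous).map continuous_subtype_val) := Path.Homotopic.Quotient.exact hpq
    have h2 := (hU.homotopic_of_map _ _ h1).map ⟨r, hr⟩
    have h3 := h2.pathCast (hj b).2.symm (hj b).2.symm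
    refine Path.Homotopic.Quotient.eq.2 ?_
    convert h3 using 1
    · ext t; exact congrArg Subtype.val (hj (p t)).2.symm
    · ext t; exact congrArg Subtype.val (hj (q t)).2.symm
  · intro g
    obtain ⟨g, rfl⟩ := Path.Homotopic.Quotient.mk_surjective g
    obtain ⟨p, hp⟩ := hU.exists_homotopic_map hX (x := j b) (y := j b) g
    let p' : Path b b := (p.map hr).cast (hj b).2.symm (hj b).2.symm
    -- A loop off the core slides back to `B` along the flow as its entrance times shrink linearly
    -- to zero. The base point stays fixed because its entrance time is already zero.
    have hpp : (p'.map j.continuous).Homotopic p := by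
      refine Path.Homotopic.symm ⟨⟨⟨⟨fun z ↦ ⟨Ψ (max ((1 - (z.1 : ℝ)) * τ (p z.2)) 0) (r (p z.2)),
        hB.notMem_core hΨ (le_max_right _ _) (r (p z.2)).2⟩, ?_⟩, ?_, ?_⟩, ?_⟩⟩
      · refine Continuous.subtype_mk (hΨ.continuous_max.comp
          (f := fun z : I × I ↦ ((1 - (z.1 : ℝ)) * τ (p z.2), (r (p z.2) : X))) ?_) _
        fun_prop
      · intro t
        exact Subtype.ext (by simp [max_eq_left (hτ0 (p t)), hrτ])
      · intro t
        exact Subtype.ext (by simp [p', j, hΨ.zero])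
      · intro s t ht
        rcases ht with rfl | rfl
        · refine Subtype.ext ?_
          simp only [ContinuousMap.coe_mk, Path.coe_toContinuousMap, Path.source,
            (hj b).1, (hj b).2, mul_zero, max_self, hΨ.zero]
          simp [j]
        · refine Subtype.ext ?_
          simp only [ContinuousMap.coe_mk, Path.coe_toContinuousMap, Path.target,
            (hj b).1, (hj b).2, mul_zero, max_self, hΨ.zero]
          simp [j]
    refine ⟨Path.Homotopic.Quotient.mk p', ?_⟩
    refine Path.Homotopic.Quotient.eq.2 ?_
    exact (hpp.map ⟨Subtype.val, continuous_subtype_val⟩).trans hp.symm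

end Semiflow

/-! ### Vector fields and integral curves in charts -/

section ChartField

open Filter
open scoped Topology

variable {E : Type*} [NormedAddCommGroup E] [NormedSpace ℝ E]
  {H : Type*} [TopologicalSpace H] {I : ModelWithCorners ℝ E H}
  {M : Type*} [TopologicalSpace M] [ChartedSpace H M]

/-- The expression of a vector field in the chart around `x₀`, on the target of the chart. -/
noncomputable def chartField (v : ∀ x : M, TangentSpace I x) (x₀ : M) (y : E) : E :=
  mfderiv I 𝓘(ℝ, E) (extChartAt I x₀) ((extChartAt I x₀).symm y) (v ((extChartAt I x₀).symm y))

variable {v : ∀ x : M, TangentSpace I x}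

theorem chartField_extChartAt {x₀ x : M} (hx : x ∈ (extChartAt I x₀).source) :
    chartField v x₀ (extChartAt I x₀ x) = mfderiv I 𝓘(ℝ, E) (extChartAt I x₀) x (v x) := by
  exact congrArg (fun z ↦ (mfderiv I 𝓘(ℝ, E) (extChartAt I x₀) z (v z) : E))
    ((extChartAt I x₀).left_inv hx)

variable [IsManifold I ∞ M]

theorem mfderivWithin_symm_chartField {x₀ : M} {y : E} (hy : y ∈ (extChartAt I x₀).target) :
    mfderivWithin 𝓘(ℝ, E) I (extChartAt I x₀).symm (range I) y (chartField (E := E) v x₀ y) =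
      v ((extChartAt I x₀).symm y) := by
  have := mfderivWithin_extChartAt_symm_comp_mfderiv_extChartAt (I := I) hy
  exact DFunLike.congr_fun this (v ((extChartAt I x₀).symm y))

/-- The tangent bundle is trivialized over a chart by the derivative of that chart, so smoothness of
the section is smoothness of its chart expression. -/
theorem contDiffOn_chartField
    (hv : ContMDiff I I.tangent ∞ (fun x ↦ (⟨x, v x⟩ : TangentBundle I M))) (x₀ : M) :
    ContDiffOn ℝ ∞ (chartField v x₀) (extChartAt I x₀).target := by
  have h1 : ContMDiffOn I 𝓘(ℝ, E) ∞
      (fun x ↦ (trivializationAt E (TangentSpace I) x₀ ⟨x, v x⟩).2) (chartAt H x₀).source :=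
    ((trivializationAt E (TangentSpace I) x₀).contMDiffOn_section_baseSet_iff).1 hv.contMDiffOn
  have h2 := h1.comp (contMDiffOn_extChartAt_symm (n := ∞) x₀) (by
    intro y hy
    have := (extChartAt I x₀).map_target hy
    rwa [extChartAt_source] at this)
  refine h2.contDiffOn.congr fun y hy ↦ ?_
  have hy' : (extChartAt I x₀).symm y ∈ (chartAt H x₀).source := by
    have := (extChartAt I x₀).map_target hy
    rwa [extChartAt_source] at this
  have h3 := TangentBundle.continuousLinearMapAt_trivializationAt (I := I) hy'
  refine (DFunLike.congr_fun h3 (v ((extChartAt I x₀).symm y))).symm.trans ?_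
  exact ((trivializationAt E (TangentSpace I) x₀).linearMapAt_apply (R := ℝ) _).trans (if_pos hy')

theorem contDiffWithinAt_chartField
    (hv : ContMDiff I I.tangent ∞ (fun x ↦ (⟨x, v x⟩ : TangentBundle I M))) {x₀ : M} {y : E}
    (hy : y ∈ (extChartAt I x₀).target) :
    ContDiffWithinAt ℝ ∞ (chartField v x₀) (range I) y :=
  (contDiffOn_chartField hv x₀ y hy).mono_of_mem_nhdsWithin
    (extChartAt_target_mem_nhdsWithin_of_mem hy)

theorem IsMIntegralCurveOn.hasDerivWithinAt_extChartAt {γ : ℝ → M} {s : Set ℝ}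
    (hγ : IsMIntegralCurveOn γ v s) {t : ℝ} (ht : t ∈ s) {x₀ : M}
    (hx : γ t ∈ (extChartAt I x₀).source) :
    HasDerivWithinAt (fun u ↦ extChartAt I x₀ (γ u))
      (chartField v x₀ (extChartAt I x₀ (γ t))) s t := by
  have h1 : HasMFDerivAt I 𝓘(ℝ, E) (extChartAt I x₀) (γ t) _ :=
    (mdifferentiableAt_extChartAt (by rwa [extChartAt_source] at hx)).hasMFDerivAt
  have h2 := h1.comp_hasMFDerivWithinAt t (hγ t ht)
  rw [chartField_extChartAt hx]
  have h3 : HasFDerivWithinAt (F := E) (fun u ↦ extChartAt I x₀ (γ u))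
      (ContinuousLinearMap.toSpanSingleton ℝ (M₁ := E)
        (mfderiv I 𝓘(ℝ, E) (extChartAt I x₀) (γ t) (v (γ t)))) s t := by
    refine HasFDerivWithinAt.congr_fderiv h2.hasFDerivWithinAt ?_
    ext
    exact ContinuousLinearMap.map_smul (mfderiv I 𝓘(ℝ, E) (extChartAt I x₀) (γ t)) (1 : ℝ) (v (γ t))
  exact h3

theorem isMIntegralCurveOn_symm_comp {y : ℝ → E} {s : Set ℝ} {x₀ : M}
    (hy : ∀ t ∈ s, y t ∈ (extChartAt I x₀).target)
    (hd : ∀ t ∈ s, HasDerivWithinAt y (chartField v x₀ (y t)) s t) :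
    IsMIntegralCurveOn (fun t ↦ (extChartAt I x₀).symm (y t)) v s := by
  intro t ht
  have h1 := (mdifferentiableWithinAt_extChartAt_symm (I := I) (hy t ht)).hasMFDerivWithinAt
  have h2 : HasMFDerivWithinAt 𝓘(ℝ, ℝ) 𝓘(ℝ, E) y s t _ :=
    (hd t ht).hasFDerivWithinAt.hasMFDerivWithinAt
  have h3 := h1.comp t h2 (fun u hu ↦ extChartAt_target_subset_range x₀ (hy u hu))
  refine h3.congr_mfderiv ?_
  ext
  have := mfderivWithin_symm_chartField (v := v) (hy t ht)
  exact (ContinuousLinearMap.map_smul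
    (mfderivWithin 𝓘(ℝ, E) I (extChartAt I x₀).symm (range I) (y t)) (1 : ℝ)
      (chartField (E := E) v x₀ (y t))).trans (congrArg (fun w ↦ (1 : ℝ) • w) this)

theorem exists_lipschitzOnWith_chartField
    (hv : ContMDiff I I.tangent ∞ (fun x ↦ (⟨x, v x⟩ : TangentBundle I M))) {x₀ : M} {y : E}
    (hy : y ∈ (extChartAt I x₀).target) :
    ∃ K, ∃ t ∈ 𝓝[range I] y, LipschitzOnWith K (chartField v x₀) t :=
  ((contDiffWithinAt_chartField hv hy).of_le (by norm_num)).exists_lipschitzOnWith I.convex_range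

/-- Integral curves on a compact interval which agree at one time agree. -/
theorem IsMIntegralCurveOn.eqOn_Icc [T2Space M]
    (hv : ContMDiff I I.tangent ∞ (fun x ↦ (⟨x, v x⟩ : TangentBundle I M))) {a b t₀ : ℝ}
    {γ₁ γ₂ : ℝ → M} (h₁ : IsMIntegralCurveOn γ₁ v (Icc a b)) (h₂ : IsMIntegralCurveOn γ₂ v (Icc a b))
    (ht₀ : t₀ ∈ Icc a b) (heq : γ₁ t₀ = γ₂ t₀) : EqOn γ₁ γ₂ (Icc a b) := by
  -- Local uniqueness in the chart around `γ₁ t`. The Lipschitz set `T` is a neighbourhood only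
  -- within the range of the model, which is enough even at boundary points.
  have loc : ∀ t ∈ Icc a b, γ₁ t = γ₂ t → ∀ᶠ s in 𝓝[Icc a b] t, γ₁ s = γ₂ s := by
    intro t ht hteq
    obtain ⟨K, T, hT, hK⟩ := exists_lipschitzOnWith_chartField hv
      (mem_extChartAt_target (I := I) (γ₁ t))
    have hev : ∀ γ : ℝ → M, IsMIntegralCurveOn γ v (Icc a b) → γ t = γ₁ t →
        ∀ᶠ s in 𝓝[Icc a b] t, γ s ∈ (extChartAt I (γ₁ t)).source ∧
          extChartAt I (γ₁ t) (γ s) ∈ T := by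
      intro γ hγ hγt
      have hc : Tendsto γ (𝓝[Icc a b] t) (𝓝 (γ₁ t)) := hγt ▸ hγ.continuousOn t ht
      have h1 := hc (extChartAt_source_mem_nhds (I := I) (γ₁ t))
      have h2 : Tendsto (fun s ↦ extChartAt I (γ₁ t) (γ s)) (𝓝[Icc a b] t)
          (𝓝[range I] (extChartAt I (γ₁ t) (γ₁ t))) :=
        tendsto_nhdsWithin_iff.2 ⟨(continuousAt_extChartAt (γ₁ t)).tendsto.comp hc, by
          filter_upwards with s; exact mem_range_self _⟩
      exact Eventually.and (h1 : ∀ᶠ s in _, _) (h2 hT)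
    obtain ⟨δ, hδ, hδs⟩ := Metric.mem_nhdsWithin_iff.1 ((hev γ₁ h₁ rfl).and (hev γ₂ h₂ hteq.symm))
    have hsrc : ∀ s ∈ Icc a b, |s - t| < δ → _ := fun s hs hst ↦ hδs ⟨by
      rwa [Metric.mem_ball, Real.dist_eq], hs⟩
    have heqs : ∀ s ∈ Icc a b, |s - t| < δ → γ₁ s = γ₂ s := by
      intro s hs hst
      have key : ∀ u ∈ uIcc t s, u ∈ Icc a b ∧ |u - t| < δ := by
        intro u hu
        refine ⟨(Set.uIcc_subset_Icc ht hs) hu, lt_of_le_of_lt ?_ hst⟩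
        exact abs_sub_left_of_mem_uIcc hu
      have hcont : ∀ γ : ℝ → M, IsMIntegralCurveOn γ v (Icc a b) →
          (∀ u ∈ uIcc t s, γ u ∈ (extChartAt I (γ₁ t)).source) →
          ContinuousOn (fun u ↦ extChartAt I (γ₁ t) (γ u)) (uIcc t s) := fun γ hγ hγs ↦
        (continuousOn_extChartAt (γ₁ t)).comp (hγ.continuousOn.mono fun u hu ↦ (key u hu).1) hγs
      have hs1 : ∀ u ∈ uIcc t s, _ := fun u hu ↦ hsrc u (key u hu).1 (key u hu).2
      have hc1 := hcont γ₁ h₁ fun u hu ↦ (hs1 u hu).1.1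
      have hc2 := hcont γ₂ h₂ fun u hu ↦ (hs1 u hu).2.1
      have hd1 : ∀ u ∈ uIcc t s, _ := fun u hu ↦
        h₁.hasDerivWithinAt_extChartAt (key u hu).1 (hs1 u hu).1.1
      have hd2 : ∀ u ∈ uIcc t s, _ := fun u hu ↦
        h₂.hasDerivWithinAt_extChartAt (key u hu).1 (hs1 u hu).2.1
      -- The two sides of `t` are treated separately, since `t` may be an end of the interval and
      -- only one-sided derivatives are available there.
      have hfin : extChartAt I (γ₁ t) (γ₁ s) = extChartAt I (γ₁ t) (γ₂ s) := by
        rcases le_total t s with hle | hle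
        · rw [uIcc_of_le hle] at hc1 hc2 hd1 hd2 hs1
          refine ODE_solution_unique_of_mem_Icc_right (v := fun _ ↦ chartField v (γ₁ t))
            (s := fun _ ↦ T) (K := K) (fun _ _ ↦ hK) hc1 (fun u hu ↦ ?_)
            (fun u hu ↦ (hs1 u (Ico_subset_Icc_self hu)).1.2) hc2 (fun u hu ↦ ?_)
            (fun u hu ↦ (hs1 u (Ico_subset_Icc_self hu)).2.2) (by rw [hteq]) ⟨hle, le_rfl⟩
          · exact (hd1 u (Ico_subset_Icc_self hu)).mono_of_mem_nhdsWithin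
              (Icc_mem_nhdsGE_of_mem ⟨ht.1.trans hu.1, hu.2.trans_le hs.2⟩)
          · exact (hd2 u (Ico_subset_Icc_self hu)).mono_of_mem_nhdsWithin
              (Icc_mem_nhdsGE_of_mem ⟨ht.1.trans hu.1, hu.2.trans_le hs.2⟩)
        · rw [uIcc_of_ge hle] at hc1 hc2 hd1 hd2 hs1
          refine ODE_solution_unique_of_mem_Icc_left (v := fun _ ↦ chartField v (γ₁ t))
            (s := fun _ ↦ T) (K := K) (fun _ _ ↦ hK) hc1 (fun u hu ↦ ?_)
            (fun u hu ↦ (hs1 u (Ioc_subset_Icc_self hu)).1.2) hc2 (fun u hu ↦ ?_)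
            (fun u hu ↦ (hs1 u (Ioc_subset_Icc_self hu)).2.2) (by rw [hteq]) ⟨le_rfl, hle⟩
          · exact (hd1 u (Ioc_subset_Icc_self hu)).mono_of_mem_nhdsWithin
              (Icc_mem_nhdsLE_of_mem ⟨hs.1.trans_lt hu.1, hu.2.trans ht.2⟩)
          · exact (hd2 u (Ioc_subset_Icc_self hu)).mono_of_mem_nhdsWithin
              (Icc_mem_nhdsLE_of_mem ⟨hs.1.trans_lt hu.1, hu.2.trans ht.2⟩)
      exact (extChartAt I (γ₁ t)).injOn (hsrc s hs hst).1.1 (hsrc s hs hst).2.1 hfin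
    filter_upwards [self_mem_nhdsWithin, mem_nhdsWithin_of_mem_nhds (Metric.ball_mem_nhds t hδ)]
      with s hs hst
    exact heqs s hs (by rwa [Metric.mem_ball, Real.dist_eq] at hst)
  have hclopen : IsClopen {t : Icc a b | γ₁ t = γ₂ t} := by
    constructor
    · exact isClosed_eq (continuousOn_iff_continuous_domRestrict.1 h₁.continuousOn)
        (continuousOn_iff_continuous_domRestrict.1 h₂.continuousOn)
    · rw [isOpen_iff_mem_nhds]
      intro t ht
      have := loc t t.2 ht
      rw [nhdsWithin_eq_map_subtype_coe t.2] at this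
      exact this
  have : PreconnectedSpace (Icc a b) := isPreconnected_iff_preconnectedSpace.1 isPreconnected_Icc
  have huniv := hclopen.eq_univ ⟨⟨t₀, ht₀⟩, heq⟩
  intro t ht
  have : (⟨t, ht⟩ : Icc a b) ∈ {t : Icc a b | γ₁ t = γ₂ t} := huniv ▸ mem_univ _
  exact this

end ChartField

/-! ### The flow of an inward pointing vector field -/

section InwardFlow

open Filter
open scoped Topology NNReal

/-- The local flow of a Lipschitz field, kept in a given ball. -/
theorem LipschitzWith.exists_local_flow {E : Type*} [NormedAddCommGroup E] [NormedSpace ℝ E]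
    [CompleteSpace E] {G : E → E} {C : ℝ≥0} (hG : LipschitzWith C G) (y₀ : E) {ρ : ℝ} (hρ : 0 < ρ) :
    ∃ r > 0, ∃ ε > 0, ∃ α : E → ℝ → E,
      (∀ x ∈ Metric.closedBall y₀ r, α x 0 = x ∧ ∀ t ∈ Icc 0 ε, α x t ∈ Metric.ball y₀ ρ ∧
        HasDerivWithinAt (α x) (G (α x t)) (Icc 0 ε) t) ∧
      (∃ C : ℝ≥0, ∀ t ∈ Icc 0 ε, LipschitzOnWith C (fun x ↦ α x t) (Metric.closedBall y₀ r)) ∧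
      ContinuousOn (fun z : E × ℝ ↦ α z.1 z.2) (Metric.closedBall y₀ r ×ˢ Icc 0 ε) := by
  -- `L` bounds the speed on the unit ball around `y₀`, so curves from the half ball stay in the
  -- unit ball for a time `τ` with `L * τ ≤ 1 / 2`.
  let L : ℝ≥0 := ‖G y₀‖₊ + C
  obtain ⟨τ, hτ0, hτ⟩ : ∃ τ > 0, (L : ℝ) * τ ≤ 1 / 2 := by
    refine ⟨1 / (2 * (L + 1)), by positivity, ?_⟩
    rw [mul_one_div, div_le_div_iff₀ (by positivity) two_pos]
    linarith
  have hpl : IsPicardLindelof (fun _ ↦ G) (tmin := 0) (tmax := τ)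
      ⟨0, le_rfl, hτ0.le⟩ y₀ 1 (1 / 2) L C := by
    refine IsPicardLindelof.of_time_independent (fun y hy ↦ ?_) hG.lipschitzOnWith ?_
    · have h1 := hG.norm_sub_le y y₀
      have h2 : ‖y - y₀‖ ≤ 1 := by simpa [dist_eq_norm] using hy
      have h3 := norm_le_norm_add_norm_sub (G y₀) (G y)
      rw [norm_sub_rev] at h3
      simp only [L, NNReal.coe_add, coe_nnnorm]
      nlinarith [C.2, C.coe_nonneg]
    · simp only [sub_zero, sub_self, max_eq_left hτ0.le]
      norm_num at hτ ⊢
      linarith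
  obtain ⟨α, hα, L', hL'⟩ := hpl.exists_forall_mem_closedBall_eq_hasDerivWithinAt_lipschitzOnWith
  have hαc : ContinuousOn (fun z : E × ℝ ↦ α z.1 z.2)
      (Metric.closedBall y₀ (1 / 2 : ℝ≥0) ×ˢ Icc 0 τ) :=
    continuousOn_prod_of_continuousOn_lipschitzOnWith _ L'
      (fun x hx ↦ HasDerivWithinAt.continuousOn (hα x hx).2) hL'
  have hmem : (y₀, (0 : ℝ)) ∈ Metric.closedBall y₀ (1 / 2 : ℝ≥0) ×ˢ Icc 0 τ :=
    ⟨Metric.mem_closedBall_self (by positivity), le_rfl, hτ0.le⟩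
  have hev : ∀ᶠ z in 𝓝[Metric.closedBall y₀ (1 / 2 : ℝ≥0) ×ˢ Icc 0 τ] (y₀, (0 : ℝ)),
      α z.1 z.2 ∈ Metric.ball y₀ ρ := by
    have h0 : α y₀ 0 = y₀ := (hα y₀ hmem.1).1
    have := hαc _ hmem
    refine this (Metric.isOpen_ball.mem_nhds ?_)
    simp only [h0]
    exact Metric.mem_ball_self hρ
  obtain ⟨δ, hδ, hδs⟩ := Metric.mem_nhdsWithin_iff.1 hev
  let r : ℝ := min (δ / 2) (1 / 2)
  let ε : ℝ := min (δ / 2) τ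
  have hr : 0 < r := by positivity
  have hε : 0 < ε := by positivity
  have hrsub : Metric.closedBall y₀ r ⊆ Metric.closedBall y₀ (1 / 2 : ℝ≥0) :=
    Metric.closedBall_subset_closedBall (by simp [r])
  have hεsub : Icc 0 ε ⊆ Icc 0 τ := Icc_subset_Icc_right (min_le_right _ _)
  have hball : ∀ x ∈ Metric.closedBall y₀ r, ∀ t ∈ Icc 0 ε, α x t ∈ Metric.ball y₀ ρ := by
    intro x hx t ht
    refine hδs (a := (x, t)) ⟨?_, hrsub hx, hεsub ht⟩
    rw [Metric.mem_ball, Prod.dist_eq, max_lt_iff]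
    constructor
    · exact lt_of_le_of_lt (hx.trans (min_le_left _ _)) (half_lt_self hδ)
    · rw [Real.dist_eq, sub_zero, abs_of_nonneg ht.1]
      exact lt_of_le_of_lt (ht.2.trans (min_le_left _ _)) (half_lt_self hδ)
  exact ⟨r, hr, ε, hε, α, fun x hx ↦ ⟨(hα x (hrsub hx)).1, fun t ht ↦ ⟨hball x hx t ht,
    ((hα x (hrsub hx)).2 t (hεsub ht)).mono hεsub⟩⟩, ⟨L', fun t ht ↦
    (hL' t (hεsub ht)).mono hrsub⟩, hαc.mono (prod_mono hrsub hεsub)⟩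

/-- Local flows of a Lipschitz field, kept in a half-space into which the field points. -/
theorem exists_flow_halfSpace {m : ℕ} [NeZero m] {F : EuclideanSpace ℝ (Fin m) → EuclideanSpace ℝ (Fin m)}
    {y₀ : EuclideanSpace ℝ (Fin m)} {T : Set (EuclideanSpace ℝ (Fin m))} {K : ℝ≥0}
    (hT : T ∈ 𝓝[{y | 0 ≤ y 0}] y₀) (hK : LipschitzOnWith K F T) (hy₀ : y₀ ∈ T)
    (hin : 0 < y₀ 0 ∨ 0 < F y₀ 0) :
    ∃ r > 0, ∃ ε > 0, ∃ α : EuclideanSpace ℝ (Fin m) → ℝ → EuclideanSpace ℝ (Fin m),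
      (∀ x ∈ Metric.closedBall y₀ r, 0 ≤ x 0 → α x 0 = x ∧ ∀ t ∈ Icc 0 ε, α x t ∈ T ∧ 0 ≤ α x t 0 ∧
        HasDerivWithinAt (α x) (F (α x t)) (Icc 0 ε) t) ∧
      (∃ C : ℝ≥0, ∀ t ∈ Icc 0 ε, LipschitzOnWith C (fun x ↦ α x t) (Metric.closedBall y₀ r)) ∧
      ContinuousOn (fun z : EuclideanSpace ℝ (Fin m) × ℝ ↦ α z.1 z.2)
        (Metric.closedBall y₀ r ×ˢ Icc 0 ε) := by
  -- The flow is that of a Lipschitz extension `G` to the whole space. Orbits remain in the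
  -- half-space either because they stay near an interior point or because their zeroth coordinate
  -- increases, and there `G` agrees with `F`.
  obtain ⟨G, hG, hFG⟩ := hK.extend_finite_dimension
  obtain ⟨ρ, hρ, hρT, hρin⟩ : ∃ ρ > 0, (∀ y ∈ Metric.ball y₀ ρ, 0 ≤ y 0 → y ∈ T) ∧
      ((∀ y ∈ Metric.ball y₀ ρ, 0 < y 0) ∨ ∀ y ∈ Metric.ball y₀ ρ, 0 < G y 0) := by
    obtain ⟨ρ₁, hρ₁, h₁⟩ := Metric.mem_nhdsWithin_iff.1 hT
    have h₂ : ∃ ρ₂ > 0, (∀ y ∈ Metric.ball y₀ ρ₂, 0 < y 0) ∨ ∀ y ∈ Metric.ball y₀ ρ₂, 0 < G y 0 := by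
      rcases hin with h | h
      · have : ∀ᶠ y in 𝓝 y₀, 0 < y 0 := by
          have hc : Continuous fun y : EuclideanSpace ℝ (Fin m) ↦ y 0 := by fun_prop
          exact hc.continuousAt.eventually (lt_mem_nhds h)
        obtain ⟨ρ₂, h1, h2⟩ := Metric.mem_nhds_iff.1 this
        exact ⟨ρ₂, h1, Or.inl h2⟩
      · rw [hFG hy₀] at h
        have : ∀ᶠ y in 𝓝 y₀, 0 < G y 0 := by
          have hc : Continuous fun y : EuclideanSpace ℝ (Fin m) ↦ G y 0 := by
            have := hG.continuous
            fun_prop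
          exact hc.continuousAt.eventually (lt_mem_nhds h)
        obtain ⟨ρ₂, h1, h2⟩ := Metric.mem_nhds_iff.1 this
        exact ⟨ρ₂, h1, Or.inr h2⟩
    obtain ⟨ρ₂, hρ₂, h₂⟩ := h₂
    refine ⟨min ρ₁ ρ₂, lt_min hρ₁ hρ₂, fun y hy h0 ↦ h₁ ⟨Metric.ball_subset_ball (min_le_left _ _) hy,
      h0⟩, ?_⟩
    exact h₂.imp (fun h y hy ↦ h y (Metric.ball_subset_ball (min_le_right _ _) hy))
      (fun h y hy ↦ h y (Metric.ball_subset_ball (min_le_right _ _) hy))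
  obtain ⟨r, hr, ε, hε, α, hα, hlip, hcont⟩ := hG.exists_local_flow y₀ hρ
  refine ⟨r, hr, ε, hε, α, fun x hx hx0 ↦ ⟨(hα x hx).1, ?_⟩, hlip, hcont⟩
  have hball := fun t ht ↦ ((hα x hx).2 t ht).1
  have hder := fun t ht ↦ ((hα x hx).2 t ht).2
  have hpos : ∀ t ∈ Icc 0 ε, 0 ≤ α x t 0 := by
    rcases hρin with h | h
    · exact fun t ht ↦ (h _ (hball t ht)).le
    · have hd0 : ∀ t ∈ Icc 0 ε, HasDerivWithinAt (fun t ↦ α x t 0) (G (α x t) 0) (Icc 0 ε) t := by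
        intro t ht
        exact ((EuclideanSpace.proj (𝕜 := ℝ) (0 : Fin m)).hasFDerivAt.comp_hasDerivWithinAt t
          (hder t ht))
      have hmono : MonotoneOn (fun t ↦ α x t 0) (Icc 0 ε) := by
        refine monotoneOn_of_hasDerivWithinAt_nonneg (f' := fun t ↦ G (α x t) 0) (convex_Icc 0 ε)
          (HasDerivWithinAt.continuousOn hd0)
          (fun t ht ↦ (hd0 t (interior_subset ht)).mono interior_subset)
          (fun t ht ↦ (h _ (hball t (interior_subset ht))).le)
      intro t ht
      have := hmono ⟨le_rfl, hε.le⟩ ht ht.1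
      simp only at this
      rw [(hα x hx).1] at this
      exact hx0.trans this
  intro t ht
  have hTt := hρT _ (hball t ht) (hpos t ht)
  refine ⟨hTt, hpos t ht, ?_⟩
  rw [hFG hTt]
  exact hder t ht

end InwardFlow

section InwardSemiflow

open Filter
open scoped Topology NNReal

theorem LipschitzOnWith.congr_eqOn {α β : Type*} [PseudoEMetricSpace α] [PseudoEMetricSpace β]
    {f g : α → β} {s : Set α} {C : ℝ≥0} (hf : LipschitzOnWith C f s) (h : EqOn g f s) :
    LipschitzOnWith C g s := fun x hx y hy ↦ by
  rw [h hx, h hy]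
  exact hf hx hy

variable {m : ℕ} [NeZero m] {M : Type*} [TopologicalSpace M]
  [ChartedSpace (EuclideanHalfSpace m) M] [IsManifold (𝓡∂ m) ∞ M]
  {v : ∀ x : M, TangentSpace (𝓡∂ m) x}

/-- A flow box for a vector field which points inwards along the boundary. -/
theorem exists_flowBox
    (hv : ContMDiff (𝓡∂ m) (𝓡∂ m).tangent ∞ (fun x ↦ (⟨x, v x⟩ : TangentBundle (𝓡∂ m) M)))
    (hin : ∀ x ∈ (𝓡∂ m).boundary M, 0 < chartField v x (extChartAt (𝓡∂ m) x x) 0) (x₀ : M) :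
    ∃ N : Set M, IsOpen N ∧ x₀ ∈ N ∧ N ⊆ (extChartAt (𝓡∂ m) x₀).source ∧
      ∃ ε > 0, ∃ ψ : ℝ → M → M,
        (∀ x ∈ N, ψ 0 x = x ∧ IsMIntegralCurveOn (fun t ↦ ψ t x) v (Icc 0 ε) ∧
          ∀ t ∈ Icc 0 ε, ψ t x ∈ (extChartAt (𝓡∂ m) x₀).source) ∧
        ContinuousOn (fun z : ℝ × M ↦ ψ z.1 z.2) (Icc 0 ε ×ˢ N) ∧
        ∃ C : ℝ≥0, ∀ t ∈ Icc 0 ε, LipschitzOnWith C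
          (fun y ↦ extChartAt (𝓡∂ m) x₀ (ψ t ((extChartAt (𝓡∂ m) x₀).symm y)))
          (extChartAt (𝓡∂ m) x₀ '' N) := by
  let e := extChartAt (𝓡∂ m) x₀
  obtain ⟨K, T, hT, hK⟩ := exists_lipschitzOnWith_chartField hv
    (mem_extChartAt_target (I := 𝓡∂ m) x₀)
  have hr : range (𝓡∂ m) = {y | 0 ≤ y 0} := range_modelWithCornersEuclideanHalfSpace m
  have hT' : T ∩ e.target ∈ 𝓝[{y | 0 ≤ y 0}] (e x₀) := by
    rw [← hr]
    exact inter_mem hT (extChartAt_target_mem_nhdsWithin x₀)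
  have hpos : 0 ≤ e x₀ 0 := by
    have : e x₀ ∈ range (𝓡∂ m) := mem_range_self _
    rwa [hr] at this
  have hin' : 0 < e x₀ 0 ∨ 0 < chartField v x₀ (e x₀) 0 := by
    by_cases hb : x₀ ∈ (𝓡∂ m).boundary M
    · exact Or.inr (hin x₀ hb)
    · left
      have h1 : (𝓡∂ m).IsInteriorPoint x₀ := by
        rw [← ModelWithCorners.compl_interior, notMem_compl_iff] at hb
        exact hb
      have h2 := (ModelWithCorners.isInteriorPoint_iff.1 h1)
      have h3 : e x₀ ∈ interior (range (𝓡∂ m)) := by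
        have := interior_mono (extChartAt_target_subset_range (I := 𝓡∂ m) x₀) h2
        exact this
      rw [interior_range_modelWithCornersEuclideanHalfSpace] at h3
      exact h3
  obtain ⟨r, hr0, ε, hε, α, hα, ⟨C, hC⟩, hcont⟩ := exists_flow_halfSpace hT'
    (hK.mono inter_subset_left) (mem_of_mem_nhdsWithin hpos hT') hin'
  have hopen : IsOpen (e.source ∩ e ⁻¹' Metric.ball (e x₀) r) :=
    (continuousOn_extChartAt x₀).isOpen_inter_preimage (isOpen_extChartAt_source x₀)
      Metric.isOpen_ball
  have hball : ∀ x ∈ e.source ∩ e ⁻¹' Metric.ball (e x₀) r,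
      e x ∈ Metric.closedBall (e x₀) r ∧ 0 ≤ e x 0 := by
    intro x hx
    refine ⟨Metric.ball_subset_closedBall hx.2, ?_⟩
    have : e x ∈ range (𝓡∂ m) := mem_range_self _
    rwa [hr] at this
  have hα' : ∀ x ∈ e.source ∩ e ⁻¹' Metric.ball (e x₀) r, _ := fun x hx ↦
    hα (e x) (hball x hx).1 (hball x hx).2
  refine ⟨e.source ∩ e ⁻¹' Metric.ball (e x₀) r, hopen,
    ⟨mem_extChartAt_source x₀, Metric.mem_ball_self hr0⟩, inter_subset_left, ε, hε,
    fun t x ↦ e.symm (α (e x) t), fun x hx ↦ ⟨?_, ?_, fun t ht ↦ ?_⟩, ?_, C, fun t ht ↦ ?_⟩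
  · exact (congrArg e.symm (hα' x hx).1).trans (e.left_inv hx.1)
  · exact isMIntegralCurveOn_symm_comp (fun t ht ↦ ((hα' x hx).2 t ht).1.2)
      (fun t ht ↦ ((hα' x hx).2 t ht).2.2)
  · exact e.map_target ((hα' x hx).2 t ht).1.2
  · have h1 : ContinuousOn (fun z : ℝ × M ↦ α (e z.2) z.1)
        (Icc 0 ε ×ˢ (e.source ∩ e ⁻¹' Metric.ball (e x₀) r)) := by
      refine hcont.comp (f := fun z : ℝ × M ↦ (e z.2, z.1)) (ContinuousOn.prodMk
        ((continuousOn_extChartAt x₀).comp continuousOn_snd fun z hz ↦ hz.2.1) continuousOn_fst)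
        (fun z hz ↦ ⟨(hball _ hz.2).1, hz.1⟩)
    exact (continuousOn_extChartAt_symm x₀).comp h1 fun z hz ↦ ((hα' _ hz.2).2 _ hz.1).1.2
  · refine ((hC t ht).mono ?_).congr_eqOn ?_
    · rintro _ ⟨x, hx, rfl⟩
      exact (hball x hx).1
    · rintro _ ⟨x, hx, rfl⟩
      have h1 : e.symm (e x) = x := e.left_inv hx.1
      change e (e.symm (α (e (e.symm (e x))) t)) = α (e x) t
      rw [h1]
      exact e.right_inv ((hα' x hx).2 t ht).1.2

/-- A vector field on a compact manifold which points inwards along the boundary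
generates a semiflow, which is locally Lipschitz in charts. -/
theorem exists_semiflow_of_inward [CompactSpace M] [T2Space M]
    (hv : ContMDiff (𝓡∂ m) (𝓡∂ m).tangent ∞ (fun x ↦ (⟨x, v x⟩ : TangentBundle (𝓡∂ m) M)))
    (hin : ∀ x ∈ (𝓡∂ m).boundary M, 0 < chartField v x (extChartAt (𝓡∂ m) x x) 0) :
    ∃ Ψ : ℝ → M → M, IsInjectiveSemiflow Ψ ∧
      (∀ x, IsMIntegralCurveOn (fun t ↦ Ψ t x) v (Ici 0)) ∧
      ∀ x₀ : M, ∃ N ∈ 𝓝 x₀, N ⊆ (extChartAt (𝓡∂ m) x₀).source ∧ ∃ ε > 0, ∃ C : ℝ≥0, ∀ t ∈ Icc 0 ε,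
        MapsTo (Ψ t) N (extChartAt (𝓡∂ m) x₀).source ∧ LipschitzOnWith C
          (fun y ↦ extChartAt (𝓡∂ m) x₀ (Ψ t ((extChartAt (𝓡∂ m) x₀).symm y)))
          (extChartAt (𝓡∂ m) x₀ '' N) := by
  choose N hNo hxN hNs ε' hε' β hβ hβc C hC using exists_flowBox hv hin
  obtain ⟨T, hT⟩ := isCompact_univ.elim_nhds_subcover N fun x _ ↦ (hNo x).mem_nhds (hxN x)
  obtain ⟨ε, hε0, hε⟩ : ∃ ε > 0, ∀ i ∈ T, ε ≤ ε' i := by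
    have h1 : ∀ᶠ ε in 𝓝[>] (0 : ℝ), ∀ i ∈ T, ε ≤ ε' i :=
      (Filter.eventually_all_finset T).2 fun i _ ↦
        mem_nhdsWithin_of_mem_nhds (Iic_mem_nhds (hε' i))
    obtain ⟨ε, h⟩ := (h1.and self_mem_nhdsWithin).exists
    exact ⟨ε, h.2, h.1⟩
  have hc : ∀ x : M, ∃ i ∈ T, x ∈ N i := fun x ↦ by
    simpa using hT.2 (mem_univ x)
  choose c hcT hcN using hc
  -- The flow box of `x` is chosen arbitrarily; by uniqueness of integral curves the choice does not
  -- matter, and all properties transfer from each box.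
  let ψ : ℝ → M → M := fun t x ↦ β (c x) t x
  have hψ0 : ∀ x, ψ 0 x = x := fun x ↦ (hβ (c x) x (hcN x)).1
  have hψint : ∀ x, IsMIntegralCurveOn (fun t ↦ ψ t x) v (Icc 0 ε) := fun x ↦
    (hβ (c x) x (hcN x)).2.1.mono (Icc_subset_Icc_right (hε _ (hcT x)))
  have hψβ : ∀ i, ∀ x ∈ N i, ∀ δ, δ ≤ ε → δ ≤ ε' i → ∀ t ∈ Icc 0 δ, ψ t x = β i t x := by
    intro i x hx δ hδ hδi t ht
    exact IsMIntegralCurveOn.eqOn_Icc hv ((hψint x).mono (Icc_subset_Icc_right hδ))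
      ((hβ i x hx).2.1.mono (Icc_subset_Icc_right hδi)) ⟨le_rfl, ht.1.trans ht.2⟩
      ((hψ0 x).trans (hβ i x hx).1.symm) ht
  have hcont : ContinuousOn (fun z : ℝ × M ↦ ψ z.1 z.2) (Icc 0 ε ×ˢ univ) := by
    rintro ⟨t, x⟩ ⟨ht, -⟩
    have h1 : ContinuousOn (fun z : ℝ × M ↦ ψ z.1 z.2) (Icc 0 ε ×ˢ N (c x)) :=
      ((hβc (c x)).mono (prod_mono_left (Icc_subset_Icc_right (hε _ (hcT x))))).congr
        fun z hz ↦ hψβ (c x) z.2 hz.2 ε le_rfl (hε _ (hcT x)) z.1 hz.1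
    refine (h1 (t, x) ⟨ht, hcN x⟩).mono_of_mem_nhdsWithin ?_
    have h2 : univ ×ˢ N (c x) ∈ 𝓝 (t, x) := prod_mem_nhds univ_mem ((hNo _).mem_nhds (hcN x))
    filter_upwards [self_mem_nhdsWithin, mem_nhdsWithin_of_mem_nhds h2] with z hz hz'
    exact ⟨hz.1, hz'.2⟩
  have hadd : ∀ s t, 0 ≤ s → 0 ≤ t → s + t ≤ ε → ∀ x, ψ (s + t) x = ψ s (ψ t x) := by
    intro s t hs ht hst x
    have h1 : IsMIntegralCurveOn (fun u ↦ ψ (u + t) x) v (Icc 0 s) :=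
      ((hψint x).comp_add t).mono fun u hu ↦ ⟨add_nonneg hu.1 ht, by
        have := hu.2; linarith⟩
    exact IsMIntegralCurveOn.eqOn_Icc hv h1
      ((hψint (ψ t x)).mono (Icc_subset_Icc_right (by linarith))) ⟨le_rfl, hs⟩
      (by simp only [zero_add, hψ0]) ⟨hs, le_rfl⟩
  have hinj : ∀ t ∈ Icc 0 ε, Function.Injective (ψ t) := by
    intro t ht x y hxy
    have := IsMIntegralCurveOn.eqOn_Icc hv (hψint x) (hψint y) ht hxy ⟨le_rfl, hε0.le⟩
    simpa only [hψ0] using this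
  obtain ⟨Ψ, hΨ, hΨψ⟩ := exists_semiflow_of_local hε0 ψ hcont hψ0 hadd hinj
  refine ⟨Ψ, hΨ, fun x t ht ↦ ?_, fun x₀ ↦ ?_⟩
  · have ht : 0 ≤ t := ht
    -- The interval `[t₁, t₁ + ε]` is a neighbourhood of `t` in `[0, ∞)`, and on it the orbit is a
    -- translate of a short orbit of `ψ`.
    let t₁ := max 0 (t - ε / 2)
    have ht₁ : 0 ≤ t₁ := le_max_left _ _
    have htt : t₁ ≤ t := max_le ht (by linarith)
    have ht2 : t < t₁ + ε := by
      have : t - ε / 2 ≤ t₁ := le_max_right _ _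
      linarith
    have h1 : IsMIntegralCurveOn (fun s ↦ ψ (s + -t₁) (Ψ t₁ x)) v (Icc t₁ (t₁ + ε)) :=
      ((hψint (Ψ t₁ x)).comp_add (-t₁)).mono fun u hu ↦ ⟨by linarith [hu.1], by linarith [hu.2]⟩
    have h2 : ∀ s ∈ Icc t₁ (t₁ + ε), Ψ s x = ψ (s + -t₁) (Ψ t₁ x) := by
      intro s hs
      rw [← hΨψ (s + -t₁) ⟨by linarith [hs.1], by linarith [hs.2]⟩,
        ← hΨ.add _ _ (by linarith [hs.1]) ht₁]
      ring_nf
    have h3 : IsMIntegralCurveOn (fun s ↦ Ψ s x) v (Icc t₁ (t₁ + ε)) := by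
      intro s hs
      have := HasMFDerivWithinAt.congr_mono (f₁ := fun s ↦ Ψ s x) (h1 s hs) (fun u hu ↦ h2 u hu)
        (h2 s hs) Subset.rfl
      exact this.congr_mfderiv (congrArg (fun z ↦ ContinuousLinearMap.smulRight (1 : ℝ →L[ℝ] ℝ)
        (v z : EuclideanSpace ℝ (Fin m))) (h2 s hs).symm)
    refine (h3 t ⟨htt, ht2.le⟩).mono_of_mem_nhdsWithin ?_
    rcases eq_or_lt_of_le htt with h | h
    · have h0 : t₁ = 0 := by
        by_contra hne
        have : t₁ = t - ε / 2 := by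
          rcases max_choice 0 (t - ε / 2) with h' | h'
          · exact absurd h' hne
          · exact h'
        linarith
      filter_upwards [self_mem_nhdsWithin, mem_nhdsWithin_of_mem_nhds (Iic_mem_nhds ht2)]
        with s hs hs'
      exact ⟨by rw [h0]; exact hs, hs'⟩
    · exact mem_nhdsWithin_of_mem_nhds (Icc_mem_nhds h ht2)
  · have hδ : 0 < min ε (ε' x₀) := lt_min hε0 (hε' x₀)
    refine ⟨N x₀, (hNo x₀).mem_nhds (hxN x₀), hNs x₀, min ε (ε' x₀), hδ, C x₀, fun t ht ↦ ?_⟩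
    have h1 : ∀ x ∈ N x₀, Ψ t x = β x₀ t x := by
      intro x hx
      rw [hΨψ t ⟨ht.1, ht.2.trans (min_le_left _ _)⟩]
      exact hψβ x₀ x hx _ (min_le_left _ _) (min_le_right _ _) t ht
    have ht' : t ∈ Icc 0 (ε' x₀) := ⟨ht.1, ht.2.trans (min_le_right _ _)⟩
    constructor
    · intro x hx
      rw [h1 x hx]
      exact (hβ x₀ x hx).2.2 t ht'
    · refine (hC x₀ t ht').congr_eqOn ?_
      rintro _ ⟨x, hx, rfl⟩
      have : (extChartAt (𝓡∂ m) x₀).symm (extChartAt (𝓡∂ m) x₀ x) = x :=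
        (extChartAt (𝓡∂ m) x₀).left_inv (hNs x₀ hx)
      simp only [this, h1 x hx]

end InwardSemiflow

/-! ### Lipschitz-covered sets: countable unions, images, charts and semiflows. -/

section CoveredByLipschitz

open Filter
open scoped Topology NNReal

section Normed

variable {E F : Type*} [NormedAddCommGroup E] [NormedAddCommGroup F]

theorem CoveredByLipschitz.of_countable {n : ℕ} {ι : Type*} [Countable ι]
    {f : ι → EuclideanSpace ℝ (Fin n) → E} {T : Set E} (hf : ∀ i, ∃ C : ℝ≥0, LipschitzWith C (f i))
    (hT : T ⊆ ⋃ i, range (f i)) : CoveredByLipschitz n T := by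
  rcases isEmpty_or_nonempty ι with h | h
  · refine ⟨fun _ _ ↦ 0, fun _ ↦ ⟨0, LipschitzWith.const 0⟩, fun x hx ↦ ?_⟩
    obtain ⟨i, -⟩ := mem_iUnion.1 (hT hx)
    exact (h.false i).elim
  · obtain ⟨g, hg⟩ := exists_surjective_nat ι
    refine ⟨fun k ↦ f (g k), fun k ↦ hf _, fun x hx ↦ ?_⟩
    obtain ⟨i, hi⟩ := mem_iUnion.1 (hT hx)
    obtain ⟨k, rfl⟩ := hg i
    exact mem_iUnion.2 ⟨k, hi⟩

theorem CoveredByLipschitz.iUnion {n : ℕ} {ι : Type*} [Countable ι] {T : ι → Set E}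
    (hT : ∀ i, CoveredByLipschitz n (T i)) : CoveredByLipschitz n (⋃ i, T i) := by
  choose f hf hfT using hT
  refine .of_countable (ι := ι × ℕ) (f := fun z ↦ f z.1 z.2) (fun z ↦ hf z.1 z.2) ?_
  refine iUnion_subset fun i x hx ↦ ?_
  obtain ⟨k, hk⟩ := mem_iUnion.1 (hfT i hx)
  exact mem_iUnion.2 ⟨(i, k), hk⟩

/-- Images under locally Lipschitz maps. -/
theorem CoveredByLipschitz.image [SecondCountableTopology E] [NormedSpace ℝ F]
    [FiniteDimensional ℝ F] {n : ℕ} {T : Set E} (hT : CoveredByLipschitz n T) {f : E → F}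
    (hf : ∀ y ∈ T, ∃ t ∈ 𝓝[T] y, ∃ K : ℝ≥0, LipschitzOnWith K f t) :
    CoveredByLipschitz n (f '' T) := by
  obtain ⟨g, hg, hgT⟩ := hT
  choose! t ht K hK using hf
  obtain ⟨J, hJT, hJc, hJ⟩ := TopologicalSpace.countable_cover_nhdsWithin ht
  have := hJc.to_subtype
  choose C hC using hg
  -- On each of countably many pieces `f ∘ g i` is Lipschitz, and a Lipschitz map into a
  -- finite-dimensional space extends to all of `ℝⁿ`.
  have hex : ∀ z : J × ℕ, ∃ h : EuclideanSpace ℝ (Fin n) → F, (∃ C : ℝ≥0, LipschitzWith C h) ∧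
      EqOn (f ∘ g z.2) h (g z.2 ⁻¹' t z.1) := by
    intro z
    obtain ⟨h, h1, h2⟩ := ((hK z.1 (hJT z.1.2)).comp ((hC z.2).lipschitzOnWith (s := g z.2 ⁻¹' t z.1))
      (mapsTo_preimage _ _)).extend_finite_dimension
    exact ⟨h, ⟨_, h1⟩, h2⟩
  choose h hh hhf using hex
  refine .of_countable hh ?_
  rintro _ ⟨y, hy, rfl⟩
  obtain ⟨i, w, rfl⟩ := mem_iUnion.1 (hgT hy)
  obtain ⟨j, hj, hyj⟩ := mem_iUnion₂.1 (hJ hy)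
  exact mem_iUnion.2 ⟨(⟨j, hj⟩, i), w, (hhf (⟨j, hj⟩, i) hyj).symm⟩

/-- Lipschitz images of subsets of a space of dimension at most `n`. -/
theorem CoveredByLipschitz.of_lipschitzOnWith [NormedSpace ℝ E] [FiniteDimensional ℝ E]
    [NormedSpace ℝ F] [FiniteDimensional ℝ F] {n : ℕ} (hn : Module.finrank ℝ E ≤ n) {f : E → F}
    {S : Set E} {K : ℝ≥0} (hf : LipschitzOnWith K f S) : CoveredByLipschitz n (f '' S) := by
  obtain ⟨g, hg, hfg⟩ := hf.extend_finite_dimension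
  -- A linear surjection from `ℝⁿ` allows the source to have smaller dimension.
  obtain ⟨L, hL⟩ : ∃ L : EuclideanSpace ℝ (Fin n) →ₗ[ℝ] E, Function.Surjective L := by
    refine ⟨(Module.finBasis ℝ E).equivFun.symm.toLinearMap ∘ₗ LinearMap.funLeft ℝ ℝ (Fin.castLE hn) ∘ₗ
      (WithLp.linearEquiv 2 ℝ (Fin n → ℝ)).toLinearMap, ?_⟩
    exact (Module.finBasis ℝ E).equivFun.symm.surjective.comp
      ((LinearMap.funLeft_surjective_of_injective ℝ ℝ _ (Fin.castLE_injective hn)).comp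
        (WithLp.linearEquiv 2 ℝ (Fin n → ℝ)).surjective)
  refine ⟨fun _ ↦ g ∘ L, fun _ ↦ ⟨_, hg.comp (LinearMap.toContinuousLinearMap L).lipschitz⟩, ?_⟩
  rintro _ ⟨y, hy, rfl⟩
  obtain ⟨w, rfl⟩ := hL y
  exact mem_iUnion.2 ⟨0, w, (hfg hy).symm⟩

end Normed

variable {E : Type*} [NormedAddCommGroup E] [NormedSpace ℝ E]
  {H : Type*} [TopologicalSpace H] {I : ModelWithCorners ℝ E H}
  {M : Type*} [TopologicalSpace M] [ChartedSpace H M]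

variable (I) in
/-- A subset of a manifold which is covered by countably many Lipschitz images of `ℝⁿ` in each
chart. -/
def CoveredByLipschitzInCharts (n : ℕ) (T : Set M) : Prop :=
  ∀ x₀ : M, CoveredByLipschitz n (extChartAt I x₀ '' (T ∩ (extChartAt I x₀).source))

theorem CoveredByLipschitzInCharts.iUnion {n : ℕ} {ι : Type*} [Countable ι] {T : ι → Set M}
    (hT : ∀ i, CoveredByLipschitzInCharts I n (T i)) :
    CoveredByLipschitzInCharts I n (⋃ i, T i) := by
  intro x₀
  rw [iUnion_inter, image_iUnion]
  exact .iUnion fun i ↦ hT i x₀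

theorem CoveredByLipschitzInCharts.mono {n : ℕ} {S T : Set M}
    (hT : CoveredByLipschitzInCharts I n T) (h : S ⊆ T) : CoveredByLipschitzInCharts I n S :=
  fun x₀ ↦ (hT x₀).mono (image_mono (inter_subset_inter_left _ h))

/-- It suffices to check one chart. -/
theorem CoveredByLipschitzInCharts.of_subset_source [IsManifold I ∞ M] [FiniteDimensional ℝ E]
    {n : ℕ} {T : Set M} {x₀ : M} (hT : T ⊆ (extChartAt I x₀).source)
    (h : CoveredByLipschitz n (extChartAt I x₀ '' T)) : CoveredByLipschitzInCharts I n T := by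
  intro x₁
  have := FiniteDimensional.proper ℝ E
  have h1 : CoveredByLipschitz n (extChartAt I x₀ '' (T ∩ (extChartAt I x₁).source)) :=
    h.mono (image_mono inter_subset_left)
  have h2 := h1.image (f := extChartAt I x₁ ∘ (extChartAt I x₀).symm) (by
    rintro _ ⟨x, ⟨hx, hx1⟩, rfl⟩
    have hx0 := hT hx
    have hcd : ContDiffWithinAt ℝ ∞ (extChartAt I x₁ ∘ (extChartAt I x₀).symm) (range I)
        (extChartAt I x₀ x) := by
      refine contDiffWithinAt_ext_coord_change x₁ x₀ ?_
      rw [PartialEquiv.trans_source]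
      refine ⟨(extChartAt I x₀).map_source hx0, ?_⟩
      rw [mem_preimage, (extChartAt I x₀).left_inv hx0]
      exact hx1
    obtain ⟨K, t, ht, hK⟩ := (hcd.of_le (by norm_num)).exists_lipschitzOnWith I.convex_range
    refine ⟨t, nhdsWithin_mono _ ?_ ht, K, hK⟩
    rintro _ ⟨z, -, rfl⟩
    exact mem_range_self _)
  refine h2.mono ?_
  rintro _ ⟨x, hx, rfl⟩
  refine ⟨_, ⟨x, hx, rfl⟩, ?_⟩
  exact congrArg (extChartAt I x₁) ((extChartAt I x₀).left_inv (hT hx.1))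

/-- Images under a semiflow which is locally Lipschitz in charts. -/
theorem CoveredByLipschitzInCharts.image_semiflow [IsManifold I ∞ M] [FiniteDimensional ℝ E]
    [CompactSpace M] {Ψ : ℝ → M → M} (hΨ : IsInjectiveSemiflow Ψ)
    (hlip : ∀ x₀ : M, ∃ N ∈ 𝓝 x₀, N ⊆ (extChartAt I x₀).source ∧ ∃ ε > 0, ∃ C : ℝ≥0, ∀ t ∈ Icc 0 ε,
      MapsTo (Ψ t) N (extChartAt I x₀).source ∧ LipschitzOnWith C
        (fun y ↦ extChartAt I x₀ (Ψ t ((extChartAt I x₀).symm y))) (extChartAt I x₀ '' N))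
    {n : ℕ} {T : Set M} (hT : CoveredByLipschitzInCharts I n T) {t : ℝ} (ht : 0 ≤ t) :
    CoveredByLipschitzInCharts I n (Ψ t '' T) := by
  have := FiniteDimensional.proper ℝ E
  choose N hN hNs ε' hε' C hC using hlip
  obtain ⟨J, hJ⟩ := isCompact_univ.elim_nhds_subcover N fun x _ ↦ hN x
  obtain ⟨ε, hε0, hε⟩ : ∃ ε > 0, ∀ i ∈ J, ε ≤ ε' i := by
    have h1 : ∀ᶠ ε in 𝓝[>] (0 : ℝ), ∀ i ∈ J, ε ≤ ε' i :=
      (Filter.eventually_all_finset J).2 fun i _ ↦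
        mem_nhdsWithin_of_mem_nhds (Iic_mem_nhds (hε' i))
    obtain ⟨ε, h⟩ := (h1.and self_mem_nhdsWithin).exists
    exact ⟨ε, h.2, h.1⟩
  have small : ∀ s ∈ Icc 0 ε, ∀ S : Set M, CoveredByLipschitzInCharts I n S →
      CoveredByLipschitzInCharts I n (Ψ s '' S) := by
    intro s hs S hS
    have h1 : ∀ i : J, CoveredByLipschitzInCharts I n (Ψ s '' (S ∩ N i)) := by
      intro i
      have hs' : s ∈ Icc 0 (ε' i) := ⟨hs.1, hs.2.trans (hε i i.2)⟩
      refine .of_subset_source (x₀ := (i : M)) ?_ ?_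
      · rintro _ ⟨x, hx, rfl⟩
        exact (hC i s hs').1 hx.2
      · have h2 : CoveredByLipschitz n (extChartAt I (i : M) '' (S ∩ N i)) :=
          (hS i).mono (image_mono (inter_subset_inter_right _ (hNs i)))
        have h3 := h2.image (f := fun y ↦ extChartAt I (i : M) (Ψ s ((extChartAt I (i : M)).symm y)))
          fun y _ ↦ ⟨_, self_mem_nhdsWithin, C i,
            (hC i s hs').2.mono (image_mono inter_subset_right)⟩
        refine h3.mono ?_
        rintro _ ⟨_, ⟨x, hx, rfl⟩, rfl⟩
        refine ⟨_, ⟨x, hx, rfl⟩, ?_⟩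
        exact congrArg (fun z ↦ extChartAt I (i : M) (Ψ s z))
          ((extChartAt I (i : M)).left_inv (hNs i hx.2))
    refine (CoveredByLipschitzInCharts.iUnion h1).mono ?_
    rintro _ ⟨x, hx, rfl⟩
    obtain ⟨i, hi, hxi⟩ := mem_iUnion₂.1 (hJ.2 (mem_univ x))
    exact mem_iUnion.2 ⟨⟨i, hi⟩, x, ⟨hx, hxi⟩, rfl⟩
  have iter : ∀ (k : ℕ), ∀ s ∈ Icc 0 ε, CoveredByLipschitzInCharts I n (Ψ (k * s) '' T) := by
    intro k s hs
    induction k with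
    | zero =>
      refine hT.mono ?_
      rintro _ ⟨x, hx, rfl⟩
      simpa only [Nat.cast_zero, zero_mul, hΨ.zero] using hx
    | succ k ih =>
      refine (small s hs _ ih).mono ?_
      rintro _ ⟨x, hx, rfl⟩
      refine ⟨_, ⟨x, hx, rfl⟩, ?_⟩
      rw [← hΨ.add _ _ hs.1 (mul_nonneg k.cast_nonneg hs.1)]
      push_cast
      ring_nf
  -- A long time is cut into `k` equal steps shorter than the uniform Lipschitz time.
  obtain ⟨k, hk⟩ := exists_nat_gt (t / ε)
  have hk0 : (0 : ℝ) < k := lt_of_le_of_lt (by positivity) hk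
  have := iter k (t / k) ⟨by positivity, by
    rw [div_le_iff₀ hk0]
    rw [div_lt_iff₀ hε0] at hk
    linarith⟩
  rwa [mul_div_cancel₀ _ hk0.ne'] at this

end CoveredByLipschitz

/-! ### Lyapunov forms of conformally symplectic linear fields -/

section Lyapunov

open Module
open scoped Topology RealInnerProductSpace

section Projection

variable {E : Type*} [NormedAddCommGroup E] [NormedSpace ℝ E] [FiniteDimensional ℝ E]

/-- A symmetric bilinear form is nonpositive on a subspace, the projection to which is
injective on the cone where the form is nonpositive. -/
theorem exists_projection_nonpos (Q : E →L[ℝ] E →L[ℝ] ℝ) (hQ : ∀ x y, Q x y = Q y x) :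
    ∃ (J : Type) (_ : Fintype J) (N : Submodule ℝ E), finrank ℝ N = Fintype.card J ∧
      (∀ z ∈ N, Q z z ≤ 0) ∧ ∃ (P : E →L[ℝ] (J → ℝ)) (C : ℝ), 0 ≤ C ∧
        ∀ z, Q z z ≤ 0 → ‖z‖ ≤ C * ‖P z‖ := by
  classical
  obtain ⟨b, hb⟩ := LinearMap.BilinForm.exists_orthogonal_basis
    (B := (Q.toLinearMap₁₂ : LinearMap.BilinForm ℝ E)) ⟨hQ⟩
  have hb' : ∀ i j, i ≠ j → Q (b i) (b j) = 0 := fun i j hij ↦ hb hij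
  have hsum : ∀ z, Q z z = ∑ i, Q (b i) (b i) * (b.repr z i) ^ 2 := by
    intro z
    conv_lhs => rw [← b.sum_repr z]
    simp only [map_sum, map_smul, sum_apply, smul_apply,
      smul_eq_mul]
    refine Finset.sum_congr rfl fun i _ ↦ ?_
    rw [Finset.sum_eq_single i]
    · ring
    · intro j _ hj
      rw [hb' j i hj]
      ring
    · simp
  let J := {i : Fin (finrank ℝ E) // Q (b i) (b i) ≤ 0}
  let P : E →ₗ[ℝ] (J → ℝ) := LinearMap.pi fun i ↦ b.coord i
  have hP : ∀ z (i : J), P z i = b.repr z i := fun z i ↦ rfl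
  let S : ℝ := ∑ i, |Q (b i) (b i)|
  have hS : 0 ≤ S := Finset.sum_nonneg fun _ _ ↦ abs_nonneg _
  -- For indices in `J` the quotient is nonpositive, or zero by convention, so its root is `0` and
  -- the maximum is `1`.
  let C : ℝ := ∑ i, max 1 √(S / Q (b i) (b i)) * ‖b i‖
  refine ⟨J, inferInstance, Submodule.span ℝ (range fun i : J ↦ b i), ?_, ?_,
    LinearMap.toContinuousLinearMap P, C, Finset.sum_nonneg fun _ _ ↦ by positivity, ?_⟩
  · exact finrank_span_eq_card (b.linearIndependent.comp _ Subtype.val_injective)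
  · intro z hz
    have hz0 : ∀ i, ¬ Q (b i) (b i) ≤ 0 → b.repr z i = 0 := by
      intro i hi
      induction hz using Submodule.span_induction with
      | mem x hx =>
        obtain ⟨j, rfl⟩ := hx
        have : (j : Fin _) ≠ i := fun h ↦ hi (h ▸ j.2)
        simp [this]
      | zero => simp
      | add x y _ _ hx hy => simp [hx, hy]
      | smul a x _ hx => simp [hx]
    rw [hsum]
    refine Finset.sum_nonpos fun i _ ↦ ?_
    by_cases hi : Q (b i) (b i) ≤ 0
    · exact mul_nonpos_of_nonpos_of_nonneg hi (sq_nonneg _)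
    · simp [hz0 i hi]
  · intro z hz
    change ‖z‖ ≤ C * ‖P z‖
    have hle : ∀ i, |b.repr z i| ≤ max 1 √(S / Q (b i) (b i)) * ‖P z‖ := by
      intro i
      by_cases hi : Q (b i) (b i) ≤ 0
      · have h1 : |b.repr z i| ≤ ‖P z‖ := by
          have := norm_le_pi_norm (P z) ⟨i, hi⟩
          rwa [hP, Real.norm_eq_abs] at this
        nlinarith [le_max_left 1 √(S / Q (b i) (b i)), norm_nonneg (P z)]
      · rw [not_le] at hi
        -- Since `Q z z ≤ 0`, one positive term of the diagonal sum is at most the total size of the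
        -- nonpositive ones, which is controlled by `P z`.
        have h1 : Q (b i) (b i) * (b.repr z i) ^ 2 ≤ S * ‖P z‖ ^ 2 := by
          have h2 : ∑ j ∈ Finset.univ.erase i, -(|Q (b j) (b j)| * ‖P z‖ ^ 2) ≤
              ∑ j ∈ Finset.univ.erase i, Q (b j) (b j) * (b.repr z j) ^ 2 := by
            refine Finset.sum_le_sum fun j _ ↦ ?_
            by_cases hj : Q (b j) (b j) ≤ 0
            · have h3 : |b.repr z j| ≤ ‖P z‖ := by
                have := norm_le_pi_norm (P z) ⟨j, hj⟩
                rwa [hP, Real.norm_eq_abs] at this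
              have h4 : (b.repr z j) ^ 2 ≤ ‖P z‖ ^ 2 := by
                rw [← sq_abs]
                gcongr
              rw [abs_of_nonpos hj]
              nlinarith
            · rw [not_le] at hj
              have : 0 ≤ |Q (b j) (b j)| * ‖P z‖ ^ 2 := by positivity
              have : 0 ≤ Q (b j) (b j) * (b.repr z j) ^ 2 := by positivity
              linarith
          rw [hsum, ← Finset.add_sum_erase _ _ (Finset.mem_univ i)] at hz
          rw [Finset.sum_neg_distrib, ← Finset.sum_mul] at h2
          have h5 : ∑ j ∈ Finset.univ.erase i, |Q (b j) (b j)| ≤ S :=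
            Finset.sum_le_univ_sum_of_nonneg fun _ ↦ abs_nonneg _
          have h6 := mul_le_mul_of_nonneg_right h5 (sq_nonneg ‖P z‖)
          linarith
        have h2 : |b.repr z i| ≤ √(S / Q (b i) (b i)) * ‖P z‖ := by
          refine abs_le_of_sq_le_sq ?_ (by positivity)
          rw [mul_pow, Real.sq_sqrt (by positivity), div_mul_eq_mul_div, le_div_iff₀ hi]
          linarith
        exact h2.trans (by gcongr; exact le_max_right _ _)
    calc ‖z‖ = ‖∑ i, b.repr z i • b i‖ := by rw [b.sum_repr]
      _ ≤ ∑ i, ‖b.repr z i • b i‖ := norm_sum_le _ _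
      _ ≤ ∑ i, max 1 √(S / Q (b i) (b i)) * ‖b i‖ * ‖P z‖ := by
        refine Finset.sum_le_sum fun i _ ↦ ?_
        rw [norm_smul, Real.norm_eq_abs, mul_right_comm]
        exact mul_le_mul_of_nonneg_right (hle i) (norm_nonneg _)
      _ = C * ‖P z‖ := by rw [← Finset.sum_mul]

/-- Isotropic subspaces of a symplectic vector space are at most half-dimensional. -/
theorem two_mul_finrank_le_of_isotropic (Ω : E →L[ℝ] E →L[ℝ] ℝ) (hΩ : ∀ u v, Ω u v = -Ω v u)
    (hnd : ∀ u, (∀ v, Ω u v = 0) → u = 0) (W : Submodule ℝ E)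
    (hW : ∀ u ∈ W, ∀ v ∈ W, Ω u v = 0) : 2 * finrank ℝ W ≤ finrank ℝ E := by
  let B : LinearMap.BilinForm ℝ E := Ω.toLinearMap₁₂
  have hB : B.Nondegenerate := by
    refine ⟨fun u hu ↦ hnd u hu, fun u hu ↦ hnd u fun v ↦ ?_⟩
    rw [hΩ, neg_eq_zero]
    exact hu v
  have h1 := LinearMap.BilinForm.finrank_orthogonal hB W
  have h2 : W ≤ B.orthogonal W := fun u hu v hv ↦ hW v hv u hu
  have h3 := Submodule.finrank_mono h2
  have h4 := Submodule.finrank_le W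
  omega

end Projection

variable {E : Type*} [NormedAddCommGroup E] [InnerProductSpace ℝ E] [FiniteDimensional ℝ E]

theorem hasDerivAt_exp_smul_apply (B : E →L[ℝ] E) (u : E) (t : ℝ) :
    HasDerivAt (fun s : ℝ ↦ NormedSpace.exp (s • B) u) (B (NormedSpace.exp (t • B) u)) t := by
  have := FiniteDimensional.complete ℝ E
  have h := hasDerivAt_exp_smul_const' (𝕂 := ℝ) B t
  exact ((ContinuousLinearMap.apply ℝ E u).hasFDerivAt.comp_hasDerivAt t h)

theorem exp_neg_smul_apply (B : E →L[ℝ] E) (u : E) (t : ℝ) :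
    NormedSpace.exp (t • B) (NormedSpace.exp ((-t) • B) u) = u := by
  have := FiniteDimensional.complete ℝ E
  let : NormedAlgebra ℚ (E →L[ℝ] E) := .restrictScalars ℚ ℝ _
  have h : NormedSpace.exp (t • B) * NormedSpace.exp ((-t) • B) = 1 := by
    rw [← NormedSpace.exp_add_of_commute ((Commute.refl B).smul_left t |>.smul_right (-t))]
    simp
  exact DFunLike.congr_fun h u

/-- A quadratic form which increases along the orbits of a linear field controls their norm. -/
theorem norm_sq_le_exp_of_lyapunov (B : E →L[ℝ] E) (Q : E →L[ℝ] E →L[ℝ] ℝ)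
    (hQ : ∀ x y, Q x y = Q y x) {c : ℝ} (hc : 0 < c) (hB : ∀ z, c * ‖z‖ ^ 2 ≤ Q z (B z)) {w : E}
    (hw : Q w w ≤ 0) {t : ℝ} (ht : 0 ≤ t) :
    ‖w‖ ^ 2 ≤ (1 + ‖B‖ / c * ‖Q‖) * ‖NormedSpace.exp ((-t) • B) w‖ ^ 2 := by
  set u := NormedSpace.exp ((-t) • B) w with hu
  let z : ℝ → E := fun s ↦ NormedSpace.exp (s • B) u
  have hz : ∀ s, HasDerivAt z (B (z s)) s := hasDerivAt_exp_smul_apply B u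
  -- Subtracting this multiple of `Q` compensates the growth of the squared norm, so the difference
  -- decreases along the orbit from `u` to `w`; at `w` the subtracted term is nonpositive.
  have hL : ∀ s, HasDerivAt (fun s ↦ ⟪z s, z s⟫ - ‖B‖ / c * Q (z s) (z s))
      ((⟪z s, B (z s)⟫ + ⟪B (z s), z s⟫) - ‖B‖ / c * (Q (B (z s)) (z s) + Q (z s) (B (z s)))) s := by
    intro s
    have h1 := (hz s).inner ℝ (hz s)
    have h2 : HasDerivAt (fun s ↦ Q (z s) (z s)) (Q (B (z s)) (z s) + Q (z s) (B (z s))) s :=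
      (Q.hasFDerivAt.comp_hasDerivAt s (hz s)).clm_apply (hz s)
    exact h1.sub (h2.const_mul _)
  have hanti : Antitone (fun s ↦ ⟪z s, z s⟫ - ‖B‖ / c * Q (z s) (z s)) := by
    refine antitone_of_hasDerivAt_nonpos hL fun s ↦ ?_
    have h1 : ⟪z s, B (z s)⟫ ≤ ‖B‖ * ‖z s‖ ^ 2 := by
      refine (real_inner_le_norm _ _).trans ?_
      have := B.le_opNorm (z s)
      nlinarith [norm_nonneg (z s)]
    have h2 : ‖B‖ * ‖z s‖ ^ 2 ≤ ‖B‖ / c * Q (z s) (B (z s)) := by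
      have := mul_le_mul_of_nonneg_left (hB (z s)) (show 0 ≤ ‖B‖ / c by positivity)
      have h3 : ‖B‖ / c * (c * ‖z s‖ ^ 2) = ‖B‖ * ‖z s‖ ^ 2 := by field_simp
      linarith
    simp only [Pi.zero_apply]
    rw [hQ (B (z s)), real_inner_comm (z s) (B (z s))]
    linarith
  have h0 := hanti ht
  have hzt : z t = w := exp_neg_smul_apply B w t
  have hz0 : z 0 = u := by simp [z]
  simp only [hzt, hz0, real_inner_self_eq_norm_sq] at h0
  have h1 : |Q u u| ≤ ‖Q‖ * ‖u‖ * ‖u‖ := Q.le_opNorm₂ u u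
  have h2 : -(‖Q‖ * ‖u‖ * ‖u‖) ≤ Q u u := (abs_le.1 h1).1
  have h3 : 0 ≤ ‖B‖ / c := by positivity
  nlinarith [mul_nonneg h3 (neg_nonneg.2 hw), mul_le_mul_of_nonneg_left h2 h3]

/-- Let `A` be an infinitesimal conformally symplectic map. If `z ↦ Q(z, (A - a)z)` is positive
definite with `a < 1/2`, then subspaces on which `Q` is nonpositive are at most
half-dimensional. -/
theorem two_mul_finrank_le_of_lyapunov (Ω : E →L[ℝ] E →L[ℝ] ℝ) (hΩ : ∀ u v, Ω u v = -Ω v u)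
    (hnd : ∀ u, (∀ v, Ω u v = 0) → u = 0) (A : E →L[ℝ] E)
    (hA : ∀ u v, Ω (A u) v + Ω u (A v) = Ω u v) (Q : E →L[ℝ] E →L[ℝ] ℝ)
    (hQ : ∀ x y, Q x y = Q y x) {a c : ℝ} (ha : a < 1 / 2) (hc : 0 < c)
    (hAQ : ∀ z, c * ‖z‖ ^ 2 ≤ Q z (A z) - a * Q z z) (N : Submodule ℝ E)
    (hN : ∀ z ∈ N, Q z z ≤ 0) : 2 * finrank ℝ N ≤ finrank ℝ E := by
  -- Shifting by `a` makes `Q` increase strictly along the linear flow, and `Ω` still expands, now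
  -- at the rate `1 - 2 * a > 0`.
  let B : E →L[ℝ] E := A - a • ContinuousLinearMap.id ℝ E
  have hBap : ∀ z, B z = A z - a • z := fun z ↦ rfl
  have hBQ : ∀ z, c * ‖z‖ ^ 2 ≤ Q z (B z) := by
    intro z
    simpa only [hBap, map_sub, map_smul, smul_eq_mul] using hAQ z
  have hBΩ : ∀ u v, Ω (B u) v + Ω u (B v) = (1 - 2 * a) * Ω u v := by
    intro u v
    simp only [hBap, map_sub, map_smul, sub_apply,
      smul_apply, smul_eq_mul]
    linarith [hA u v]
  have hconf : ∀ u v t, Ω (NormedSpace.exp ((-t) • B) u) (NormedSpace.exp ((-t) • B) v) =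
      Real.exp (-((1 - 2 * a) * t)) * Ω u v := by
    intro u v t
    let f : ℝ → ℝ := fun s ↦ Real.exp (-((1 - 2 * a) * s)) *
      Ω (NormedSpace.exp (s • B) u) (NormedSpace.exp (s • B) v)
    have hf : ∀ s, HasDerivAt f 0 s := by
      intro s
      have h1 : HasDerivAt (fun s ↦ Ω (NormedSpace.exp (s • B) u) (NormedSpace.exp (s • B) v))
          (Ω (B (NormedSpace.exp (s • B) u)) (NormedSpace.exp (s • B) v) +
            Ω (NormedSpace.exp (s • B) u) (B (NormedSpace.exp (s • B) v))) s :=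
        (Ω.hasFDerivAt.comp_hasDerivAt s (hasDerivAt_exp_smul_apply B u s)).clm_apply
          (hasDerivAt_exp_smul_apply B v s)
      have h2 : HasDerivAt (fun s ↦ Real.exp (-((1 - 2 * a) * s)))
          (Real.exp (-((1 - 2 * a) * s)) * -(1 - 2 * a)) s := by
        have := ((hasDerivAt_id s).const_mul (1 - 2 * a)).neg.exp
        simpa using this
      refine (h2.mul h1).congr_deriv ?_
      rw [hBΩ]
      ring
    have hconst := is_const_of_deriv_eq_zero (fun s ↦ (hf s).differentiableAt)
      (fun s ↦ (hf s).deriv) (-t) 0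
    simp only [f, zero_smul, NormedSpace.exp_zero, mul_zero, neg_zero, Real.exp_zero, one_mul,
      one_apply_eq_self] at hconst
    rw [← hconst, ← mul_assoc, ← Real.exp_add]
    ring_nf
    simp
  -- If `N` were too large, every orthonormal frame with as many vectors would fail to be isotropic,
  -- uniformly by compactness of the set of frames.
  by_contra hlt
  rw [not_le] at hlt
  let k := finrank ℝ N
  let Ons : Set (Fin k → E) := {u | Orthonormal ℝ u}
  have hOns : ∀ u ∈ Ons, 0 < ∑ i, ∑ j, |Ω (u i) (u j)| := by
    intro u hu
    refine lt_of_le_of_ne (Finset.sum_nonneg fun _ _ ↦ Finset.sum_nonneg fun _ _ ↦ abs_nonneg _) ?_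
    intro h0
    have hij : ∀ i j, Ω (u i) (u j) = 0 := by
      intro i j
      have h1 := (Finset.sum_eq_zero_iff_of_nonneg (fun _ _ ↦ Finset.sum_nonneg
        fun _ _ ↦ abs_nonneg _)).1 h0.symm i (Finset.mem_univ i)
      have h2 := (Finset.sum_eq_zero_iff_of_nonneg (fun _ _ ↦ abs_nonneg _)).1 h1 j
        (Finset.mem_univ j)
      exact abs_eq_zero.1 h2
    have hW : ∀ x ∈ Submodule.span ℝ (range u), ∀ y ∈ Submodule.span ℝ (range u), Ω x y = 0 := by
      intro x hx y hy
      induction hx, hy using Submodule.span_induction₂ with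
      | mem_mem x y hx hy =>
        obtain ⟨i, rfl⟩ := hx
        obtain ⟨j, rfl⟩ := hy
        exact hij i j
      | zero_left => simp
      | zero_right => simp
      | add_left x y z _ _ _ h1 h2 => simp [h1, h2]
      | add_right x y z _ _ _ h1 h2 => simp [h1, h2]
      | smul_left r x y _ _ h => simp [h]
      | smul_right r x y _ _ h => simp [h]
    have h3 := two_mul_finrank_le_of_isotropic Ω hΩ hnd _ hW
    rw [finrank_span_eq_card (Orthonormal.linearIndependent hu), Fintype.card_fin] at h3
    exact absurd h3 (not_le.2 hlt)
  have hcomp : IsCompact Ons := by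
    have hcl : IsClosed Ons := by
      have : Ons = ⋂ i, ⋂ j, {u : Fin k → E | ⟪u i, u j⟫ = if i = j then (1 : ℝ) else 0} := by
        ext u
        simp only [Ons, mem_iInter]
        exact orthonormal_iff_ite
      rw [this]
      exact isClosed_iInter fun i ↦ isClosed_iInter fun j ↦ isClosed_eq
        (by fun_prop) continuous_const
    refine Metric.isCompact_of_isClosed_isBounded hcl ?_
    refine isBounded_iff_forall_norm_le.2 ⟨1, fun u hu ↦ ?_⟩
    exact (pi_norm_le_iff_of_nonneg zero_le_one).2 fun i ↦ (hu.1 i).le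
  obtain ⟨δ, hδ, hδO⟩ : ∃ δ > 0, ∀ u ∈ Ons, δ ≤ ∑ i, ∑ j, |Ω (u i) (u j)| := by
    rcases Ons.eq_empty_or_nonempty with he | hne
    · exact ⟨1, one_pos, by simp [he]⟩
    · obtain ⟨u, hu, hmin⟩ := hcomp.exists_isMinOn hne
        (f := fun u ↦ ∑ i, ∑ j, |Ω (u i) (u j)|) (by fun_prop)
      exact ⟨_, hOns u hu, fun v hv ↦ hmin hv⟩
  let D : ℝ := 1 + ‖B‖ / c * ‖Q‖
  have hD : 0 ≤ D := by positivity
  -- Frames of the image of `N` under the backward flow violate this: `Ω` shrinks exponentially,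
  -- while the norms of vectors of `N` shrink by at most a factor independent of `t`.
  have key : ∀ t : ℝ, 0 ≤ t → δ ≤ k * (k * (Real.exp (-((1 - 2 * a) * t)) * (‖Ω‖ * D))) := by
    intro t ht
    let L : E →ₗ[ℝ] E := (NormedSpace.exp ((-t) • B) : E →L[ℝ] E)
    have hLinj : Function.Injective L := by
      intro x y hxy
      have h1 := exp_neg_smul_apply B x t
      have h2 := exp_neg_smul_apply B y t
      have h3 : NormedSpace.exp ((-t) • B) x = NormedSpace.exp ((-t) • B) y := hxy
      rw [← h1, ← h2, h3]
    have hfr : finrank ℝ (N.map L) = k := (LinearEquiv.finrank_eq (N.equivMapOfInjective L hLinj)).symm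
    let b := (stdOrthonormalBasis ℝ (N.map L)).reindex (finCongr hfr)
    have hb : Orthonormal ℝ (fun i ↦ (b i : E)) :=
      b.orthonormal.comp_linearIsometry (N.map L).subtypeₗᵢ
    refine (hδO _ hb).trans ?_
    have hij : ∀ i j, |Ω (b i) (b j)| ≤ Real.exp (-((1 - 2 * a) * t)) * (‖Ω‖ * D) := by
      intro i j
      obtain ⟨x, hx, hxi⟩ := (b i).2
      obtain ⟨y, hy, hyj⟩ := (b j).2
      have hx1 : ‖x‖ ^ 2 ≤ D := by
        have := norm_sq_le_exp_of_lyapunov B Q hQ hc hBQ (hN x hx) ht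
        have h1 : NormedSpace.exp ((-t) • B) x = b i := hxi
        rw [h1, show ‖(b i : E)‖ = 1 from hb.1 i] at this
        simpa using this
      have hy1 : ‖y‖ ^ 2 ≤ D := by
        have := norm_sq_le_exp_of_lyapunov B Q hQ hc hBQ (hN y hy) ht
        have h1 : NormedSpace.exp ((-t) • B) y = b j := hyj
        rw [h1, show ‖(b j : E)‖ = 1 from hb.1 j] at this
        simpa using this
      have h2 := hconf x y t
      have h3 : NormedSpace.exp ((-t) • B) x = b i := hxi
      have h4 : NormedSpace.exp ((-t) • B) y = b j := hyj
      rw [h3, h4] at h2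
      rw [h2, abs_mul, abs_of_pos (Real.exp_pos _)]
      have h5 : |Ω x y| ≤ ‖Ω‖ * ‖x‖ * ‖y‖ := Ω.le_opNorm₂ x y
      have h6 : ‖x‖ * ‖y‖ ≤ D := by nlinarith [sq_nonneg (‖x‖ - ‖y‖)]
      have h7 := mul_le_mul_of_nonneg_left h6 (norm_nonneg Ω)
      gcongr
      linarith
    calc ∑ i, ∑ j, |Ω (b i) (b j)| ≤ ∑ _i : Fin k, ∑ _j : Fin k, _ :=
          Finset.sum_le_sum fun i _ ↦ Finset.sum_le_sum fun j _ ↦ hij i j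
      _ = _ := by simp
  have hlim : Filter.Tendsto (fun t : ℝ ↦ k * (k * (Real.exp (-((1 - 2 * a) * t)) * (‖Ω‖ * D))))
      Filter.atTop (𝓝 (k * (k * (0 * (‖Ω‖ * D))))) := by
    refine Filter.Tendsto.const_mul _ (Filter.Tendsto.const_mul _ (Filter.Tendsto.mul_const _ ?_))
    refine Real.tendsto_exp_atBot.comp (Filter.tendsto_neg_atTop_atBot.comp ?_)
    exact Filter.tendsto_id.const_mul_atTop (by linarith)
  have := ge_of_tendsto hlim (Filter.eventually_atTop.2 ⟨0, key⟩)
  simp only [zero_mul, mul_zero] at this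
  linarith

end Lyapunov

/-! ### The gradient-like inequality in chart norms. -/

section Metric

open Filter Bundle
open scoped Topology

variable {E : Type*} [NormedAddCommGroup E] [NormedSpace ℝ E]
  {H : Type*} [TopologicalSpace H] {I : ModelWithCorners ℝ E H}
  {M : Type*} [TopologicalSpace M] [ChartedSpace H M] [IsManifold I ∞ M]

/-- Near `x` the metric is comparable with the model norm, because the tangent trivialization and
its inverse are locally bounded. The first bound serves for `X`, the second for `dφ`. -/
theorem Bundle.ContMDiffRiemannianMetric.eventually_le_chart
    (g : ContMDiffRiemannianMetric I ∞ E (fun x : M ↦ TangentSpace I x)) (x : M) :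
    ∃ C > 0, ∀ᶠ y in 𝓝 x,
      (∀ v : TangentSpace I y, ‖id (α := E) (mfderiv I 𝓘(ℝ, E) (extChartAt I x) y v)‖ ^ 2 ≤
        C * g.inner y v v) ∧
      ∀ w : E, g.inner y
        (mfderivWithin 𝓘(ℝ, E) I (extChartAt I x).symm (range I) (extChartAt I x y) w)
        (mfderivWithin 𝓘(ℝ, E) I (extChartAt I x).symm (range I) (extChartAt I x y) w) ≤
          C * ‖w‖ ^ 2 := by
  let : RiemannianBundle (fun x : M ↦ TangentSpace I x) :=
    ⟨g.toContinuousRiemannianMetric.toRiemannianMetric⟩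
  obtain ⟨C₁, hC₁, h₁⟩ := eventually_norm_trivializationAt_lt E (fun x : M ↦ TangentSpace I x) x
  obtain ⟨C₂, hC₂, h₂⟩ := eventually_norm_symmL_trivializationAt_lt E (fun x : M ↦ TangentSpace I x) x
  have hin : ∀ (y : M) (v : TangentSpace I y), g.inner y v v = ‖v‖ ^ 2 := by
    intro y v
    exact real_inner_self_eq_norm_sq v
  refine ⟨C₁ ^ 2 + C₂ ^ 2, by positivity, ?_⟩
  filter_upwards [h₁, h₂, chart_source_mem_nhds H x] with y hy1 hy2 hy
  constructor
  · intro v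
    have h3 := DFunLike.congr_fun (TangentBundle.continuousLinearMapAt_trivializationAt (I := I) hy) v
    have h4 : ‖(trivializationAt E (TangentSpace I) x).continuousLinearMapAt ℝ y v‖ ≤ C₁ * ‖v‖ :=
      (ContinuousLinearMap.le_opNorm _ _).trans (by gcongr)
    rw [hin]
    have h5 : ‖id (α := E) (mfderiv I 𝓘(ℝ, E) (extChartAt I x) y v)‖ ≤ C₁ * ‖v‖ := h3 ▸ h4
    refine (pow_le_pow_left₀ (norm_nonneg _) h5 2).trans ?_
    nlinarith [sq_nonneg (C₂ * ‖v‖)]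
  · intro w
    have h3 := DFunLike.congr_fun (TangentBundle.symmL_trivializationAt (I := I) hy) w
    have h4 : ‖(trivializationAt E (TangentSpace I) x).symmL ℝ y w‖ ≤ C₂ * ‖w‖ :=
      (ContinuousLinearMap.le_opNorm _ _).trans (by gcongr)
    rw [h3] at h4
    refine (hin y _).trans_le ?_
    refine (pow_le_pow_left₀ (norm_nonneg _) h4 2).trans ?_
    nlinarith [sq_nonneg (C₁ * ‖w‖)]

/-- Scale `v` to unit length. Boundedness of the set of squares has to be checked, as `sSup` of an
unbounded set is `0`. -/
theorem Bundle.ContMDiffRiemannianMetric.sq_le_dualNormSq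
    (g : ContMDiffRiemannianMetric I ∞ E (fun x : M ↦ TangentSpace I x)) (x : M)
    (α : TangentSpace I x →L[ℝ] ℝ) (v : TangentSpace I x) :
    (α v) ^ 2 ≤ dualNormSq (fun v w ↦ g.inner x v w) α * g.inner x v v := by
  let : RiemannianBundle (fun x : M ↦ TangentSpace I x) := ⟨g.toRiemannianMetric⟩
  have hin : ∀ (v : TangentSpace I x), g.inner x v v = ‖v‖ ^ 2 := fun v ↦
    real_inner_self_eq_norm_sq v
  have hbdd : BddAbove {r : ℝ | ∃ v : TangentSpace I x, g.inner x v v ≤ 1 ∧ r = (α v) ^ 2} := by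
    refine ⟨‖α‖ ^ 2, ?_⟩
    rintro _ ⟨v, hv, rfl⟩
    rw [hin] at hv
    have h1 : ‖v‖ ≤ 1 := by
      nlinarith [norm_nonneg v]
    have h2 : |α v| ≤ ‖α‖ := (α.le_opNorm v).trans (by nlinarith [norm_nonneg α])
    rw [← sq_abs]
    gcongr
  rcases eq_or_ne v 0 with rfl | hv
  · simp
  have hv0 : 0 < ‖v‖ := norm_pos_iff.2 hv
  have h1 := le_csSup hbdd ⟨‖v‖⁻¹ • v, by
    rw [hin, norm_smul, norm_inv, norm_norm, inv_mul_cancel₀ hv0.ne', one_pow], rfl⟩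
  change _ ≤ dualNormSq (fun v w ↦ g.inner x v w) α at h1
  rw [map_smul, smul_eq_mul, mul_pow, inv_pow] at h1
  rw [hin]
  have := mul_le_mul_of_nonneg_right h1 (sq_nonneg ‖v‖)
  rwa [mul_right_comm, inv_mul_cancel₀ (by positivity), one_mul] at this

theorem hasFDerivAt_comp_extChartAt_symm {φ : M → ℝ} (hφ : ContMDiff I 𝓘(ℝ, ℝ) ∞ φ) {x₀ : M} {y : E}
    (hy : y ∈ (extChartAt I x₀).target) (hr : range I ∈ 𝓝 y) :
    ∃ ℓ : E →L[ℝ] ℝ, HasFDerivAt (φ ∘ (extChartAt I x₀).symm) ℓ y ∧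
      ∀ w : E, ℓ w = mfderiv I 𝓘(ℝ, ℝ) φ ((extChartAt I x₀).symm y)
        (mfderivWithin 𝓘(ℝ, E) I (extChartAt I x₀).symm (range I) y w) := by
  have h1 := (mdifferentiableWithinAt_extChartAt_symm (I := I) hy).hasMFDerivWithinAt
  have h2 : HasMFDerivAt I 𝓘(ℝ, ℝ) φ ((extChartAt I x₀).symm y) _ :=
    (hφ.mdifferentiableAt (by norm_num)).hasMFDerivAt
  exact ⟨_, (h2.comp_hasMFDerivWithinAt y h1).hasFDerivWithinAt.hasFDerivAt hr, fun w ↦ rfl⟩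

theorem fderiv_comp_extChartAt_symm_apply {φ : M → ℝ} (hφ : ContMDiff I 𝓘(ℝ, ℝ) ∞ φ) {x₀ : M}
    {y : E} (hy : y ∈ (extChartAt I x₀).target) (hr : range I ∈ 𝓝 y) (w : E) :
    fderiv ℝ (φ ∘ (extChartAt I x₀).symm) y w = mfderiv I 𝓘(ℝ, ℝ) φ ((extChartAt I x₀).symm y)
      (mfderivWithin 𝓘(ℝ, E) I (extChartAt I x₀).symm (range I) y w) := by
  obtain ⟨ℓ, h, hℓ⟩ := hasFDerivAt_comp_extChartAt_symm hφ hy hr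
  rw [h.fderiv]
  exact hℓ w

/-- The inequality defining gradient-like fields in a chart around an interior point. -/
theorem IsGradientLike.eventually_chart {X : ∀ x : M, TangentSpace I x} {φ : M → ℝ}
    (hX : IsGradientLike I X φ) (hφ : ContMDiff I 𝓘(ℝ, ℝ) ∞ φ) {p : M}
    (hp : range I ∈ 𝓝 (extChartAt I p p)) :
    ∃ κ > 0, ∀ᶠ y in 𝓝 (extChartAt I p p),
      κ * (‖chartField X p y‖ ^ 2 + ‖fderiv ℝ (φ ∘ (extChartAt I p).symm) y‖ ^ 2) ≤
        fderiv ℝ (φ ∘ (extChartAt I p).symm) y (chartField X p y) := by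
  obtain ⟨g, δ, hδ, hg⟩ := hX
  obtain ⟨C, hC, hev⟩ := g.eventually_le_chart p
  have htar : (extChartAt I p).target ∈ 𝓝 (extChartAt I p p) := by
    have := extChartAt_target_mem_nhdsWithin (I := I) p
    rwa [nhdsWithin_eq_nhds.2 hp] at this
  have hcont : Tendsto (extChartAt I p).symm (𝓝 (extChartAt I p p)) (𝓝 p) := by
    have := (continuousAt_extChartAt_symm (I := I) p).tendsto
    rwa [extChartAt_to_inv] at this
  refine ⟨δ / C, by positivity, ?_⟩
  filter_upwards [htar, hcont.eventually hev, eventually_mem_nhds_iff.2 hp] with y hy ⟨h1, h2⟩ hr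
  have hder := fderiv_comp_extChartAt_symm_apply hφ hy hr
  rw [(extChartAt I p).right_inv hy] at h2
  have hval : fderiv ℝ (φ ∘ (extChartAt I p).symm) y (chartField X p y) =
      mfderiv I 𝓘(ℝ, ℝ) φ ((extChartAt I p).symm y) (X ((extChartAt I p).symm y)) :=
    (hder _).trans (congrArg (mfderiv I 𝓘(ℝ, ℝ) φ ((extChartAt I p).symm y))
      (mfderivWithin_symm_chartField (v := X) hy))
  generalize fderiv ℝ (φ ∘ (extChartAt I p).symm) y = ℓ at hder hval ⊢
  have hF : ‖chartField X p y‖ ^ 2 ≤ C * g.inner ((extChartAt I p).symm y)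
    (X ((extChartAt I p).symm y)) (X ((extChartAt I p).symm y)) := h1 (X ((extChartAt I p).symm y))
  have hgx := hg ((extChartAt I p).symm y)
  have hsq := g.sq_le_dualNormSq ((extChartAt I p).symm y)
    (mfderiv I 𝓘(ℝ, ℝ) φ ((extChartAt I p).symm y))
  have hdual0 : 0 ≤ dualNormSq (fun v w ↦ g.inner ((extChartAt I p).symm y) v w)
      (mfderiv I 𝓘(ℝ, ℝ) φ ((extChartAt I p).symm y)) := by
    refine Real.sSup_nonneg ?_
    rintro _ ⟨v, -, rfl⟩
    positivity
  generalize dualNormSq (fun v w ↦ g.inner ((extChartAt I p).symm y) v w)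
      (mfderiv I 𝓘(ℝ, ℝ) φ ((extChartAt I p).symm y)) = D at hgx hsq hdual0
  have hD : ‖ℓ‖ ^ 2 ≤ C * D := by
    have h3 : ‖ℓ‖ ≤ √(C * D) := by
      refine ContinuousLinearMap.opNorm_le_bound _ (Real.sqrt_nonneg _) fun w ↦ ?_
      refine abs_le_of_sq_le_sq ?_ (by positivity)
      rw [mul_pow, Real.sq_sqrt (by positivity), hder w]
      refine (hsq _).trans ?_
      rw [mul_comm C, mul_assoc]
      exact mul_le_mul_of_nonneg_left (h2 w) hdual0
    refine (pow_le_pow_left₀ (norm_nonneg _) h3 2).trans ?_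
    rw [Real.sq_sqrt (by positivity)]
  refine le_trans ?_ (hgx.trans hval.ge)
  rw [div_mul_eq_mul_div, div_le_iff₀ hC, mul_assoc]
  refine mul_le_mul_of_nonneg_left ?_ hδ.le
  linarith

end Metric

/-! ### Lyapunov forms at a zero of a gradient-like field. -/

section LyapunovForm

open Filter
open scoped Topology NNReal

variable {E : Type*} [NormedAddCommGroup E] [NormedSpace ℝ E]

/-- The linearization of the inequality `df(F) ≥ κ (|F|² + |df|²)` at a common zero of `F`, `df`. -/
theorem le_of_eventually_le_of_hasFDerivAt {f' : E → E →L[ℝ] ℝ} {F : E → E} {y₀ : E}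
    {D : E →L[ℝ] E →L[ℝ] ℝ} {A : E →L[ℝ] E} {κ : ℝ} (hf : HasFDerivAt f' D y₀)
    (hF : HasFDerivAt F A y₀) (hf0 : f' y₀ = 0) (hF0 : F y₀ = 0)
    (h : ∀ᶠ y in 𝓝 y₀, κ * (‖F y‖ ^ 2 + ‖f' y‖ ^ 2) ≤ f' y (F y)) (v : E) :
    κ * (‖A v‖ ^ 2 + ‖D v‖ ^ 2) ≤ D v (A v) := by
  -- Both sides are quadratic to leading order along this line: divide by `t ^ 2` and let `t` tend
  -- to zero.
  have hline : HasDerivAt (fun t : ℝ ↦ y₀ + t • v) v 0 := by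
    simpa using ((hasDerivAt_id (0 : ℝ)).smul_const v).const_add y₀
  have hy : y₀ + (0 : ℝ) • v = y₀ := by simp
  have h1 := (hy.symm ▸ hf : HasFDerivAt f' D (y₀ + (0 : ℝ) • v)).comp_hasDerivAt (0 : ℝ) hline
  have h2 := (hy.symm ▸ hF : HasFDerivAt F A (y₀ + (0 : ℝ) • v)).comp_hasDerivAt (0 : ℝ) hline
  rw [hasDerivAt_iff_tendsto_slope_zero] at h1 h2
  simp only [Function.comp_apply, zero_add, zero_smul, add_zero, hf0, hF0, sub_zero] at h1 h2
  have hl := ((h2.norm.pow 2).add (h1.norm.pow 2)).const_mul κ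
  have hr := ((isBoundedBilinearMap_apply (𝕜 := ℝ) (E := E) (F := ℝ)).continuous.tendsto
    (D v, A v)).comp (h1.prodMk_nhds h2)
  refine le_of_tendsto_of_tendsto hl hr ?_
  have h3 : Tendsto (fun t : ℝ ↦ y₀ + t • v) (𝓝[≠] 0) (𝓝 y₀) := by
    have := hline.continuousAt.tendsto.mono_left (nhdsWithin_le_nhds (s := {(0 : ℝ)}ᶜ))
    rwa [hy] at this
  filter_upwards [h3.eventually h] with t ht
  simp only [Function.comp_apply, norm_smul, map_smul, smul_apply, smul_eq_mul]
  have := mul_le_mul_of_nonneg_left ht (sq_nonneg t⁻¹)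
  rw [Real.norm_eq_abs, mul_pow, mul_pow, sq_abs]
  nlinarith

/-- A Lyapunov form for the linearization of a gradient-like field at a zero where the Hessian has
a kernel of dimension at most one. -/
theorem exists_lyapunov_form [FiniteDimensional ℝ E] {D : E →L[ℝ] E →L[ℝ] ℝ} {A : E →L[ℝ] E}
    (hD : ∀ v w, D v w = D w v) {κ : ℝ} (hκ : 0 < κ)
    (h : ∀ v, κ * (‖A v‖ ^ 2 + ‖D v‖ ^ 2) ≤ D v (A v))
    (hker : (∀ v, D v = 0 → v = 0) ∨ ∃ u, u ≠ 0 ∧ ∀ v, D v = 0 ↔ ∃ t : ℝ, v = t • u) :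
    ∃ (Q : E →L[ℝ] E →L[ℝ] ℝ) (a c : ℝ), (∀ v w, Q v w = Q w v) ∧ 0 ≤ a ∧ a < 1 / 2 ∧ 0 < c ∧
      ∀ z, c * ‖z‖ ^ 2 ≤ Q z (A z) - a * Q z z := by
  rcases hker with hker | ⟨u, hu, hker⟩
  · obtain ⟨K, hK, hKD⟩ := D.toLinearMap.exists_antilipschitzWith (LinearMap.ker_eq_bot'.2 hker)
    refine ⟨D, 0, κ / K ^ 2, hD, le_rfl, by norm_num, by positivity, fun z ↦ ?_⟩
    have h1 : ‖z‖ ≤ K * ‖D z‖ := ZeroHomClass.bound_of_antilipschitz D hKD z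
    have h2 : ‖z‖ ^ 2 ≤ K ^ 2 * ‖D z‖ ^ 2 := by
      rw [← mul_pow]
      gcongr
    rw [zero_mul, sub_zero, div_mul_eq_mul_div]
    refine le_trans ?_ (h z)
    rw [div_le_iff₀ (by positivity)]
    nlinarith [sq_nonneg ‖A z‖, mul_nonneg hκ.le (mul_nonneg (sq_nonneg (K : ℝ)) (sq_nonneg ‖A z‖))]
  -- In the degenerate case `A u = 0`, so the unshifted expression cannot be positive at `u`.
  -- Subtracting `η • ℓ ⊗ ℓ` from `D` makes the form equal to `-η` at `u`, which the shift by `a`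
  -- turns into the gain `a * η`.
  · obtain ⟨ℓ, hℓ⟩ := SeparatingDual.exists_eq_one (R := ℝ) hu
    have hDu : D u = 0 := (hker u).2 ⟨1, by simp⟩
    obtain ⟨K, hK, hKD⟩ := (D.prod ℓ).toLinearMap.exists_antilipschitzWith
      (LinearMap.ker_eq_bot'.2 fun z hz ↦ by
        have hz' : (D z, ℓ z) = 0 := hz
        obtain ⟨t, rfl⟩ := (hker z).1 (congrArg Prod.fst hz')
        have := congrArg Prod.snd hz'
        simp only [map_smul, hℓ, smul_eq_mul, mul_one, Prod.snd_zero] at this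
        rw [this, zero_smul])
    have hbound : ∀ z, ‖z‖ ≤ K * max ‖D z‖ |ℓ z| := fun z ↦
      ZeroHomClass.bound_of_antilipschitz (D.prod ℓ) hKD z
    have hK0 : (0 : ℝ) < K := hK
    have hDzz : ∀ z, |D z z| ≤ K * ‖D z‖ ^ 2 := by
      intro z
      have h1 : D (z - ℓ z • u) = D z := by simp [hDu]
      have h2 : ‖z - ℓ z • u‖ ≤ K * ‖D z‖ := by
        have := hbound (z - ℓ z • u)
        rw [h1, map_sub, map_smul, hℓ, smul_eq_mul, mul_one, sub_self, abs_zero,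
          max_eq_left (norm_nonneg _)] at this
        exact this
      have h3 : D z z = D z (z - ℓ z • u) := by
        rw [map_sub, map_smul, hD z u, hDu]
        simp
      rw [h3]
      refine ((D z).le_opNorm _).trans ?_
      nlinarith [norm_nonneg (D z)]
    -- The bound `a * K ≤ κ / 2` lets half of `κ * ‖D z‖ ^ 2` absorb `a * D z z`.
    let a : ℝ := min (1 / 4) (κ / (2 * K))
    have ha : 0 < a := by positivity
    have haK : a * K ≤ κ / 2 := by
      have : a ≤ κ / (2 * K) := min_le_right _ _
      rw [le_div_iff₀ (by positivity)] at this
      linarith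
    -- This `η` is small enough for the cross term `η * ℓ z * ℓ (A z)` to be absorbed by `κ * ‖A z‖
    -- ^ 2` and half of the gain `a * η * ℓ z ^ 2`.
    let η : ℝ := 2 * κ * a / (‖ℓ‖ ^ 2 + 1)
    have hη : 0 < η := by positivity
    have hηℓ : η * ‖ℓ‖ ^ 2 ≤ 2 * κ * a := by
      rw [div_mul_eq_mul_div, div_le_iff₀ (by positivity)]
      have : 0 < 2 * κ * a := by positivity
      nlinarith
    refine ⟨D - η • ℓ.smulRight ℓ, a, min (κ / 2) (a * η / 2) / K ^ 2, fun v w ↦ ?_, ha.le,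
      lt_of_le_of_lt (min_le_left _ _) (by norm_num), by positivity, fun z ↦ ?_⟩
    · simp [hD v w, mul_comm (ℓ v)]
    · have hQ : ∀ w, (D - η • ℓ.smulRight ℓ) z w = D z w - η * (ℓ z * ℓ w) := fun w ↦ rfl
      rw [hQ, hQ]
      have h1 := h z
      have h2 := (abs_le.1 (hDzz z)).2
      have h3 : |ℓ (A z)| ≤ ‖ℓ‖ * ‖A z‖ := ℓ.le_opNorm _
      have h4 : η * (ℓ z * ℓ (A z)) ≤ κ * ‖A z‖ ^ 2 + a * η / 2 * ℓ z ^ 2 := by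
        have h5 : ℓ z * ℓ (A z) ≤ |ℓ z| * (‖ℓ‖ * ‖A z‖) := by
          refine (le_abs_self _).trans ?_
          rw [abs_mul]
          gcongr
        have h6 := mul_le_mul_of_nonneg_left h5 hη.le
        have h7 : κ * (η * (|ℓ z| * (‖ℓ‖ * ‖A z‖))) ≤
            κ * (κ * ‖A z‖ ^ 2 + a * η / 2 * ℓ z ^ 2) := by
          have h8 : η * (η * ‖ℓ‖ ^ 2) ≤ η * (2 * κ * a) := mul_le_mul_of_nonneg_left hηℓ hη.le
          have h9 := mul_le_mul_of_nonneg_right h8 (sq_nonneg |ℓ z|)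
          rw [← sq_abs (ℓ z)]
          linarith [sq_nonneg (κ * ‖A z‖ - η * ‖ℓ‖ * |ℓ z| / 2)]
        exact h6.trans (le_of_mul_le_mul_left h7 hκ)
      have h5 : min (κ / 2) (a * η / 2) * max ‖D z‖ |ℓ z| ^ 2 ≤
          κ / 2 * ‖D z‖ ^ 2 + a * η / 2 * ℓ z ^ 2 := by
        rcases max_choice ‖D z‖ |ℓ z| with hm | hm
        · rw [hm]
          have := mul_le_mul_of_nonneg_right (min_le_left (κ / 2) (a * η / 2)) (sq_nonneg ‖D z‖)
          have : 0 ≤ a * η / 2 * ℓ z ^ 2 := by positivity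
          linarith
        · rw [hm, sq_abs]
          have := mul_le_mul_of_nonneg_right (min_le_right (κ / 2) (a * η / 2)) (sq_nonneg (ℓ z))
          have : 0 ≤ κ / 2 * ‖D z‖ ^ 2 := by positivity
          linarith
      have h6 : min (κ / 2) (a * η / 2) / K ^ 2 * ‖z‖ ^ 2 ≤
          min (κ / 2) (a * η / 2) * max ‖D z‖ |ℓ z| ^ 2 := by
        rw [div_mul_eq_mul_div, div_le_iff₀ (by positivity), mul_assoc]
        refine mul_le_mul_of_nonneg_left ?_ (by positivity)
        rw [← mul_pow, mul_comm _ (K : ℝ)]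
        exact pow_le_pow_left₀ (norm_nonneg _) (hbound z) 2
      have h7 : a * D z z ≤ κ / 2 * ‖D z‖ ^ 2 := by
        calc a * D z z ≤ a * (K * ‖D z‖ ^ 2) := by gcongr
          _ = a * K * ‖D z‖ ^ 2 := by ring
          _ ≤ _ := by gcongr
      nlinarith

/-- Differences of orbits which stay near a zero of a field lie in the cone where a Lyapunov form
is nonpositive. -/
theorem HasStrictFDerivAt.exists_lyapunov_nonpos {F : E → E} {y₀ : E} {A : E →L[ℝ] E}
    (hF : HasStrictFDerivAt F A y₀) {Q : E →L[ℝ] E →L[ℝ] ℝ} (hQ : ∀ v w, Q v w = Q w v) {a c : ℝ}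
    (ha : 0 ≤ a) (hc : 0 < c) (hAQ : ∀ z, c * ‖z‖ ^ 2 ≤ Q z (A z) - a * Q z z) :
    ∃ ρ > 0, ∀ x y : ℝ → E,
      (∀ t, 0 ≤ t → x t ∈ Metric.ball y₀ ρ ∧ HasDerivWithinAt x (F (x t)) (Ici 0) t) →
      (∀ t, 0 ≤ t → y t ∈ Metric.ball y₀ ρ ∧ HasDerivWithinAt y (F (y t)) (Ici 0) t) →
      Q (x 0 - y 0) (x 0 - y 0) ≤ 0 := by
  let M : ℝ := ‖Q‖ + 1
  have hM : 0 < M := by positivity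
  -- With this precision the nonlinear error costs at most `c * ‖z‖ ^ 2` in the derivative of `q`,
  -- half of the gain `2 * c * ‖z‖ ^ 2`.
  obtain ⟨s, hs, hlin⟩ := hF.approximates_deriv_on_nhds (c := ⟨c / (2 * M), by positivity⟩)
    (Or.inr (NNReal.coe_pos.1 (show (0 : ℝ) < c / (2 * M) by positivity)))
  obtain ⟨ρ, hρ, hρs⟩ := Metric.mem_nhds_iff.1 hs
  refine ⟨ρ, hρ, fun x y hx hy ↦ ?_⟩
  -- If `q` starts positive it never falls below `q 0`. Then `‖z‖ ^ 2` is bounded below, so `q`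
  -- grows at least linearly, although it is bounded on the ball.
  by_contra! hpos
  let z : ℝ → E := fun t ↦ x t - y t
  let q : ℝ → ℝ := fun t ↦ Q (z t) (z t)
  let q' : ℝ → ℝ := fun t ↦ 2 * Q (z t) (F (x t) - F (y t))
  have hq : ∀ t ∈ Ici (0 : ℝ), HasDerivWithinAt q (q' t) (Ici 0) t := by
    intro t ht
    have hz : HasDerivWithinAt z (F (x t) - F (y t)) (Ici 0) t := (hx t ht).2.sub (hy t ht).2
    refine ((Q.hasFDerivAt.comp_hasDerivWithinAt t hz).clm_apply hz).congr_deriv ?_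
    simp only [q', Function.comp_apply]
    rw [hQ (F (x t) - F (y t))]
    ring
  have hq' : ∀ t ∈ Ici (0 : ℝ), 2 * a * q t + c * ‖z t‖ ^ 2 ≤ q' t := by
    intro t ht
    have h1 : ‖F (x t) - F (y t) - A (z t)‖ ≤ c / (2 * M) * ‖z t‖ :=
      hlin _ (hρs (hx t ht).1) _ (hρs (hy t ht).1)
    have h2 : q' t = 2 * Q (z t) (A (z t)) + 2 * Q (z t) (F (x t) - F (y t) - A (z t)) := by
      simp only [q', map_sub]
      ring
    have h3 : |Q (z t) (F (x t) - F (y t) - A (z t))| ≤ ‖Q‖ * ‖z t‖ * (c / (2 * M) * ‖z t‖) :=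
      (Q.le_opNorm₂ _ _).trans (by gcongr)
    have h4 : ‖Q‖ * ‖z t‖ * (c / (2 * M) * ‖z t‖) ≤ c / 2 * ‖z t‖ ^ 2 := by
      have : ‖Q‖ * (c / (2 * M)) ≤ c / 2 := by
        rw [mul_div_assoc', div_le_div_iff₀ (by positivity) two_pos]
        have : ‖Q‖ ≤ M := by simp [M]
        nlinarith
      have := mul_le_mul_of_nonneg_right this (sq_nonneg ‖z t‖)
      linarith
    have h5 := (abs_le.1 h3).1
    have h6 := hAQ (z t)
    simp only [q]
    linarith
  have hqc : ContinuousOn q (Ici 0) := HasDerivWithinAt.continuousOn hq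
  have hexp : ∀ t : ℝ, HasDerivAt (fun t ↦ Real.exp (-(2 * a * t)))
      (Real.exp (-(2 * a * t)) * -(2 * a)) t := by
    intro t
    have := ((hasDerivAt_id t).const_mul (2 * a)).neg.exp
    simpa using this
  have hq0 : ∀ t ∈ Ici (0 : ℝ), q 0 ≤ q t := by
    have hmono : MonotoneOn (fun t ↦ Real.exp (-(2 * a * t)) * q t) (Ici 0) := by
      refine monotoneOn_of_hasDerivWithinAt_nonneg (convex_Ici 0)
        ((by fun_prop : Continuous fun t : ℝ ↦ Real.exp (-(2 * a * t))).continuousOn.mul hqc)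
        (fun t ht ↦ ((hexp t).hasDerivWithinAt.mul ((hq t (interior_subset ht)).mono
          interior_subset))) (fun t ht ↦ ?_)
      have h1 := hq' t (interior_subset ht)
      have h2 : 0 ≤ q' t - 2 * a * q t := by
        have : 0 ≤ c * ‖z t‖ ^ 2 := by positivity
        linarith
      have h3 := mul_nonneg (Real.exp_pos (-(2 * a * t))).le h2
      linarith
    intro t ht
    have h1 := hmono self_mem_Ici ht ht
    simp only [mul_zero, neg_zero, Real.exp_zero, one_mul] at h1
    have h2 : Real.exp (-(2 * a * t)) ≤ 1 := by
      rw [Real.exp_le_one_iff]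
      have : 0 ≤ a * t := mul_nonneg ha ht
      linarith
    have h3 : 0 < q t := by
      by_contra! hle
      have := mul_nonpos_of_nonneg_of_nonpos (Real.exp_pos (-(2 * a * t))).le hle
      exact absurd (hpos.trans_le (h1.trans this)) (lt_irrefl _)
    nlinarith
  have hqz : ∀ t, q t ≤ M * ‖z t‖ ^ 2 := by
    intro t
    have h1 : |q t| ≤ ‖Q‖ * ‖z t‖ * ‖z t‖ := Q.le_opNorm₂ _ _
    have h2 := (abs_le.1 h1).2
    simp only [M]
    nlinarith [sq_nonneg ‖z t‖]
  have hgrow : ∀ t ∈ Ici (0 : ℝ), q 0 + c / M * q 0 * t ≤ q t := by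
    have hmono : MonotoneOn (fun t ↦ q t - c / M * q 0 * t) (Ici 0) := by
      refine monotoneOn_of_hasDerivWithinAt_nonneg (f' := fun t ↦ q' t - c / M * q 0 * 1)
        (convex_Ici 0)
        (hqc.sub (by fun_prop))
        (fun t ht ↦ ((hq t (interior_subset ht)).mono interior_subset).sub
          ((hasDerivWithinAt_id t _).const_mul _)) (fun t ht ↦ ?_)
      have ht' := interior_subset ht
      have h1 := hq' t ht'
      have h2 := hq0 t ht'
      have h3 : 0 < q 0 := hpos
      have h4 : c / M * q 0 ≤ c * ‖z t‖ ^ 2 := by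
        rw [div_mul_eq_mul_div, div_le_iff₀ hM, mul_assoc]
        refine mul_le_mul_of_nonneg_left ?_ hc.le
        linarith [hqz t]
      have h5 : 0 ≤ 2 * a * q t := mul_nonneg (by positivity) (h3.le.trans h2)
      linarith
    intro t ht
    have := hmono self_mem_Ici ht ht
    simp only [mul_zero, sub_zero] at this
    linarith
  have hbdd : ∀ t ∈ Ici (0 : ℝ), q t ≤ M * (2 * ρ) ^ 2 := by
    intro t ht
    refine (hqz t).trans ?_
    have : ‖z t‖ ≤ 2 * ρ := by
      have h1 := Metric.mem_ball.1 (hx t ht).1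
      have h2 := Metric.mem_ball.1 (hy t ht).1
      have h3 := dist_triangle_right (x t) (y t) y₀
      rw [dist_eq_norm] at h3
      linarith
    gcongr
  have h0 : 0 < q 0 := hpos
  have hT : 0 ≤ M * (2 * ρ) ^ 2 / (c / M * q 0) := by positivity
  have h1 := hgrow _ hT
  have h2 := hbdd _ hT
  rw [mul_div_cancel₀ _ (by positivity)] at h1
  linarith

end LyapunovForm

/-! ### The Liouville equation linearized at a zero of the field. -/

section Linearization
open Filter
open scoped Topology
variable {E : Type*} [NormedAddCommGroup E] [NormedSpace ℝ E]

theorem ContinuousAlternatingMap.exists_bilinear (s : E [⋀^Fin 2]→L[ℝ] ℝ) :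
    ∃ Ω : E →L[ℝ] E →L[ℝ] ℝ, ∀ a b, Ω a b = s ![a, b] := by
  refine ⟨((ContinuousAlternatingMap.ofSubsingletonLIE (𝕜 := ℝ) (E := E) (F := ℝ) (ι := Fin 1)
    (i := 0)).symm.toContinuousLinearEquiv.toContinuousLinearMap).comp
      (ContinuousAlternatingMap.curryLeft s), fun a b ↦ ?_⟩
  refine congrArg s ?_
  ext i
  fin_cases i <;> rfl

/-- The exterior derivative of `ι_F s` at a zero of `F`. -/
theorem extDerivWithin_curryLeft_of_zero {s : E → E [⋀^Fin 2]→L[ℝ] ℝ} {F : E → E} {A : E →L[ℝ] E}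
    {y₀ : E} {R : Set E} (hR : UniqueDiffWithinAt ℝ R y₀) (hs : DifferentiableAt ℝ s y₀)
    (hA : HasFDerivAt F A y₀) (h0 : F y₀ = 0) {G : E → E [⋀^Fin 1]→L[ℝ] ℝ}
    (hG : G =ᶠ[𝓝 y₀] fun y ↦ (s y).curryLeft (F y)) (u v : E) :
    extDerivWithin G R y₀ ![u, v] = s y₀ ![A u, v] - s y₀ ![A v, u] := by
  let c : (E [⋀^Fin 2]→L[ℝ] ℝ) →L[ℝ] E →L[ℝ] E [⋀^Fin 1]→L[ℝ] ℝ :=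
    (ContinuousAlternatingMap.curryLeftLI (𝕜 := ℝ) (E := E) (F := ℝ)
      (n := 1)).toContinuousLinearMap
  have hcs : HasFDerivAt (fun y ↦ c (s y)) (c.comp (fderiv ℝ s y₀)) y₀ :=
    HasFDerivAt.comp (g := c) y₀ (ContinuousLinearMap.hasFDerivAt (𝕜 := ℝ) (E := E [⋀^Fin 2]→L[ℝ] ℝ)
      (F := E →L[ℝ] E [⋀^Fin 1]→L[ℝ] ℝ) c) hs.hasFDerivAt
  -- By the product rule the derivative of `s` only enters paired with `F y₀ = 0`, so only the terms
  -- with `A` survive.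
  have hd' := ((hcs.clm_apply hA).congr_of_eventuallyEq hG).hasFDerivWithinAt (s := R)
  rw [extDerivWithin, ContinuousAlternatingMap.alternatizeUncurryFin_apply, hd'.fderivWithin hR,
    Fin.sum_univ_two]
  have h1 : Fin.removeNth 0 ![u, v] = ![v] := by
    ext i; fin_cases i; rfl
  have h2 : Fin.removeNth 1 ![u, v] = ![u] := by
    ext i; fin_cases i; rfl
  have h3 : ∀ a b, c (s y₀) (A a) ![b] = s y₀ ![A a, b] := fun a b ↦ rfl
  simp only [Fin.val_zero, pow_zero, one_smul, Fin.val_one, pow_one, neg_smul, h1, h2,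
    Matrix.cons_val_zero, Matrix.cons_val_one, h0]
  rw [← h3, ← h3, ← sub_eq_add_neg]
  simp

variable  {H : Type*} [TopologicalSpace H] {I : ModelWithCorners ℝ E H}
  {M : Type*} [TopologicalSpace M] [ChartedSpace H M] [IsManifold I ∞ M]

/-- The linearization of a Liouville field at a zero is infinitesimally conformally symplectic. -/
theorem IsLiouvilleField.exists_linearization {σ : MForm I M 2} {X : ∀ x : M, TangentSpace I x}
    (hσ : σ.IsSymplectic) (hX : IsLiouvilleField σ X) {p : M}
    (hp : range I ∈ 𝓝 (extChartAt I p p)) {A : E →L[ℝ] E}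
    (hA : HasFDerivAt (chartField X p) A (extChartAt I p p))
    (h0 : chartField X p (extChartAt I p p) = 0) :
    ∃ Ω : E →L[ℝ] E →L[ℝ] ℝ, (∀ u v, Ω u v = -Ω v u) ∧ (∀ u, (∀ v, Ω u v = 0) → u = 0) ∧
      ∀ u v, Ω (A u) v + Ω u (A v) = Ω u v := by
  set y₀ := extChartAt I p p with hy₀
  have hmem : y₀ ∈ (extChartAt I p).target := mem_extChartAt_target p
  have htar : (extChartAt I p).target ∈ 𝓝 y₀ := by
    have := extChartAt_target_mem_nhdsWithin (I := I) p
    rwa [nhdsWithin_eq_nhds.2 hp] at this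
  obtain ⟨Ω, hΩ⟩ := (σ.inChart p y₀).exists_bilinear
  have hanti : ∀ u v, Ω u v = -Ω v u := by
    intro u v
    rw [hΩ, hΩ]
    have := (σ.inChart p y₀).map_swap ![v, u] (i := 0) (j := 1) (by decide)
    refine Eq.trans (congrArg (σ.inChart p y₀) ?_) this
    ext i
    fin_cases i <;> rfl
  let T : E →L[ℝ] TangentSpace I p :=
    mfderivWithin 𝓘(ℝ, E) I (extChartAt I p).symm (range I) y₀
  have hT1 : ∀ v, T (mfderiv I 𝓘(ℝ, E) (extChartAt I p) p v) = v := fun v ↦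
    DFunLike.congr_fun (mfderivWithin_extChartAt_symm_comp_mfderiv_extChartAt'
      (mem_extChartAt_source (I := I) p)) v
  have hT2 : ∀ v, mfderiv I 𝓘(ℝ, E) (extChartAt I p) p (T v) = v := fun v ↦
    DFunLike.congr_fun (mfderiv_extChartAt_comp_mfderivWithin_extChartAt_symm'
      (mem_extChartAt_source (I := I) p)) v
  have hσΩ : ∀ a b : E, σ p ![T a, T b] = Ω a b := by
    intro a b
    rw [hΩ]
    have h2 := congrArg (fun z ↦ id (α := E [⋀^Fin 2]→L[ℝ] ℝ) (σ z) ![T a, T b])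
      (extChartAt_to_inv (I := I) p)
    refine h2.symm.trans (congrArg (id (α := E [⋀^Fin 2]→L[ℝ] ℝ) (σ ((extChartAt I p).symm y₀))) ?_)
    ext i
    fin_cases i <;> rfl
  refine ⟨Ω, hanti, fun u hu ↦ ?_, fun u v ↦ ?_⟩
  · have h1 : T u = 0 := by
      refine hσ.nondegenerate p (T u) fun w ↦ ?_
      have := hσΩ u (mfderiv I 𝓘(ℝ, E) (extChartAt I p) p w)
      rw [hT1] at this
      exact this.trans (hu _)
    have h2 := hT2 u
    rw [h1, map_zero] at h2
    exact h2.symm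
  have hs : DifferentiableAt ℝ (σ.inChart p) y₀ :=
    ((hσ.smooth p y₀ hmem).contDiffAt htar).differentiableAt (by norm_num)
  -- Contraction commutes with passage to the chart, so the Liouville equation can be differentiated
  -- in coordinates.
  have hG : (MForm.interiorProduct X σ).inChart p =ᶠ[𝓝 y₀]
      fun y ↦ (σ.inChart p y).curryLeft (chartField X p y) := by
    filter_upwards [htar] with y hy
    ext w
    change id (α := E [⋀^Fin 2]→L[ℝ] ℝ) (σ ((extChartAt I p).symm y)) _ =
      id (α := E [⋀^Fin 2]→L[ℝ] ℝ) (σ ((extChartAt I p).symm y)) _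
    congr 1
    ext i
    refine Fin.cases ?_ (fun j ↦ ?_) i
    · exact (mfderivWithin_symm_chartField (v := X) hy).symm
    · rfl
  have h1 := congrArg (fun s : E [⋀^Fin 2]→L[ℝ] ℝ ↦ s ![T u, T v]) (hX.d_interiorProduct p)
  have h2 : extDerivWithin ((MForm.interiorProduct X σ).inChart p) (range I) y₀ ![u, v] =
      Ω u v := by
    refine Eq.trans ?_ (h1.trans (hσΩ u v))
    refine congrArg (extDerivWithin ((MForm.interiorProduct X σ).inChart p) (range I) y₀) ?_
    ext i
    fin_cases i
    · exact (hT2 u).symm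
    · exact (hT2 v).symm
  have h3 := extDerivWithin_curryLeft_of_zero (s := σ.inChart p) (y₀ := y₀)
    (I.uniqueDiffOn _ (mem_range_self _)) hs hA h0 hG u v
  rw [h2, ← hΩ, ← hΩ] at h3
  rw [h3, hanti (A v) u]
  ring
end Linearization

/-! ### Second-order obstruction to accumulating zeros. -/

section IsolatedZero

open Filter
open scoped Topology

variable {E : Type*} [NormedAddCommGroup E] [NormedSpace ℝ E]

theorem Filter.Tendsto.continuousLinearMap_apply {α E F : Type*} [NormedAddCommGroup E]
    [NormedSpace ℝ E] [NormedAddCommGroup F] [NormedSpace ℝ F] {l : Filter α} {f : α → E →L[ℝ] F}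
    {g : α → E} {A : E →L[ℝ] F} {x : E} (hf : Tendsto f l (𝓝 A)) (hg : Tendsto g l (𝓝 x)) :
    Tendsto (fun a ↦ f a (g a)) l (𝓝 (A x)) :=
  ((isBoundedBilinearMap_apply (𝕜 := ℝ) (E := E) (F := F)).continuous.tendsto (A, x)).comp
    (hf.prodMk_nhds hg)

set_option maxSynthPendingDepth 3 in
/-- Second-order obstruction to a gradient having a nonisolated zero. -/
theorem exists_kernel_of_not_isolated [FiniteDimensional ℝ E] {G : E → E →L[ℝ] ℝ} {y₀ : E}
    (hG : ContDiffAt ℝ 2 G y₀) (h0 : G y₀ = 0)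
    (hsymm : ∀ v w, fderiv ℝ G y₀ v w = fderiv ℝ G y₀ w v)
    (hfreq : ∃ᶠ z in 𝓝[≠] (0 : E), G (y₀ + z) = 0) :
    ∃ z : E, z ≠ 0 ∧ fderiv ℝ G y₀ z = 0 ∧
      ∀ u, fderiv ℝ G y₀ u = 0 → fderiv ℝ (fderiv ℝ G) y₀ z z u = 0 := by
  have := FiniteDimensional.proper ℝ E
  let f := 𝓝[≠] (0 : E) ⊓ 𝓟 {z | G (y₀ + z) = 0}
  have hf : f.NeBot := frequently_mem_iff_neBot.1 hfreq
  -- An ultrafilter of zeros tending to `y₀` makes the normalized directions converge on the compact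
  -- unit sphere; the limit `e` is the required vector.
  let 𝓤 := Ultrafilter.of f
  have h𝓤 : (𝓤 : Filter E) ≤ f := Ultrafilter.of_le f
  have hz0 : ∀ᶠ z in (𝓤 : Filter E), z ≠ 0 :=
    h𝓤.trans inf_le_left self_mem_nhdsWithin
  have hzG : ∀ᶠ z in (𝓤 : Filter E), G (y₀ + z) = 0 :=
    h𝓤.trans inf_le_right (mem_principal_self _)
  have hlim : Tendsto id (𝓤 : Filter E) (𝓝 0) :=
    (h𝓤.trans inf_le_left).trans nhdsWithin_le_nhds
  let N : E → E := fun z ↦ ‖z‖⁻¹ • z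
  obtain ⟨e, he, hNe⟩ := (isCompact_sphere (0 : E) 1).ultrafilter_le_nhds (𝓤.map N) (by
    rw [Ultrafilter.coe_map, le_principal_iff, mem_map]
    filter_upwards [hz0] with z hz
    simp [N, norm_smul, hz])
  have hN : Tendsto N (𝓤 : Filter E) (𝓝 e) := hNe
  have hlimy : Tendsto (fun z ↦ y₀ + z) (𝓤 : Filter E) (𝓝 y₀) := by
    simpa using hlim.const_add y₀
  have hev : ∀ᶠ y in 𝓝 y₀, ContDiffAt ℝ 2 G y := hG.eventually (by simp)
  obtain ⟨r, hr, hball⟩ := Metric.eventually_nhds_iff_ball.1 hev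
  refine ⟨e, ?_, ?_, fun u hu ↦ ?_⟩
  · rintro rfl
    simp at he
  · have h1 : Tendsto (fun z ↦ fderiv ℝ G y₀ (N z)) (𝓤 : Filter E) (𝓝 (fderiv ℝ G y₀ e)) :=
      ((fderiv ℝ G y₀).continuous.tendsto e).comp hN
    have h2 := (hG.differentiableAt (by norm_num)).hasFDerivAt.isLittleO
    have h3 := (h2.comp_tendsto hlimy)
    have h4 : Tendsto (fun z ↦ fderiv ℝ G y₀ (N z)) (𝓤 : Filter E) (𝓝 0) := by
      have h5 := h3.norm_right.tendsto_inv_smul_nhds_zero.neg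
      rw [neg_zero] at h5
      refine h5.congr' ?_
      filter_upwards [hzG] with z hz
      simp [N, hz, h0]
    exact tendsto_nhds_unique h1 h4
  -- Rolle twice along the segment to a zero: `G` paired with `u` vanishes at both ends, and its
  -- first derivative also vanishes at the start by symmetry and `u` being in the kernel. The second
  -- derivative passes to the limit.
  · have hrolle : ∀ z : E, z ≠ 0 → ‖z‖ < r → G (y₀ + z) = 0 →
        ∃ t ∈ Icc (0 : ℝ) 1, fderiv ℝ (fderiv ℝ G) (y₀ + t • z) z z u = 0 := by
      intro z hz hzr hGz
      have hmem : ∀ t ∈ Icc (0 : ℝ) 1, ContDiffAt ℝ 2 G (y₀ + t • z) := by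
        intro t ht
        refine hball _ ?_
        rw [Metric.mem_ball, dist_eq_norm, add_sub_cancel_left, norm_smul, Real.norm_eq_abs,
          abs_of_nonneg ht.1]
        nlinarith [ht.2, norm_nonneg z]
      have hline : ∀ t : ℝ, HasDerivAt (fun t : ℝ ↦ y₀ + t • z) z t := by
        intro t
        simpa using ((hasDerivAt_id t).smul_const z).const_add y₀
      have hd1 : ∀ t ∈ Icc (0 : ℝ) 1, HasDerivAt (fun t : ℝ ↦ G (y₀ + t • z) u)
          (fderiv ℝ G (y₀ + t • z) z u) t := by
        intro t ht
        have h1 := ((hmem t ht).differentiableAt (by norm_num)).hasFDerivAt.comp_hasDerivAt t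
          (hline t)
        exact (ContinuousLinearMap.apply ℝ ℝ u).hasFDerivAt.comp_hasDerivAt t h1
      have hd2 : ∀ t ∈ Icc (0 : ℝ) 1, HasDerivAt (fun t : ℝ ↦ fderiv ℝ G (y₀ + t • z) z u)
          (fderiv ℝ (fderiv ℝ G) (y₀ + t • z) z z u) t := by
        intro t ht
        have h0 : ContDiffAt ℝ 1 (fderiv ℝ G) (y₀ + t • z) :=
          (hmem t ht).fderiv_right (by norm_num)
        have h1 := (h0.differentiableAt (by norm_num)).hasFDerivAt.comp_hasDerivAt t (hline t)
        have h2 := (ContinuousLinearMap.apply ℝ (E →L[ℝ] ℝ) z).hasFDerivAt.comp_hasDerivAt t h1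
        exact (ContinuousLinearMap.apply ℝ ℝ u).hasFDerivAt.comp_hasDerivAt t h2
      obtain ⟨t₁, ht₁, h₁⟩ := exists_hasDerivAt_eq_zero zero_lt_one
        (fun t ht ↦ (hd1 t ht).continuousAt.continuousWithinAt) (by simp [h0, hGz])
        (fun t ht ↦ hd1 t (Ioo_subset_Icc_self ht))
      have hsub : Icc 0 t₁ ⊆ Icc (0 : ℝ) 1 := Icc_subset_Icc_right ht₁.2.le
      obtain ⟨t₂, ht₂, h₂⟩ := exists_hasDerivAt_eq_zero ht₁.1
        (fun t ht ↦ (hd2 t (hsub ht)).continuousAt.continuousWithinAt)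
        (by rw [h₁]; simp [hsymm z u, hu])
        (fun t ht ↦ hd2 t (hsub (Ioo_subset_Icc_self ht)))
      exact ⟨t₂, hsub (Ioo_subset_Icc_self ht₂), h₂⟩
    choose! τ hτ hτ0 using hrolle
    have hrev : ∀ᶠ z in (𝓤 : Filter E), ‖z‖ < r := by
      have := hlim.norm
      rw [norm_zero] at this
      exact this.eventually (gt_mem_nhds hr)
    have hθ : Tendsto (fun z ↦ y₀ + τ z • z) (𝓤 : Filter E) (𝓝 y₀) := by
      have : Tendsto (fun z ↦ τ z • z) (𝓤 : Filter E) (𝓝 0) := by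
        refine squeeze_zero_norm' ?_ (by simpa using hlim.norm)
        filter_upwards [hz0, hzG, hrev] with z h1 h2 h3
        have := hτ z h1 h3 h2
        rw [norm_smul, Real.norm_eq_abs, abs_of_nonneg this.1]
        exact mul_le_of_le_one_left (norm_nonneg z) this.2
      simpa using this.const_add y₀
    have hc2 : ContinuousAt (fderiv ℝ (fderiv ℝ G)) y₀ := by
      have h0 : ContDiffAt ℝ 1 (fderiv ℝ G) y₀ := hG.fderiv_right (by norm_num)
      exact (h0.fderiv_right (m := 0) (by norm_num)).continuousAt
    have h1 := (((hc2.tendsto.comp hθ).continuousLinearMap_apply hN).continuousLinearMap_apply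
      hN).continuousLinearMap_apply (tendsto_const_nhds (x := u))
    refine tendsto_nhds_unique h1 (tendsto_const_nhds.congr' ?_)
    filter_upwards [hz0, hzG, hrev] with z h1 h2 h3
    simp [N, hτ0 z h1 h3 h2]

end IsolatedZero

/-! ### Critical points: isolation and dimension of local stable sets. -/

section CriticalPoints

open Filter
open scoped Topology NNReal

section Chart

variable {E : Type*} [NormedAddCommGroup E] [NormedSpace ℝ E]
  {H : Type*} [TopologicalSpace H] {I : ModelWithCorners ℝ E H}
  {M : Type*} [TopologicalSpace M] [ChartedSpace H M] {φ : M → ℝ} {p : M}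

theorem extChartAt_target_mem_nhds_of_range (hp : range I ∈ 𝓝 (extChartAt I p p)) :
    (extChartAt I p).target ∈ 𝓝 (extChartAt I p p) := by
  have := extChartAt_target_mem_nhdsWithin (I := I) p
  rwa [nhdsWithin_eq_nhds.2 hp] at this

theorem hessianInChart_eq_fderiv (hp : range I ∈ 𝓝 (extChartAt I p p)) (v w : E) :
    hessianInChart I φ p v w =
      fderiv ℝ (fderiv ℝ (φ ∘ (extChartAt I p).symm)) (extChartAt I p p) v w := by
  rw [hessianInChart, iteratedFDerivWithin_congr_set (t := univ) (eventuallyEq_univ.2 hp),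
    iteratedFDerivWithin_univ, iteratedFDeriv_two_apply]
  rfl

theorem thirdDerivInChart_eq_fderiv (hp : range I ∈ 𝓝 (extChartAt I p p)) (v : E) :
    thirdDerivInChart I φ p v =
      fderiv ℝ (fderiv ℝ (fderiv ℝ (φ ∘ (extChartAt I p).symm))) (extChartAt I p p) v v v := by
  rw [thirdDerivInChart, iteratedFDerivWithin_congr_set (t := univ) (eventuallyEq_univ.2 hp),
    iteratedFDerivWithin_univ, iteratedFDeriv_succ_apply_right, iteratedFDeriv_two_apply]
  rfl

/-- The kernel of the Hessian of a generalized Morse function in a chart. -/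
theorem IsGeneralizedMorse.ker_hessian (hφ : IsGeneralizedMorse I φ) (hc : IsCriticalPt I φ p)
    (hp : range I ∈ 𝓝 (extChartAt I p p)) :
    (∀ v, fderiv ℝ (fderiv ℝ (φ ∘ (extChartAt I p).symm)) (extChartAt I p p) v = 0 → v = 0) ∨
      ∃ u, u ≠ 0 ∧ (∀ v, fderiv ℝ (fderiv ℝ (φ ∘ (extChartAt I p).symm)) (extChartAt I p p) v = 0 ↔
        ∃ t : ℝ, v = t • u) ∧
      fderiv ℝ (fderiv ℝ (fderiv ℝ (φ ∘ (extChartAt I p).symm))) (extChartAt I p p) u u u ≠ 0 := by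
  have hiff : ∀ v, fderiv ℝ (fderiv ℝ (φ ∘ (extChartAt I p).symm)) (extChartAt I p p) v = 0 ↔
      ∀ w, hessianInChart I φ p v w = 0 := by
    intro v
    simp only [hessianInChart_eq_fderiv hp]
    exact ContinuousLinearMap.ext_iff
  rcases hφ.2 p hc with h | ⟨-, u, hu, hker, h3⟩
  · exact Or.inl fun v hv ↦ h.2 v ((hiff v).1 hv)
  · rw [thirdDerivInChart_eq_fderiv hp] at h3
    exact Or.inr ⟨u, hu, fun v ↦ (hiff v).trans (hker v), h3⟩

variable [IsManifold I ∞ M]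

theorem contDiffAt_comp_extChartAt_symm (hφ : ContMDiff I 𝓘(ℝ, ℝ) ∞ φ)
    (hp : range I ∈ 𝓝 (extChartAt I p p)) :
    ContDiffAt ℝ ∞ (φ ∘ (extChartAt I p).symm) (extChartAt I p p) :=
  ((hφ.comp_contMDiffOn (contMDiffOn_extChartAt_symm (n := ∞) p)).contDiffOn _
    (mem_extChartAt_target p)).contDiffAt (extChartAt_target_mem_nhds_of_range hp)

theorem IsCriticalPt.fderiv_chart_eq_zero (hφ : ContMDiff I 𝓘(ℝ, ℝ) ∞ φ) {y : E}
    (hy : y ∈ (extChartAt I p).target) (hr : range I ∈ 𝓝 y)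
    (hc : IsCriticalPt I φ ((extChartAt I p).symm y)) :
    fderiv ℝ (φ ∘ (extChartAt I p).symm) y = 0 := by
  ext w
  rw [fderiv_comp_extChartAt_symm_apply hφ hy hr]
  exact DFunLike.congr_fun hc _

theorem isSymm_fderiv_fderiv_chart (hφ : ContMDiff I 𝓘(ℝ, ℝ) ∞ φ)
    (hp : range I ∈ 𝓝 (extChartAt I p p)) (v w : E) :
    fderiv ℝ (fderiv ℝ (φ ∘ (extChartAt I p).symm)) (extChartAt I p p) v w =
      fderiv ℝ (fderiv ℝ (φ ∘ (extChartAt I p).symm)) (extChartAt I p p) w v :=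
  (contDiffAt_comp_extChartAt_symm hφ hp).isSymmSndFDerivAt (by simpa using ENat.LEInfty.out) v w

/-- Critical points of a generalized Morse function are isolated. -/
theorem IsGeneralizedMorse.eventually_eq [FiniteDimensional ℝ E] (hφ : IsGeneralizedMorse I φ)
    (hc : IsCriticalPt I φ p) (hp : range I ∈ 𝓝 (extChartAt I p p)) :
    ∀ᶠ q in 𝓝 p, IsCriticalPt I φ q → q = p := by
  by_contra hnot
  have hfreq : ∃ᶠ q in 𝓝 p, IsCriticalPt I φ q ∧ q ≠ p := by
    rw [not_eventually] at hnot
    exact hnot.mono fun q hq ↦ by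
      push Not at hq
      exact hq
  set f := φ ∘ (extChartAt I p).symm
  set y₀ := extChartAt I p p with hy₀
  have hf : ContDiffAt ℝ ∞ f y₀ := contDiffAt_comp_extChartAt_symm hφ.1 hp
  have hG : ContDiffAt ℝ 2 (fderiv ℝ f) y₀ := hf.fderiv_right (by norm_num; exact ENat.LEInfty.out)
  have hG0 : fderiv ℝ f y₀ = 0 := by
    refine IsCriticalPt.fderiv_chart_eq_zero hφ.1 (mem_extChartAt_target p) hp ?_
    rwa [extChartAt_to_inv]
  have hz : ∃ᶠ z in 𝓝[≠] (0 : E), fderiv ℝ f (y₀ + z) = 0 := by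
    have hcont : Tendsto (fun q ↦ extChartAt I p q - y₀) (𝓝 p) (𝓝 0) := by
      have := (continuousAt_extChartAt (I := I) p).tendsto.sub_const y₀
      rwa [← hy₀, sub_self] at this
    have hrange : ∀ᶠ q in 𝓝 p, range I ∈ 𝓝 (extChartAt I p q) :=
      (continuousAt_extChartAt (I := I) p).tendsto.eventually (eventually_mem_nhds_iff.2 hp)
    have h1 := hfreq.and_eventually (hrange.and (extChartAt_source_mem_nhds (I := I) p))
    rw [frequently_nhdsWithin_iff]
    refine hcont.frequently (h1.mono ?_)
    rintro q ⟨⟨hq, hqp⟩, hqr, hqs⟩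
    have hqs : q ∈ (extChartAt I p).source := hqs
    refine ⟨?_, ?_⟩
    · rw [add_sub_cancel]
      refine IsCriticalPt.fderiv_chart_eq_zero hφ.1 ((extChartAt I p).map_source hqs) hqr ?_
      rwa [(extChartAt I p).left_inv hqs]
    · intro h0
      rw [mem_singleton_iff, sub_eq_zero] at h0
      exact hqp ((extChartAt I p).injOn hqs (mem_extChartAt_source p) h0)
  -- An accumulation of critical points gives a kernel direction of the Hessian. It is absent at a
  -- nondegenerate point; at an embryonic one it is a multiple of `u`, and the third derivative
  -- along `u` would vanish.
  obtain ⟨z, hz0, hDz, hz3⟩ := exists_kernel_of_not_isolated hG hG0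
    (isSymm_fderiv_fderiv_chart hφ.1 hp) hz
  rcases hφ.ker_hessian hc hp with h | ⟨u, hu, hker, h3⟩
  · exact hz0 (h z hDz)
  · obtain ⟨t, rfl⟩ := (hker z).1 hDz
    have ht : t ≠ 0 := fun h ↦ hz0 (by rw [h, zero_smul])
    have h4 := hz3 u ((hker u).2 ⟨1, (one_smul ℝ u).symm⟩)
    rw [map_smul, smul_apply, map_smul, smul_apply, smul_apply, smul_eq_mul, smul_eq_mul] at h4
    simp only [mul_eq_zero, ht, false_or] at h4
    exact h3 h4

end Chart

variable {n : ℕ} [NeZero (2 * n)] {V : Type*} [TopologicalSpace V] [CompactSpace V] [T2Space V]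
  [ChartedSpace (EuclideanHalfSpace (2 * n)) V] [IsManifold (𝓡∂ (2 * n)) ∞ V]

/-- The boundary is regular, so critical points are interior and derivatives within the half-space
are ordinary derivatives there. -/
theorem WeinsteinDomain.range_mem_nhds (W : WeinsteinDomain n V) {p : V}
    (hp : IsCriticalPt (𝓡∂ (2 * n)) W.φ p) :
    range (𝓡∂ (2 * n)) ∈ 𝓝 (extChartAt (𝓡∂ (2 * n)) p p) := by
  have h1 : p ∉ (𝓡∂ (2 * n)).boundary V := fun h ↦ W.boundary_regular p h hp
  rw [← ModelWithCorners.compl_interior, notMem_compl_iff] at h1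
  exact range_mem_nhds_isInteriorPoint h1

/-- Near a critical point, the set of points whose orbits stay near the critical point is at most
half-dimensional. -/
theorem WeinsteinDomain.exists_nhds_coveredByLipschitz (W : WeinsteinDomain n V) {p : V}
    (hp : IsCriticalPt (𝓡∂ (2 * n)) W.φ p) :
    ∃ U ∈ 𝓝 p, CoveredByLipschitzInCharts (𝓡∂ (2 * n)) n
      {x | ∃ γ : ℝ → V, γ 0 = x ∧ IsMIntegralCurveOn γ W.X (Ici 0) ∧ ∀ t, 0 ≤ t → γ t ∈ U} := by
  have hr := W.range_mem_nhds hp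
  have hφ := W.isGeneralizedMorse
  set e := extChartAt (𝓡∂ (2 * n)) p
  set f := W.φ ∘ e.symm with hf_def
  let F := chartField W.X p
  have hF : ContDiffAt ℝ ∞ F (e p) :=
    ((contDiffOn_chartField W.isLiouville.smooth p) _ (mem_extChartAt_target p)).contDiffAt
      (extChartAt_target_mem_nhds_of_range hr)
  have hFs := hF.hasStrictFDerivAt (by norm_num)
  have hf : ContDiffAt ℝ ∞ f (e p) := contDiffAt_comp_extChartAt_symm hφ.1 hr
  have hfd : HasFDerivAt (fderiv ℝ f) (fderiv ℝ (fderiv ℝ f) (e p)) (e p) :=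
    ((hf.fderiv_right (m := 1) (by norm_num; exact ENat.LEInfty.out)).differentiableAt (by norm_num)).hasFDerivAt
  have hf0 : fderiv ℝ f (e p) = 0 := by
    refine IsCriticalPt.fderiv_chart_eq_zero hφ.1 (mem_extChartAt_target p) hr ?_
    rwa [extChartAt_to_inv]
  obtain ⟨κ, hκ, hev⟩ := W.isGradientLike.eventually_chart hφ.1 hr
  -- Where `dφ` vanishes, the gradient-like inequality forces `X` to vanish too.
  have hF0 : F (e p) = 0 := by
    have h1 : κ * (‖F (e p)‖ ^ 2 + ‖fderiv ℝ f (e p)‖ ^ 2) ≤ fderiv ℝ f (e p) (F (e p)) :=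
      hev.self_of_nhds
    rw [hf0, norm_zero, zero_apply] at h1
    have h2 : ‖F (e p)‖ ^ 2 ≤ 0 := by
      have := nonpos_of_mul_nonpos_right h1 hκ
      linarith
    exact norm_eq_zero.1 (pow_eq_zero_iff two_ne_zero |>.1 (le_antisymm h2 (sq_nonneg _)))
  have hlin := le_of_eventually_le_of_hasFDerivAt hfd hFs.hasFDerivAt hf0 hF0 hev
  obtain ⟨Q, a, c, hQ, ha, ha', hc, hAQ⟩ := exists_lyapunov_form
    (isSymm_fderiv_fderiv_chart hφ.1 hr) hκ hlin
    ((hφ.ker_hessian hp hr).imp id fun ⟨u, h1, h2, _⟩ ↦ ⟨u, h1, h2⟩)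
  obtain ⟨Ω, hΩ1, hΩ2, hΩ3⟩ := W.isLiouville.exists_linearization W.isSymplectic hr
    hFs.hasFDerivAt hF0
  obtain ⟨J, _, N, hNJ, hN, P, C, hC, hP⟩ := exists_projection_nonpos Q hQ
  have hdim := two_mul_finrank_le_of_lyapunov Ω hΩ1 hΩ2 _ hΩ3 Q hQ ha' hc hAQ N hN
  rw [finrank_euclideanSpace, Fintype.card_fin, hNJ] at hdim
  have hJ : Module.finrank ℝ (J → ℝ) ≤ n := by
    rw [Module.finrank_fintype_fun_eq_card]
    omega
  obtain ⟨ρ, hρ, hstay⟩ := hFs.exists_lyapunov_nonpos hQ ha hc hAQ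
  refine ⟨e.source ∩ e ⁻¹' Metric.ball (e p) ρ, inter_mem (extChartAt_source_mem_nhds p)
    ((continuousAt_extChartAt p).preimage_mem_nhds (Metric.ball_mem_nhds _ hρ)), ?_⟩
  set S := {x | ∃ γ : ℝ → V, γ 0 = x ∧ IsMIntegralCurveOn γ W.X (Ici 0) ∧
    ∀ t, 0 ≤ t → γ t ∈ e.source ∩ e ⁻¹' Metric.ball (e p) ρ}
  have hS : S ⊆ e.source := by
    rintro _ ⟨γ, rfl, -, h⟩
    exact (h 0 le_rfl).1
  -- Differences of points of `S` lie in the cone `Q ≤ 0`, where `P` is bounded below. So `P` is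
  -- injective on `S` with Lipschitz inverse `g`, and its target has dimension at most `n`.
  have hdist : ∀ y ∈ e '' S, ∀ z ∈ e '' S, ‖y - z‖ ≤ C * ‖P y - P z‖ := by
    have horb : ∀ γ : ℝ → V, IsMIntegralCurveOn γ W.X (Ici 0) →
        (∀ t, 0 ≤ t → γ t ∈ e.source ∩ e ⁻¹' Metric.ball (e p) ρ) → ∀ t, 0 ≤ t →
        e (γ t) ∈ Metric.ball (e p) ρ ∧
          HasDerivWithinAt (fun t ↦ e (γ t)) (F (e (γ t))) (Ici 0) t :=
      fun γ hγ hγU t ht ↦ ⟨(hγU t ht).2, hγ.hasDerivWithinAt_extChartAt ht (hγU t ht).1⟩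
    rintro _ ⟨_, ⟨γ, rfl, hγ, hγU⟩, rfl⟩ _ ⟨_, ⟨γ', rfl, hγ', hγU'⟩, rfl⟩
    rw [← map_sub]
    exact hP _ (hstay _ _ (horb γ hγ hγU) (horb γ' hγ' hγU'))
  refine .of_subset_source hS ?_
  let g : (J → ℝ) → EuclideanSpace ℝ (Fin (2 * n)) := Function.invFunOn P (e '' S)
  have hg : ∀ y ∈ e '' S, g (P y) ∈ e '' S ∧ P (g (P y)) = P y := fun y hy ↦
    ⟨Function.invFunOn_mem ⟨y, hy, rfl⟩, Function.invFunOn_eq ⟨y, hy, rfl⟩⟩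
  have hgl : LipschitzOnWith ⟨C, hC⟩ g (P '' (e '' S)) := by
    refine LipschitzOnWith.of_dist_le_mul ?_
    rintro _ ⟨y, hy, rfl⟩ _ ⟨z, hz, rfl⟩
    have h1 := hdist _ (hg y hy).1 _ (hg z hz).1
    rw [(hg y hy).2, (hg z hz).2] at h1
    rw [dist_eq_norm, dist_eq_norm]
    exact h1
  refine (CoveredByLipschitz.of_lipschitzOnWith hJ hgl).mono ?_
  intro y hy
  refine ⟨P y, ⟨y, hy, rfl⟩, ?_⟩
  have h1 := hdist _ (hg y hy).1 y hy
  rw [(hg y hy).2, sub_self, norm_zero, mul_zero] at h1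
  exact sub_eq_zero.1 (norm_le_zero_iff.1 h1)

end CriticalPoints

/-! ### Backward orbits of gradient-like semiflows -/

section Lyapunov

open Filter
open scoped Topology NNReal

/-- Every neighbourhood of the set of equilibria contains the tail of each complete backward orbit
of a semiflow with a strict Lyapunov function. -/
theorem eventually_mem_of_lyapunov {X : Type*} [TopologicalSpace X] [CompactSpace X]
    {Ψ : ℝ → X → X} {φ : X → ℝ} (hφ : Continuous φ) (hΨ : Continuous (Ψ 1))
    (hle : ∀ t, 0 ≤ t → ∀ x, φ (Ψ t x) ≤ φ x) {O : Set X} (hO : IsOpen O)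
    (hZ : ∀ x, φ (Ψ 1 x) = φ x → x ∈ O) {γ : ℝ → X}
    (hγ : ∀ s t, 0 ≤ s → 0 ≤ t → Ψ s (γ (t + s)) = γ t) : ∀ᶠ t in atTop, γ t ∈ O := by
  have hmono : Monotone fun t ↦ φ (γ (max t 0)) := by
    intro s t hst
    have h1 := hγ (max t 0 - max s 0) (max s 0) (sub_nonneg.2 (max_le_max_right 0 hst))
      (le_max_right _ _)
    rw [add_sub_cancel] at h1
    dsimp only
    rw [← h1]
    exact hle _ (sub_nonneg.2 (max_le_max_right 0 hst)) _
  have hbdd : BddAbove (range fun t ↦ φ (γ (max t 0))) :=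
    (isCompact_range hφ).bddAbove.mono (range_comp_subset_range (fun t ↦ γ (max t 0)) φ)
  obtain ⟨L, hL⟩ : ∃ L, Tendsto (fun t ↦ φ (γ (max t 0))) atTop (𝓝 L) :=
    ⟨_, tendsto_atTop_ciSup hmono hbdd⟩
  have hL0 : Tendsto (φ ∘ γ) atTop (𝓝 L) := by
    refine hL.congr' ?_
    filter_upwards [eventually_ge_atTop 0] with t ht
    rw [max_eq_left ht, Function.comp_apply]
  -- `Ψ 1` shifts the backward orbit by one unit, so `φ` before and after has the same limit; a
  -- cluster point outside `O` would then be an equilibrium.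
  have hL1 : Tendsto ((fun x ↦ φ (Ψ 1 x)) ∘ γ) atTop (𝓝 L) := by
    refine (hL0.comp (tendsto_atTop_add_const_right atTop (-1) tendsto_id)).congr' ?_
    filter_upwards [eventually_ge_atTop 1] with t ht
    have := hγ 1 (t + -1) zero_le_one (by linarith)
    rw [neg_add_cancel_right] at this
    simp only [Function.comp_apply, id, this]
  by_contra hnot
  have hne : (atTop ⊓ 𝓟 {t | γ t ∉ O}).NeBot :=
    frequently_mem_iff_neBot.1 (not_eventually.1 hnot)
  obtain ⟨q, hq, hcl⟩ := (hO.isClosed_compl.isCompact (X := X)).exists_mapClusterPt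
    (f := atTop ⊓ 𝓟 {t | γ t ∉ O}) (u := γ) (by
      rw [le_principal_iff, mem_map]
      exact mem_inf_of_right (mem_principal_self _))
  have key : ∀ f : X → ℝ, Continuous f → Tendsto (f ∘ γ) atTop (𝓝 L) → f q = L := by
    intro f hf hfL
    have h1 := hcl.continuousAt_comp hf.continuousAt
    have h2 : Tendsto (f ∘ γ) (atTop ⊓ 𝓟 {t | γ t ∉ O}) (𝓝 L) := hfL.mono_left inf_le_left
    exact eq_of_nhds_neBot (h1.clusterPt.neBot.mono (inf_le_inf_left _ h2))
  exact hq (hZ q ((key _ (hφ.comp hΨ) hL1).trans (key _ hφ hL0).symm))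

/-- A complete backward orbit of a semiflow with a strict Lyapunov function and finitely many
equilibria eventually stays near one of them. -/
theorem exists_tail_mem_of_lyapunov {X : Type*} [TopologicalSpace X] [CompactSpace X] [T2Space X]
    {Ψ : ℝ → X → X} {φ : X → ℝ} (hφ : Continuous φ) (hΨ : Continuous (Ψ 1))
    (hle : ∀ t, 0 ≤ t → ∀ x, φ (Ψ t x) ≤ φ x) {Z : Set X} (hfin : Z.Finite)
    (hZ : ∀ x, φ (Ψ 1 x) = φ x → x ∈ Z) {γ : ℝ → X}
    (hγ : ∀ s t, 0 ≤ s → 0 ≤ t → Ψ s (γ (t + s)) = γ t) (hcont : ContinuousOn γ (Ici 0))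
    {U : X → Set X} (hU : ∀ p ∈ Z, U p ∈ 𝓝 p) :
    ∃ p ∈ Z, ∃ k : ℕ, ∀ t, (k : ℝ) ≤ t → γ t ∈ U p := by
  obtain ⟨D, hD, hdisj⟩ := hfin.t2_separation
  let O (p : X) : Set X := D p ∩ interior (U p)
  have hO : ∀ p, IsOpen (O p) := fun p ↦ (hD p).2.inter isOpen_interior
  have hev := eventually_mem_of_lyapunov hφ hΨ hle (O := ⋃ p ∈ Z, O p)
    (isOpen_biUnion fun p _ ↦ hO p)
    (fun x hx ↦ mem_biUnion (hZ x hx) ⟨(hD x).1, mem_interior_iff_mem_nhds.2 (hU x (hZ x hx))⟩) hγ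
  obtain ⟨T, hT⟩ := eventually_atTop.1 hev
  obtain ⟨k, hk⟩ := exists_nat_ge T
  obtain ⟨p, hp, hkp⟩ := mem_iUnion₂.1 (hT k hk)
  refine ⟨p, hp, k, fun t ht ↦ ?_⟩
  -- The connected tail cannot pass between the disjoint neighbourhoods of different equilibria.
  have hpre : IsPreconnected (γ '' Ici (k : ℝ)) :=
    isPreconnected_Ici.image _ (hcont.mono (Ici_subset_Ici.2 k.cast_nonneg))
  have hsub : γ '' Ici (k : ℝ) ⊆ O p := by
    refine hpre.subset_left_of_subset_union (v := ⋃ q ∈ Z \ {p}, O q) (hO p)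
      (isOpen_biUnion fun q _ ↦ hO q) ?_ ?_ ⟨γ k, mem_image_of_mem _ self_mem_Ici, hkp⟩
    · rw [disjoint_iUnion₂_right]
      intro q hq
      exact (hdisj hp hq.1 (fun h ↦ hq.2 h.symm)).mono inter_subset_left inter_subset_left
    · rintro _ ⟨s, hs, rfl⟩
      obtain ⟨q, hq, hsq⟩ := mem_iUnion₂.1 (hT s (hk.trans hs))
      by_cases hqp : q = p
      · exact Or.inl (hqp ▸ hsq)
      · exact Or.inr (mem_biUnion (show q ∈ Z \ {p} from ⟨hq, hqp⟩) hsq)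
  exact interior_subset (hsub (mem_image_of_mem _ ht)).2

/-- The points of the core of a semiflow have complete backward orbits. -/
theorem IsInjectiveSemiflow.exists_backward_orbit {X : Type*} [TopologicalSpace X] {Ψ : ℝ → X → X}
    (hΨ : IsInjectiveSemiflow Ψ) {x : X} (hx : x ∈ semiflowCore Ψ) :
    ∃ γ : ℝ → X, γ 0 = x ∧ (∀ t, 0 ≤ t → Ψ t (γ t) = x) ∧
      ∀ s t, 0 ≤ s → 0 ≤ t → Ψ s (γ (t + s)) = γ t := by
  have : Nonempty X := ⟨x⟩
  choose! γ hγ using hx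
  refine ⟨γ, by rw [← hΨ.zero (γ 0), hγ 0 le_rfl], hγ, fun s t hs ht ↦ hΨ.injective t ht ?_⟩
  rw [← hΨ.add t s ht hs, hγ _ (add_nonneg ht hs), hγ t ht]

end Lyapunov

/-! ### Gradient-like fields along integral curves. -/

section GradientLike

open Filter
open scoped Topology NNReal

variable {E : Type*} [NormedAddCommGroup E] [NormedSpace ℝ E]
  {H : Type*} [TopologicalSpace H] {I : ModelWithCorners ℝ E H}
  {M : Type*} [TopologicalSpace M] [ChartedSpace H M]
  {v : ∀ x : M, TangentSpace I x} {φ : M → ℝ}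

/-- The derivative of a function along an integral curve. -/
theorem IsMIntegralCurveOn.hasDerivWithinAt_comp (hφ : ContMDiff I 𝓘(ℝ, ℝ) ∞ φ) {γ : ℝ → M}
    {s : Set ℝ} (hγ : IsMIntegralCurveOn γ v s) {t : ℝ} (ht : t ∈ s) :
    HasDerivWithinAt (fun u ↦ φ (γ u)) (mfderiv I 𝓘(ℝ, ℝ) φ (γ t) (v (γ t))) s t := by
  have h1 : HasMFDerivAt I 𝓘(ℝ, ℝ) φ (γ t) _ := (hφ.mdifferentiableAt (by norm_num)).hasMFDerivAt
  have h2 := (h1.comp_hasMFDerivWithinAt t (hγ t ht)).hasFDerivWithinAt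
  have h3 : HasFDerivWithinAt (F := ℝ) (fun u ↦ φ (γ u)) (ContinuousLinearMap.toSpanSingleton ℝ
      (M₁ := ℝ) (mfderiv I 𝓘(ℝ, ℝ) φ (γ t) (v (γ t)))) s t := by
    refine HasFDerivWithinAt.congr_fderiv h2 ?_
    ext
    exact ContinuousLinearMap.map_smul (mfderiv I 𝓘(ℝ, ℝ) φ (γ t)) (1 : ℝ) (v (γ t))
  refine h3.hasDerivWithinAt.congr_deriv ?_
  exact one_smul ℝ _

/-- Reversing the time of an integral curve. -/
theorem IsMIntegralCurveOn.comp_const_sub {γ : ℝ → M} {s : Set ℝ} (hγ : IsMIntegralCurveOn γ v s)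
    (T : ℝ) : IsMIntegralCurveOn (fun t ↦ γ (T - t)) (-v) {t | T - t ∈ s} := by
  have h1 := (hγ.comp_add T).comp_mul (-1)
  rw [neg_one_smul] at h1
  have h2 : ∀ t : ℝ, t * -1 + T = T - t := fun t ↦ by ring
  simpa only [Function.comp_def, mem_ofPred_eq, h2] using h1

/-- The backward orbits of a semiflow by integral curves of `v` are integral curves of `-v`. -/
theorem isMIntegralCurveOn_backward_orbit {γ : ℝ → M} {Ψ : ℝ → M → M}
    (hΨ : ∀ x, IsMIntegralCurveOn (fun t ↦ Ψ t x) v (Ici 0))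
    (hγ : ∀ s t, 0 ≤ s → 0 ≤ t → Ψ s (γ (t + s)) = γ t) : IsMIntegralCurveOn γ (-v) (Ici 0) := by
  intro t ht
  -- Starting one unit further back exhibits the orbit around `t` as a time-reversed semiflow orbit
  -- on both sides of `t`.
  have h1 := ((hΨ (γ (t + 1))).comp_const_sub (t + 1)).mono (s' := Icc 0 (t + 1))
    fun s hs ↦ sub_nonneg.2 hs.2
  have h2 : EqOn γ (fun s ↦ Ψ (t + 1 - s) (γ (t + 1))) (Icc 0 (t + 1)) := fun s hs ↦ by
    have := hγ (t + 1 - s) s (sub_nonneg.2 hs.2) hs.1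
    rw [add_sub_cancel] at this
    exact this.symm
  have ht' : t ∈ Icc 0 (t + 1) := ⟨ht, (lt_add_one t).le⟩
  have h3 := (h1 t ht').congr_of_eventuallyEq (eventually_mem_nhdsWithin.mono h2) (h2 ht')
  have h4 : Icc 0 (t + 1) ∈ 𝓝[Ici 0] t :=
    inter_mem self_mem_nhdsWithin (mem_nhdsWithin_of_mem_nhds (Iic_mem_nhds (lt_add_one t)))
  rw [← h2 ht'] at h3
  exact h3.mono_of_mem_nhdsWithin h4

variable [IsManifold I ∞ M] {X : ∀ x : M, TangentSpace I x}

theorem IsGradientLike.mfderiv_nonneg (h : IsGradientLike I X φ) (x : M) :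
    0 ≤ id (α := ℝ) (mfderiv I 𝓘(ℝ, ℝ) φ x (X x)) := by
  obtain ⟨g, δ, hδ, hg⟩ := h
  refine le_trans (mul_nonneg hδ.le (add_nonneg ?_ ?_)) (hg x)
  · rcases eq_or_ne (X x) 0 with h0 | h0
    · rw [h0, map_zero]
    · exact (g.pos x _ h0).le
  · refine Real.sSup_nonneg ?_
    rintro _ ⟨w, -, rfl⟩
    exact sq_nonneg _

/-- The gradient-like inequality bounds the dual norm of `dφ` by `dφ(X)`, so one vanishes with the
other. -/
theorem IsGradientLike.isCriticalPt_of_mfderiv_eq_zero (h : IsGradientLike I X φ) {x : M}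
    (hx : id (α := ℝ) (mfderiv I 𝓘(ℝ, ℝ) φ x (X x)) = 0) : IsCriticalPt I φ x := by
  obtain ⟨g, δ, hδ, hg⟩ := h
  have h1 := hg x
  have hX : 0 ≤ g.inner x (X x) (X x) := by
    rcases eq_or_ne (X x) 0 with h0 | h0
    · rw [h0, map_zero]
    · exact (g.pos x _ h0).le
  have h2 : g.inner x (X x) (X x) +
      dualNormSq (fun v w ↦ g.inner x v w) (mfderiv I 𝓘(ℝ, ℝ) φ x) ≤ 0 :=
    nonpos_of_mul_nonpos_right (h1.trans hx.le) hδ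
  have h3 : dualNormSq (fun v w ↦ g.inner x v w) (mfderiv I 𝓘(ℝ, ℝ) φ x) ≤ 0 := by linarith
  rw [IsCriticalPt]
  ext w
  have h4 := g.sq_le_dualNormSq x (mfderiv I 𝓘(ℝ, ℝ) φ x) w
  have hw : 0 ≤ g.inner x w w := by
    rcases eq_or_ne w 0 with h0 | h0
    · rw [h0, map_zero]
    · exact (g.pos x _ h0).le
  exact pow_eq_zero_iff two_ne_zero |>.1
    (le_antisymm (h4.trans (mul_nonpos_of_nonpos_of_nonneg h3 hw)) (sq_nonneg _))

theorem IsGradientLike.eq_zero_of_isCriticalPt (h : IsGradientLike I X φ) {x : M}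
    (hx : IsCriticalPt I φ x) : X x = 0 := by
  obtain ⟨g, δ, hδ, hg⟩ := h
  by_contra h0
  have h1 := hg x
  rw [IsCriticalPt] at hx
  rw [hx] at h1
  have h2 : 0 ≤ dualNormSq (fun v w ↦ g.inner x v w) (0 : TangentSpace I x →L[ℝ] ℝ) := by
    refine Real.sSup_nonneg ?_
    rintro _ ⟨w, -, rfl⟩
    exact sq_nonneg _
  have h3 := mul_pos hδ (add_pos_of_pos_of_nonneg (g.pos x _ h0) h2)
  exact absurd (h3.trans_le h1) (lt_irrefl 0)

end GradientLike

/-! ### The backward flow of a gradient-like field -/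

section BackwardFlow

open Filter
open scoped Topology NNReal

section General

variable {E : Type*} [NormedAddCommGroup E] [NormedSpace ℝ E]
  {H : Type*} [TopologicalSpace H] {I : ModelWithCorners ℝ E H}
  {M : Type*} [TopologicalSpace M] [ChartedSpace H M] [IsManifold I ∞ M]
  {X : ∀ x : M, TangentSpace I x} {φ : M → ℝ} {γ : ℝ → M}

/-- A function is nonincreasing along the backward orbits of a gradient-like field. -/
theorem IsGradientLike.antitoneOn (h : IsGradientLike I X φ) (hφ : ContMDiff I 𝓘(ℝ, ℝ) ∞ φ)
    (hγ : IsMIntegralCurveOn γ (-X) (Ici 0)) : AntitoneOn (fun t ↦ φ (γ t)) (Ici 0) := by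
  have hd := fun t (ht : t ∈ Ici (0 : ℝ)) ↦ hγ.hasDerivWithinAt_comp hφ ht
  refine antitoneOn_of_hasDerivWithinAt_nonpos (convex_Ici 0)
    (fun t ht ↦ (hd t ht).continuousWithinAt)
    (fun t ht ↦ (hd t (interior_subset ht)).mono interior_subset) fun t _ ↦ ?_
  have h1 := h.mfderiv_nonneg (γ t)
  have h2 : (mfderiv I 𝓘(ℝ, ℝ) φ (γ t) ((-X) (γ t)) : ℝ) =
      -id (α := ℝ) (mfderiv I 𝓘(ℝ, ℝ) φ (γ t) (X (γ t))) :=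
    ContinuousLinearMap.map_neg (mfderiv I 𝓘(ℝ, ℝ) φ (γ t)) (X (γ t))
  rw [h2]
  exact neg_nonpos.2 h1

/-- This makes `φ` a strict Lyapunov function: if it does not drop by time `T` it is constant on
`[0, T]`, and its one-sided derivative at `0` gives `dφ(X) = 0`. -/
theorem IsGradientLike.isCriticalPt_of_le (h : IsGradientLike I X φ)
    (hφ : ContMDiff I 𝓘(ℝ, ℝ) ∞ φ) (hγ : IsMIntegralCurveOn γ (-X) (Ici 0)) {T : ℝ} (hT : 0 < T)
    (heq : φ (γ 0) ≤ φ (γ T)) : IsCriticalPt I φ (γ 0) := by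
  have hanti := h.antitoneOn hφ hγ
  have hconst : ∀ t ∈ Icc 0 T, φ (γ t) = φ (γ 0) := fun t ht ↦
    le_antisymm (hanti self_mem_Ici ht.1 ht.1) (heq.trans (hanti ht.1 hT.le ht.2))
  have h0 : HasDerivWithinAt (fun t ↦ φ (γ t)) (0 : ℝ) (Icc 0 T) 0 :=
    (hasDerivWithinAt_const (0 : ℝ) (Icc 0 T) (φ (γ 0))).congr hconst rfl
  have h1 := (hγ.hasDerivWithinAt_comp hφ self_mem_Ici).mono
    fun u (hu : u ∈ Icc 0 T) ↦ hu.1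
  have h2 := (uniqueDiffOn_Icc hT 0 ⟨le_rfl, hT.le⟩).eq_deriv _ h1 h0
  refine h.isCriticalPt_of_mfderiv_eq_zero ?_
  refine neg_eq_zero.1 (Eq.trans ?_ h2)
  exact (ContinuousLinearMap.map_neg (mfderiv I 𝓘(ℝ, ℝ) φ (γ 0)) (X (γ 0))).symm

theorem IsGradientLike.semiflow_eq_of_isCriticalPt [T2Space M] (h : IsGradientLike I X φ)
    (hX : ContMDiff I I.tangent ∞ (fun x ↦ (⟨x, (-X) x⟩ : TangentBundle I M)))
    (hγ : IsMIntegralCurveOn γ (-X) (Ici 0)) (hc : IsCriticalPt I φ (γ 0)) {t : ℝ} (ht : 0 ≤ t) :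
    γ t = γ 0 := by
  have h0 : (-X) (γ 0) = 0 := by
    rw [Pi.neg_apply, h.eq_zero_of_isCriticalPt hc, neg_zero]
  exact (hγ.mono Icc_subset_Ici_self).eqOn_Icc hX
    ((isMIntegralCurve_const h0).isMIntegralCurveOn (Icc 0 t)) (t₀ := 0) ⟨le_rfl, ht⟩ rfl
    ⟨ht, le_rfl⟩

/-- A semiflow by integral curves of a smooth field can be reversed at interior points. -/
theorem exists_mem_range_semiflow [CompleteSpace E] [T2Space M] {v : ∀ x : M, TangentSpace I x}
    (hv : ContMDiff I I.tangent ∞ (fun x ↦ (⟨x, v x⟩ : TangentBundle I M))) {Ψ : ℝ → M → M}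
    (hΨ : ∀ x, IsMIntegralCurveOn (fun t ↦ Ψ t x) v (Ici 0)) (h0 : ∀ x, Ψ 0 x = x) {x : M}
    (hx : I.IsInteriorPoint x) : ∃ δ > 0, x ∈ range (Ψ δ) := by
  obtain ⟨γ, rfl, hγ⟩ := exists_isMIntegralCurveAt_of_contMDiffAt 0
    ((hv x).of_le (by norm_num)) hx
  obtain ⟨ε, hε, hγ⟩ := isMIntegralCurveAt_iff'.1 hγ
  refine ⟨ε / 2, half_pos hε, γ (-(ε / 2)), ?_⟩
  have h1 : IsMIntegralCurveOn (γ ∘ (· - ε / 2)) v (Icc 0 (ε / 2)) := by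
    refine (isMIntegralCurveOn_comp_sub.2 hγ).mono fun t ht ↦ ?_
    rw [mem_ofPred_eq, Metric.mem_ball, Real.dist_eq, sub_zero, abs_lt]
    constructor <;> linarith [ht.1, ht.2]
  have h2 := ((hΨ (γ (-(ε / 2)))).mono Icc_subset_Ici_self).eqOn_Icc hv h1 (t₀ := 0)
    ⟨le_rfl, (half_pos hε).le⟩ (by simp [h0]) ⟨(half_pos hε).le, le_rfl⟩
  rw [Function.comp_apply, sub_self] at h2
  exact h2

end General

variable {n : ℕ} [NeZero (2 * n)] {V : Type*} [TopologicalSpace V] [CompactSpace V] [T2Space V]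
  [ChartedSpace (EuclideanHalfSpace (2 * n)) V] [IsManifold (𝓡∂ (2 * n)) ∞ V]

theorem WeinsteinDomain.contMDiff_neg (W : WeinsteinDomain n V) :
    ContMDiff (𝓡∂ (2 * n)) (𝓡∂ (2 * n)).tangent ∞
      (fun x ↦ (⟨x, (-W.X) x⟩ : TangentBundle (𝓡∂ (2 * n)) V)) :=
  W.isLiouville.smooth.neg_section

theorem WeinsteinDomain.chartField_neg_pos (W : WeinsteinDomain n V) :
    ∀ x ∈ (𝓡∂ (2 * n)).boundary V, 0 < chartField (-W.X) x (extChartAt (𝓡∂ (2 * n)) x x) 0 := by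
  intro x hx
  rw [chartField_extChartAt (mem_extChartAt_source x)]
  have h1 : (mfderiv (𝓡∂ (2 * n)) 𝓘(ℝ, EuclideanSpace ℝ (Fin (2 * n)))
      (extChartAt (𝓡∂ (2 * n)) x) x ((-W.X) x) : EuclideanSpace ℝ (Fin (2 * n))) =
      -id (α := EuclideanSpace ℝ (Fin (2 * n))) (mfderiv (𝓡∂ (2 * n))
        𝓘(ℝ, EuclideanSpace ℝ (Fin (2 * n))) (extChartAt (𝓡∂ (2 * n)) x) x (W.X x)) :=
    ContinuousLinearMap.map_neg _ (W.X x)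
  rw [h1]
  exact neg_pos.2 (W.outward x hx)

/-- Critical points are exactly the points where `φ` does not drop in unit time. They form a closed,
hence compact set, and they are isolated. -/
theorem WeinsteinDomain.finite_isCriticalPt (W : WeinsteinDomain n V) {Ψ : ℝ → V → V}
    (hΨ : IsInjectiveSemiflow Ψ) (hint : ∀ x, IsMIntegralCurveOn (fun t ↦ Ψ t x) (-W.X) (Ici 0)) :
    {x | IsCriticalPt (𝓡∂ (2 * n)) W.φ x}.Finite := by
  have heq : {x | IsCriticalPt (𝓡∂ (2 * n)) W.φ x} = {x | W.φ (Ψ 1 x) = W.φ x} := by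
    ext x
    constructor
    · intro hx
      have h1 := W.isGradientLike.semiflow_eq_of_isCriticalPt W.contMDiff_neg (hint x)
        (by rwa [hΨ.zero]) zero_le_one
      rw [hΨ.zero] at h1
      exact congrArg W.φ h1
    · intro hx
      have h1 := W.isGradientLike.isCriticalPt_of_le W.isGeneralizedMorse.1 (hint x) zero_lt_one
        (by rw [hΨ.zero]; exact hx.ge)
      rwa [hΨ.zero] at h1
  have hφ : Continuous W.φ := W.isGeneralizedMorse.1.continuous
  have hcpt : IsCompact {x | IsCriticalPt (𝓡∂ (2 * n)) W.φ x} := by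
    rw [heq]
    exact (isClosed_eq (hφ.comp (hΨ.continuous zero_le_one)) hφ).isCompact
  obtain ⟨t, ht⟩ := hcpt.elim_nhds_subcover'
    (fun p _ ↦ {q | IsCriticalPt (𝓡∂ (2 * n)) W.φ q → q = p}) fun p hp ↦
      W.isGeneralizedMorse.eventually_eq hp (W.range_mem_nhds hp)
  refine (t.finite_toSet.image Subtype.val).subset fun x hx ↦ ?_
  obtain ⟨p, hp, hxp⟩ := mem_iUnion₂.1 (ht hx)
  exact ⟨p, hp, (hxp hx).symm⟩

/-- The core of the backward flow of a Weinstein domain is at most half-dimensional. -/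
theorem WeinsteinDomain.coveredByLipschitz_core (W : WeinsteinDomain n V) {Ψ : ℝ → V → V}
    (hΨ : IsInjectiveSemiflow Ψ) (hint : ∀ x, IsMIntegralCurveOn (fun t ↦ Ψ t x) (-W.X) (Ici 0))
    (hlip : ∀ x₀ : V, ∃ N ∈ 𝓝 x₀, N ⊆ (extChartAt (𝓡∂ (2 * n)) x₀).source ∧ ∃ ε > 0, ∃ C : ℝ≥0,
      ∀ t ∈ Icc 0 ε, MapsTo (Ψ t) N (extChartAt (𝓡∂ (2 * n)) x₀).source ∧ LipschitzOnWith C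
        (fun y ↦ extChartAt (𝓡∂ (2 * n)) x₀ (Ψ t ((extChartAt (𝓡∂ (2 * n)) x₀).symm y)))
          (extChartAt (𝓡∂ (2 * n)) x₀ '' N)) :
    CoveredByLipschitzInCharts (𝓡∂ (2 * n)) n (semiflowCore Ψ) := by
  have hfin := W.finite_isCriticalPt hΨ hint
  have := hfin.to_subtype
  have hU := fun p : {x | IsCriticalPt (𝓡∂ (2 * n)) W.φ x} ↦ W.exists_nhds_coveredByLipschitz p.2
  choose U hU hUc using hU
  have hφ := W.isGeneralizedMorse.1
  -- The core is covered by countably many pieces: images under `Ψ k` of the local stable sets of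
  -- the finitely many critical points.
  refine (CoveredByLipschitzInCharts.iUnion (fun z : {x | IsCriticalPt (𝓡∂ (2 * n)) W.φ x} × ℕ ↦
    (hUc z.1).image_semiflow hΨ hlip z.2.cast_nonneg)).mono ?_
  intro x hx
  obtain ⟨γ, -, hγx, hγ⟩ := hΨ.exists_backward_orbit hx
  have hcurve := isMIntegralCurveOn_backward_orbit hint hγ
  rw [neg_neg] at hcurve
  classical
  obtain ⟨p, hp, k, hk⟩ := exists_tail_mem_of_lyapunov hφ.continuous (hΨ.continuous zero_le_one)
    (fun t ht x ↦ by
      have : W.φ (Ψ t x) ≤ W.φ (Ψ 0 x) :=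
        W.isGradientLike.antitoneOn hφ (hint x) self_mem_Ici ht ht
      rwa [hΨ.zero] at this)
    hfin (fun x hx ↦ by
      have h1 := W.isGradientLike.isCriticalPt_of_le hφ (hint x) zero_lt_one
        (by rw [hΨ.zero]; exact hx.ge)
      rwa [hΨ.zero] at h1) hγ hcurve.continuousOn
    (U := fun x ↦ if h : IsCriticalPt (𝓡∂ (2 * n)) W.φ x then U ⟨x, h⟩ else univ)
    (fun p hp ↦ by
      rw [dif_pos (show IsCriticalPt (𝓡∂ (2 * n)) W.φ p from hp)]
      exact hU ⟨p, hp⟩)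
  rw [dif_pos (show IsCriticalPt (𝓡∂ (2 * n)) W.φ p from hp)] at hk
  refine mem_iUnion.2 ⟨(⟨p, hp⟩, k), γ k, ⟨fun t ↦ γ (t + k), ?_, ?_, fun t ht ↦ ?_⟩,
    hγx k k.cast_nonneg⟩
  · exact congrArg γ (zero_add _)
  · exact (hcurve.comp_add k).mono fun t (ht : 0 ≤ t) ↦
      show 0 ≤ t + k from add_nonneg ht k.cast_nonneg
  · exact hk _ (le_add_of_nonneg_left ht)

/-- The backward flow of a Weinstein domain enters through the boundary. -/
theorem WeinsteinDomain.isEntrance_boundary (W : WeinsteinDomain n V) {Ψ : ℝ → V → V}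
    (hΨ : IsInjectiveSemiflow Ψ) (hint : ∀ x, IsMIntegralCurveOn (fun t ↦ Ψ t x) (-W.X) (Ici 0)) :
    IsEntrance Ψ ((𝓡∂ (2 * n)).boundary V) := by
  have hφ := W.isGeneralizedMorse.1
  obtain ⟨c, hc, hB⟩ := W.boundary_level
  refine ⟨?_, fun t ht x hx ↦ ?_, fun x hx ↦ ?_⟩
  · rw [hB]
    exact isClosed_eq hφ.continuous continuous_const
  -- On the boundary `φ` is maximal. An orbit ending there cannot have lost height, so it starts at
  -- a critical point and is constant, contradicting regularity of the boundary.
  · have h1 : W.φ (Ψ t x) = c := by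
      rwa [hB] at hx
    have h2 := W.isGradientLike.antitoneOn hφ (hint x) self_mem_Ici ht.le ht.le
    have h3 := W.isGradientLike.isCriticalPt_of_le hφ (hint x) ht
      (by rw [h1]; exact hc _)
    have h4 := W.isGradientLike.semiflow_eq_of_isCriticalPt W.contMDiff_neg (hint x) h3 ht.le
    refine W.boundary_regular _ hx ?_
    rwa [h4]
  · rw [← mem_compl_iff, ModelWithCorners.compl_boundary] at hx
    exact exists_mem_range_semiflow W.contMDiff_neg hint hΨ.zero hx

end BackwardFlow

/-! ### Simply connected neighbourhoods in charts -/

section Traces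

open Filter
open scoped Topology NNReal

variable {E : Type*} [NormedAddCommGroup E] [NormedSpace ℝ E]
  {H : Type*} [TopologicalSpace H] {I : ModelWithCorners ℝ E H}
  {M : Type*} [TopologicalSpace M] [ChartedSpace H M]

theorem Convex.isSimplyConnected {s : Set E} (hs : Convex ℝ s) (hne : s.Nonempty) :
    IsSimplyConnected s := by
  have := hs.contractibleSpace hne
  exact (inferInstance : SimplyConnectedSpace s)

theorem isEmbedding_extChartAt_symm (x : M) :
    Topology.IsEmbedding fun y : (extChartAt I x).target ↦ (extChartAt I x).symm y := by
  let h : (extChartAt I x).target ≃ₜ (extChartAt I x).source :=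
    { (extChartAt I x).toEquiv.symm with
      continuous_toFun :=
        ((continuousOn_extChartAt_symm x).domRestrict).subtype_mk _
      continuous_invFun :=
        ((continuousOn_extChartAt x).domRestrict).subtype_mk _ }
  exact Topology.IsEmbedding.subtypeVal.comp h.isEmbedding

theorem IsSimplyConnected.image_extChartAt_symm {x : M} {S : Set E} (hS : IsSimplyConnected S)
    (hx : S ⊆ (extChartAt I x).target) : IsSimplyConnected ((extChartAt I x).symm '' S) := by
  have h1 : Subtype.val '' ((↑) ⁻¹' S : Set (extChartAt I x).target) = S :=
    Subtype.image_preimage_val _ _ |>.trans (inter_eq_right.2 hx)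
  have h2 : (fun y : (extChartAt I x).target ↦ (extChartAt I x).symm y) '' ((↑) ⁻¹' S) =
      (extChartAt I x).symm '' S := by
    rw [← h1, image_image, h1]
  rw [← h2, (isEmbedding_extChartAt_symm x).isSimplyConnected_image,
    ← Topology.IsEmbedding.subtypeVal.isSimplyConnected_image, h1]
  exact hS

/-- Small balls in charts are neighbourhoods. -/
theorem exists_chart_ball {x : M} {N : Set M} (hN : N ∈ 𝓝 x) {ρ : ℝ} (hρ : 0 < ρ) :
    ∃ r > 0, r ≤ ρ ∧ Metric.ball (extChartAt I x x) r ∩ range I ⊆ (extChartAt I x).target ∧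
      (extChartAt I x).symm '' (Metric.ball (extChartAt I x x) r ∩ range I) ⊆ N ∧
      (extChartAt I x).symm '' (Metric.ball (extChartAt I x x) r ∩ range I) ∈ 𝓝 x := by
  have h1 : (extChartAt I x).symm ⁻¹' N ∈ 𝓝 (extChartAt I x x) :=
    (continuousAt_extChartAt_symm x).preimage_mem_nhds (by rwa [extChartAt_to_inv])
  obtain ⟨r, hr, h⟩ := Metric.mem_nhdsWithin_iff.1 (inter_mem
    (extChartAt_target_mem_nhdsWithin (I := I) x) (mem_nhdsWithin_of_mem_nhds h1))
  have hball := Metric.ball_subset_ball (x := extChartAt I x x) (min_le_left r ρ)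
  have h' : Metric.ball (extChartAt I x x) (min r ρ) ∩ range I ⊆ _ :=
    (inter_subset_inter_left _ hball).trans h
  refine ⟨min r ρ, lt_min hr hρ, min_le_right _ _, fun y hy ↦ (h' hy).1,
    image_subset_iff.2 fun y hy ↦ (h' hy).2, ?_⟩
  filter_upwards [extChartAt_source_mem_nhds (I := I) x, (continuousAt_extChartAt (I := I)
    x).preimage_mem_nhds (Metric.ball_mem_nhds _ (lt_min hr hρ))] with y hy hyr
  exact ⟨_, ⟨hyr, mem_range_self _⟩, (extChartAt I x).left_inv hy⟩

theorem convex_chart_ball (x : M) (r : ℝ) :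
    Convex ℝ (Metric.ball (extChartAt I x x) r ∩ range I) :=
  (convex_ball _ r).inter I.convex_range

/-- Manifolds with boundary are locally simply connected. -/
theorem exists_isSimplyConnected_nhds (I : ModelWithCorners ℝ E H) {x : M} {N : Set M} (hN : N ∈ 𝓝 x) :
    ∃ B ∈ 𝓝 x, B ⊆ N ∧ IsSimplyConnected B := by
  obtain ⟨r, hr, -, htar, hsub, hnhds⟩ := exists_chart_ball (I := I) hN one_pos
  exact ⟨_, hnhds, hsub, ((convex_chart_ball x r).isSimplyConnected
    ⟨_, Metric.mem_ball_self hr, mem_range_self _⟩).image_extChartAt_symm htar⟩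

theorem hasSimplyConnectedTraces_univ (I : ModelWithCorners ℝ E H) : HasSimplyConnectedTraces (univ : Set M) := by
  intro x N hN
  obtain ⟨B, hB, hBN, hs⟩ := exists_isSimplyConnected_nhds I hN
  exact ⟨B, hB, hBN, by rwa [inter_univ]⟩

/-- The complement of a closed set of codimension at least three in the interior of a manifold has
simply connected traces. -/
theorem CoveredByLipschitzInCharts.hasSimplyConnectedTraces_compl [FiniteDimensional ℝ E] {n : ℕ}
    (hn : n + 3 ≤ Module.finrank ℝ E) {T : Set M} (hT : CoveredByLipschitzInCharts I n T)
    (hc : IsClosed T) (hint : ∀ x ∈ T, I.IsInteriorPoint x) : HasSimplyConnectedTraces Tᶜ := by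
  intro x N hN
  by_cases hx : x ∈ T
  -- At a point of `T` a whole ball of the model space lies in the chart, so the codimension three
  -- result applies; away from `T` a small neighbourhood misses it.
  · have hr := range_mem_nhds_isInteriorPoint (hint x hx)
    obtain ⟨ρ, hρ, hρI⟩ := Metric.mem_nhds_iff.1 hr
    obtain ⟨r, hr0, hr, htar, hsub, hnhds⟩ := exists_chart_ball (I := I) hN hρ
    rw [inter_eq_left.2 ((Metric.ball_subset_ball hr).trans hρI)] at htar hsub hnhds
    set e := extChartAt I x
    set D := Metric.ball (e x) r
    have himage : e '' (T ∩ e.source) ∩ e.target = e.target ∩ e.symm ⁻¹' T := by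
      ext y
      constructor
      · rintro ⟨⟨z, ⟨hz, hze⟩, rfl⟩, hy⟩
        exact ⟨hy, by rwa [mem_preimage, e.left_inv hze]⟩
      · exact fun ⟨hy, hyT⟩ ↦ ⟨⟨_, ⟨hyT, e.map_target hy⟩, e.right_inv hy⟩, hy⟩
    have hmem : ∀ y ∈ D, y ∈ e '' (T ∩ e.source) ↔ e.symm y ∈ T := by
      intro y hy
      have := Set.ext_iff.1 himage y
      simpa only [mem_inter_iff, mem_preimage, htar hy, and_true, true_and] using this
    have hopen : IsOpen (D \ e '' (T ∩ e.source)) := by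
      have h1 : D \ e '' (T ∩ e.source) = D ∩ e.symm ⁻¹' Tᶜ := by
        ext y
        exact and_congr_right fun hy ↦ not_congr (hmem y hy)
      rw [h1]
      exact ((continuousOn_extChartAt_symm x).mono htar).isOpen_inter_preimage Metric.isOpen_ball
        hc.isOpen_compl
    have hs := CoveredByLipschitz.isSimplyConnected_diff hn Metric.isOpen_ball (convex_ball (e x) r)
      ⟨_, Metric.mem_ball_self hr0⟩ hopen ((hT x).mono inter_subset_right)
    refine ⟨_, hnhds, hsub, ?_⟩
    have h2 : e.symm '' D ∩ Tᶜ = e.symm '' (D \ e '' (T ∩ e.source)) := by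
      ext z
      constructor
      · rintro ⟨⟨y, hy, rfl⟩, hz⟩
        exact ⟨y, ⟨hy, fun h ↦ hz ((hmem y hy).1 h)⟩, rfl⟩
      · rintro ⟨y, ⟨hy, hyT⟩, rfl⟩
        exact ⟨⟨y, hy, rfl⟩, fun h ↦ hyT ((hmem y hy).2 h)⟩
    rw [h2]
    exact hs.image_extChartAt_symm (sdiff_subset.trans htar)
  · obtain ⟨B, hB, hBN, hs⟩ := exists_isSimplyConnected_nhds I
      (inter_mem hN (hc.isOpen_compl.mem_nhds hx))
    refine ⟨B, hB, hBN.trans inter_subset_left, ?_⟩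
    rwa [inter_eq_left.2 (hBN.trans inter_subset_right)]

end Traces

theorem mainTheorem4 (n : ℕ) (hn : 3 ≤ n) [NeZero (2 * n)]
    (V : Type*) [TopologicalSpace V] [CompactSpace V] [T2Space V]
    [ChartedSpace (EuclideanHalfSpace (2 * n)) V] [IsManifold (𝓡∂ (2 * n)) ∞ V]
    (W : WeinsteinDomain n V) (b : (𝓡∂ (2 * n)).boundary V) :
    Function.Bijective (FundamentalGroup.map (boundaryInclusion (𝓡∂ (2 * n)) V) b) := by
  -- Any compatible metric will do; it only serves the Lebesgue number arguments.
  have := Manifold.metrizableSpace (𝓡∂ (2 * n)) V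
  let := TopologicalSpace.metrizableSpaceMetric V
  obtain ⟨Ψ, hΨ, hint, hlip⟩ := exists_semiflow_of_inward W.contMDiff_neg W.chartField_neg_pos
  have hB := W.isEntrance_boundary hΨ hint
  refine hB.bijective_fundamentalGroup_map hΨ
    ((W.coveredByLipschitz_core hΨ hint hlip).hasSimplyConnectedTraces_compl ?_
      hΨ.isClosed_core fun x hx ↦ ?_)
    (hasSimplyConnectedTraces_univ (𝓡∂ (2 * n))) (boundaryInclusion (𝓡∂ (2 * n)) V)
    (fun _ ↦ rfl) b
  -- Codimension three, `n + 3 ≤ 2 * n`, is where `3 ≤ n` enters.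
  · rw [finrank_euclideanSpace, Fintype.card_fin]
    omega
  · by_contra h
    exact hB.notMem_core hΨ le_rfl
      ((ModelWithCorners.isBoundaryPoint_iff_not_isInteriorPoint x).2 h) (by rwa [hΨ.zero])
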